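/- Let $\nu\in\mathbb N$, $\langle x\rangle=(1+|x|^2)^{1/2}$, $D_x=-\mathrm i\nabla_x$. Assume: (a) $\Omega:\mathbb R^\nu\to[0,\infty)$ is real-analytic and rotation invariant, and there is $s\in[0,2]$ such that $\Omega(\eta)\ge C^{-1}\langle\eta\rangle^{s}-C$ for some $C>0$ and, for every multi-index $\alpha$, $|\partial^\alpha\Omega(\eta)|\le C_\alpha\langle\eta\rangle^{s-|\alpha|}$. (b) $\omega:\mathbb R^\nu\to[0,\infty)$ is real-analytic and rotation invariant, $\partial^\alpha\omega$ is bounded for every $|\alpha|\ge1$, and, if $s=0$, $\omega(k)\to\infty$ as $|k|\to\infty$. (c) $\rho\in L^2(\mathbb R^\nu)$ is rotation invariant, $\hat\rho\in C^2(\mathbb R^\nu)$, $\langle\cdot\rangle|\nabla\hat\rho|$ and $\langle\cdot\rangle\|\nabla^2\hat\rho\|$ belong to $L^2(\mathbb R^\nu)$, and $|\rho(x)|\le C\langle x\rangle^{-1-\nu/2-\mu}$ for some $C,\mu>0$. For $P\in\mathbb R^\nu$ let $$H(P)=\begin{pmatrix}\Omega(P)&0\\0&\Omega(P-D_x)+\omega(D_x)\end{pmatrix}+\begin{pmatrix}0&\langle\rho|\\|\rho\rangle&0\end{pmatrix}$$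 be the self-adjoint fiber Hamiltonian on $\mathcal K=\mathbb C\oplus L^2(\mathbb R^\nu)$, with domain $\mathcal D=\mathbb C\oplus\mathcal D(\Omega(P-D_x)+\omega(D_x))$, and let $$\theta(P)=\{\lambda\in\mathbb R\mid\exists k\in\mathbb R^\nu:\ \lambda=\Omega(P-k)+\omega(k),\ \nabla\Omega(P-k)=\nabla\omega(k)\}.$$ Let $v_P(k)=\nabla\omega(k)-\nabla\Omega(P-k)$, let $a_P$ be the closure of $\tfrac12\bigl(v_P(D_x)\cdot x+x\cdot v_P(D_x)\bigr)$ defined on the Schwartz space, and let $A_P=\begin{pmatrix}0&0\\0&a_P\end{pmatrix}$ on $\mathbb C\oplus\mathcal D(a_P)$. **Theorem.** Let $P\in\mathbb R^\nu$ and $\lambda\in\mathbb R\setminus\theta(P)$. Then the commutator form $[H(P),\mathrm iA_P]$ on $\mathcal D(A_P)\cap\mathcal D$ has a unique extension $[H(P),\mathrm iA_P]^\circ\in\mathcal B(\mathcal D;\mathcal D^*)$, and there exist constants $\kappa,c>0$ and a compact operator $K$ on $\mathcal K$ such that $$E_{\lambda,\kappa}(H(P))\,[H(P),\mathrm iA_P]^\circ\,E_{\lambda,\kappa}(H(P))\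 \ge\ c\,E_{\lambda,\kappa}(H(P))+K,$$ where $E_{\lambda,\kappa}(H(P))$ is the spectral projection of $H(P)$ for the interval $[\lambda-\kappa,\lambda+\kappa]$. -/

import Mathlib

open MeasureTheory Set Filter Topology
open scoped InnerProductSpace SchwartzMap ENNReal FourierTransform

noncomputable section

/-! ## Spectral projections of unbounded operators -/

section Abstract

variable {𝓗 : Type*} [NormedAddCommGroup 𝓗] [InnerProductSpace ℂ 𝓗]

/-- A projection-valued measure on the Borel sets of the real line: orthogonal projections,
strongly countably additive, of total mass the identity (values on non-measurable sets are
irrelevant). -/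
structure ProjectionValuedMeasure (𝓗 : Type*) [NormedAddCommGroup 𝓗] [InnerProductSpace ℂ 𝓗]
    [CompleteSpace 𝓗] where
  /-- The projection attached to a set. -/
  proj : Set ℝ → 𝓗 →L[ℂ] 𝓗
  isStarProjection : ∀ S, MeasurableSet S → IsStarProjection (proj S)
  univ : proj Set.univ = 1
  iUnion : ∀ S : ℕ → Set ℝ, (∀ i, MeasurableSet (S i)) → Pairwise (Function.onFun Disjoint S) →
    ∀ u : 𝓗, HasSum (fun i => proj (S i) u) (proj (⋃ i, S i) u)

namespace ProjectionValuedMeasure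

variable [CompleteSpace 𝓗]

theorem proj_empty (E : ProjectionValuedMeasure 𝓗) : E.proj ∅ = 0 := by
  ext u
  have h := E.iUnion (fun _ => ∅) (fun _ => MeasurableSet.empty)
    (fun _ _ _ => disjoint_bot_left) u
  simpa using tendsto_nhds_unique tendsto_const_nhds h.summable.tendsto_atTop_zero

theorem inner_proj_nonneg (E : ProjectionValuedMeasure 𝓗) (u : 𝓗) {S : Set ℝ}
    (hS : MeasurableSet S) : 0 ≤ (⟪u, E.proj S u⟫_ℂ).re :=
  (ContinuousLinearMap.IsPositive.of_isStarProjection (E.isStarProjection S hS)).re_inner_nonneg_right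
    u

/-- The measure `S ↦ ⟪u, E(S) u⟫`. -/
def scalarMeasure (E : ProjectionValuedMeasure 𝓗) (u : 𝓗) : Measure ℝ :=
  Measure.ofMeasurable (fun S _ => ENNReal.ofReal (⟪u, E.proj S u⟫_ℂ).re)
    (by simp [E.proj_empty])
    (by
      intro S hS hd
      have h := (Complex.reCLM.hasSum ((innerSL ℂ u).hasSum (E.iUnion S hS hd u)))
      simp only [Complex.reCLM_apply, innerSL_apply_apply] at h
      rw [← h.tsum_eq, ENNReal.ofReal_tsum_of_nonneg
        (fun i => E.inner_proj_nonneg u (hS i)) h.summable])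

end ProjectionValuedMeasure

/-- `E` is the spectral measure of the operator `H`, i.e. `H = ∫ t dE(t)`:
`u ∈ D(H)` iff `∫ t² d⟪u, E u⟫ < ∞`, and `⟪u, H u⟫ = ∫ t d⟪u, E u⟫` for `u ∈ D(H)`. -/
def IsSpectralMeasure [CompleteSpace 𝓗] (H : 𝓗 →ₗ.[ℂ] 𝓗) (E : ProjectionValuedMeasure 𝓗) :
    Prop :=
  (∀ u : 𝓗, u ∈ H.domain ↔ Integrable (fun t : ℝ => t ^ 2) (E.scalarMeasure u)) ∧
  ∀ u : H.domain, ⟪(u : 𝓗), H u⟫_ℂ = ((∫ t : ℝ, t ∂(E.scalarMeasure (u : 𝓗)) : ℝ) : ℂ)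

/-! ## Commutators -/

/-- `C` is an extension of the commutator form `[H, iA]`, defined on `D(A) ∩ D(H)`, to an element
of `𝓑(D(H); D(H)*)`: a sesquilinear form on `D(H)`, bounded with respect to the graph norm. -/
structure IsCommutatorExtension (H A : 𝓗 →ₗ.[ℂ] 𝓗) (C : H.domain →ₗ⋆[ℂ] H.domain →ₗ[ℂ] ℂ) :
    Prop where
  bounded : ∃ M : ℝ, ∀ u w : H.domain,
    ‖C u w‖ ≤ M * (‖(u : 𝓗)‖ + ‖H u‖) * (‖(w : 𝓗)‖ + ‖H w‖)
  extend : ∀ (u w : H.domain) (hu : (u : 𝓗) ∈ A.domain) (hw : (w : 𝓗) ∈ A.domain),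
    C u w = ⟪H u, Complex.I • A ⟨w, hw⟩⟫_ℂ - ⟪(-Complex.I) • A ⟨u, hu⟩, H w⟫_ℂ

/-- The bounded operator `T` is `p C p`, where `p` is a bounded self-adjoint operator with range in
`D(H)` and `C` is a sesquilinear form on `D(H)`. -/
def IsSandwich (H : 𝓗 →ₗ.[ℂ] 𝓗) (C : H.domain →ₗ⋆[ℂ] H.domain →ₗ[ℂ] ℂ) (p T : 𝓗 →L[ℂ] 𝓗) :
    Prop :=
  ∃ hp : ∀ u : 𝓗, p u ∈ H.domain,
    ∀ u w : 𝓗, ⟪u, T w⟫_ℂ = C ⟨p u, hp u⟩ ⟨p w, hp w⟩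

end Abstract

/-! ## The model -/

/-- `ℝ^ν`. -/
abbrev Space (ν : ℕ) : Type := EuclideanSpace ℝ (Fin ν)

/-- `L²(ℝ^ν)`. -/
abbrev L2 (ν : ℕ) : Type := Lp ℂ 2 (volume : Measure (Space ν))

/-- The Hilbert space `ℂ ⊕ L²(ℝ^ν)`. -/
abbrev FiberSpace (ν : ℕ) : Type := WithLp 2 (ℂ × L2 ν)

variable {ν : ℕ}

/-- `⟨x⟩ = (1 + x²)^{1/2}`. -/
def japaneseBracket (x : Space ν) : ℝ := Real.sqrt (1 + ‖x‖ ^ 2)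

/-- Rotation invariance: `f (O x) = f x` for a.e. `x`, for every orthogonal `O`. -/
def RotationInvariant {β : Type*} (f : Space ν → β) : Prop :=
  ∀ O : Space ν ≃ₗᵢ[ℝ] Space ν, ∀ᵐ x, f (O x) = f x

/-- The assumptions on the matter particle dispersion relation `Ω`, with growth exponent `s`. -/
structure MatterDispersion (s : ℝ) (Ω : Space ν → ℝ) : Prop where
  exponent_mem : s ∈ Icc (0 : ℝ) 2
  nonneg : ∀ η, 0 ≤ Ω η
  analytic : AnalyticOnNhd ℝ Ω Set.univ
  rotationInvariant : RotationInvariant Ω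
  lower_bound : ∃ C : ℝ, 0 < C ∧ ∀ η, C⁻¹ * japaneseBracket η ^ s - C ≤ Ω η
  deriv_bound : ∀ n : ℕ, ∃ C : ℝ, 0 < C ∧
    ∀ η, ‖iteratedFDeriv ℝ n Ω η‖ ≤ C * japaneseBracket η ^ (s - n)

/-- The assumptions on the field particle dispersion relation `ω`; `s` is the growth exponent of
the matter particle dispersion relation. -/
structure FieldDispersion (s : ℝ) (ω : Space ν → ℝ) : Prop where
  nonneg : ∀ k, 0 ≤ ω k
  analytic : AnalyticOnNhd ℝ ω Set.univ
  rotationInvariant : RotationInvariant ω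
  deriv_bound : ∀ n : ℕ, 1 ≤ n → ∃ C : ℝ, ∀ k, ‖iteratedFDeriv ℝ n ω k‖ ≤ C
  tendsto_atTop : s = 0 → Tendsto ω (cocompact (Space ν)) atTop

/-- The assumptions on the coupling function `ρ ∈ L²(ℝ^ν)`; `g` is the `C²` representative of the
Fourier transform of `ρ`. (The normalisation of the Fourier transform is immaterial here.) -/
structure CouplingFunction (ρ : L2 ν) : Prop where
  rotationInvariant : RotationInvariant (ρ : Space ν → ℂ)
  fourier : ∃ g : Space ν → ℂ, ((𝓕 ρ : L2 ν) : Space ν → ℂ) =ᵐ[volume] g ∧ ContDiff ℝ 2 g ∧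
    MemLp (fun k => japaneseBracket k * ‖fderiv ℝ g k‖) 2 volume ∧
    MemLp (fun k => japaneseBracket k * ‖iteratedFDeriv ℝ 2 g k‖) 2 volume
  short_range : ∃ C μ : ℝ, 0 < C ∧ 0 < μ ∧
    ∀ᵐ x, ‖(ρ : Space ν → ℂ) x‖ ≤ C * japaneseBracket x ^ (-1 - (ν : ℝ) / 2 - μ)

/-- The threshold set `θ(P)`. -/
def thresholdSet (Ω ω : Space ν → ℝ) (P : Space ν) : Set ℝ :=
  {lam | ∃ k : Space ν, lam = Ω (P - k) + ω k ∧ gradient Ω (P - k) = gradient ω k}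

/-- The maximal domain of multiplication by `m` in `L²(ℝ^ν)`. -/
def multiplicationDomain (m : Space ν → ℂ) : Submodule ℂ (L2 ν) where
  carrier := {u | MemLp (fun ξ => m ξ * (u : Space ν → ℂ) ξ) 2 volume}
  zero_mem' := by
    refine (memLp_congr_ae ?_).2 (MemLp.zero (ε := ℂ))
    filter_upwards [Lp.coeFn_zero ℂ 2 (volume : Measure (Space ν))] with ξ h
    rw [h, Pi.zero_apply, mul_zero]
  add_mem' := by
    intro u w hu hw
    refine (memLp_congr_ae ?_).2 (MemLp.add hu hw)
    filter_upwards [Lp.coeFn_add u w] with ξ h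
    rw [h, Pi.add_apply, Pi.add_apply, mul_add]
  smul_mem' := by
    intro c u hu
    refine (memLp_congr_ae ?_).2 (MemLp.const_smul hu c)
    filter_upwards [Lp.coeFn_smul c u] with ξ h
    rw [h, Pi.smul_apply, Pi.smul_apply, smul_eq_mul, smul_eq_mul, mul_left_comm]

/-- Multiplication by the function `m` in `L²(ℝ^ν)`, with its maximal domain. -/
def multiplicationOperator (m : Space ν → ℂ) : L2 ν →ₗ.[ℂ] L2 ν where
  domain := multiplicationDomain m
  toFun :=
    { toFun := fun u => MemLp.toLp (fun ξ => m ξ * ((u : L2 ν) : Space ν → ℂ) ξ) u.2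
      map_add' := by
        intro u w
        refine Eq.trans ?_ (MemLp.toLp_add u.2 w.2)
        refine MemLp.toLp_congr _ _ ?_
        filter_upwards [Lp.coeFn_add (u : L2 ν) (w : L2 ν)] with ξ h
        rw [Submodule.coe_add, h, Pi.add_apply, Pi.add_apply, mul_add]
      map_smul' := by
        intro c u
        refine Eq.trans ?_ (MemLp.toLp_const_smul c u.2)
        refine MemLp.toLp_congr _ _ ?_
        filter_upwards [Lp.coeFn_smul c (u : L2 ν)] with ξ h
        rw [Submodule.coe_smul, h, Pi.smul_apply, Pi.smul_apply, smul_eq_mul, smul_eq_mul,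
          mul_left_comm] }

/-- The Fourier transform on `L²(ℝ^ν)`, as a linear equivalence; it has the kernel
`exp (-2πi x·ξ)`, so that `D = -i∇` is multiplication by `2πξ` on the Fourier side. -/
def fourierEquivL2 (ν : ℕ) : L2 ν ≃ₗ[ℂ] L2 ν :=
  (Lp.fourierTransformₗᵢ (Space ν) ℂ).toLinearEquiv

/-- The self-adjoint operator `m(D)`, `D = -i∇`, on `L²(ℝ^ν)`, with its maximal domain, for a real
function `m`. -/
def multiplier (m : Space ν → ℝ) : L2 ν →ₗ.[ℂ] L2 ν where
  domain := (multiplicationOperator fun ξ : Space ν =>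
    (m ((2 * Real.pi) • ξ) : ℂ)).domain.comap (fourierEquivL2 ν : L2 ν →ₗ[ℂ] L2 ν)
  toFun := ((fourierEquivL2 ν).symm : L2 ν →ₗ[ℂ] L2 ν).comp
    ((multiplicationOperator fun ξ : Space ν => (m ((2 * Real.pi) • ξ) : ℂ)).toFun.comp
      ((fourierEquivL2 ν : L2 ν →ₗ[ℂ] L2 ν).restrict fun _ h => h))

/-- For an operator `e` in `ℂ` (a number) and an operator `T` in `L²(ℝ^ν)`, the diagonal operator
`(z, u) ↦ (e z, T u)` with domain `ℂ ⊕ D(T)`. -/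
def diagonal (e : ℂ) (T : L2 ν →ₗ.[ℂ] L2 ν) : FiberSpace ν →ₗ.[ℂ] FiberSpace ν where
  domain :=
    { carrier := {u | u.snd ∈ T.domain}
      zero_mem' := T.domain.zero_mem
      add_mem' := fun hu hw => T.domain.add_mem hu hw
      smul_mem' := fun c _ hu => T.domain.smul_mem c hu }
  toFun :=
    { toFun := fun u => WithLp.toLp 2 (e * u.1.fst, T ⟨u.1.snd, u.2⟩)
      map_add' := by
        intro u w
        have h : T ⟨(u + w).1.snd, (u + w).2⟩ = T ⟨u.1.snd, u.2⟩ + T ⟨w.1.snd, w.2⟩ := by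
          rw [← LinearPMap.map_add]; rfl
        rw [h, ← WithLp.toLp_add, Prod.mk_add_mk, ← mul_add]; rfl
      map_smul' := by
        intro c u
        have h : T ⟨(c • u).1.snd, (c • u).2⟩ = c • T ⟨u.1.snd, u.2⟩ := by
          rw [← LinearPMap.map_smul]; rfl
        rw [h, RingHom.id_apply, ← WithLp.toLp_smul, Prod.smul_mk, smul_eq_mul, mul_left_comm]
        rfl }

/-- The interaction `(z, u) ↦ (⟨ρ, u⟩, z ρ)`. -/
def interaction (ρ : L2 ν) : FiberSpace ν →ₗ[ℂ] FiberSpace ν where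
  toFun u := WithLp.toLp 2 (⟪ρ, u.snd⟫_ℂ, u.fst • ρ)
  map_add' u w := by
    rw [WithLp.add_snd, WithLp.add_fst, inner_add_right, add_smul]; rfl
  map_smul' c u := by
    rw [WithLp.smul_snd, WithLp.smul_fst, inner_smul_right, smul_assoc]; rfl

/-- The free fiber Hamiltonian `H₀(P) = diag (Ω(P), Ω(P - D) + ω(D))`. -/
def freeFiberHamiltonian (Ω ω : Space ν → ℝ) (P : Space ν) : FiberSpace ν →ₗ.[ℂ] FiberSpace ν :=
  diagonal (Ω P : ℂ) (multiplier fun k => Ω (P - k) + ω k)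

/-- The fiber Hamiltonian `H(P) = H₀(P) + V`, with domain `D(H₀(P))`. -/
def fiberHamiltonian (Ω ω : Space ν → ℝ) (ρ : L2 ν) (P : Space ν) :
    FiberSpace ν →ₗ.[ℂ] FiberSpace ν :=
  interaction ρ +ᵥ freeFiberHamiltonian Ω ω P

/-! ## The conjugate operator -/

/-- The `j`-th component `v_j(D)` of `v(D)` on Schwartz functions, `D = -i∇`. -/
def schwartzMultiplier (v : Space ν → Space ν) (j : Fin ν) : 𝓢(Space ν, ℂ) →L[ℂ] 𝓢(Space ν, ℂ) :=
  SchwartzMap.fourierMultiplierCLM ℂ fun ξ => ((v ((2 * Real.pi) • ξ) j : ℝ) : ℂ)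

/-- Multiplication by the coordinate `x_j` on Schwartz functions. -/
def schwartzPosition (j : Fin ν) : 𝓢(Space ν, ℂ) →L[ℂ] 𝓢(Space ν, ℂ) :=
  SchwartzMap.smulLeftCLM ℂ fun x : Space ν => ((x j : ℝ) : ℂ)

/-- `½ (v(D)·x + x·v(D))` on Schwartz functions. -/
def schwartzConjugate (v : Space ν → Space ν) : 𝓢(Space ν, ℂ) →ₗ[ℂ] 𝓢(Space ν, ℂ) :=
  (1 / 2 : ℂ) • ∑ j : Fin ν,
    (((schwartzMultiplier v j).comp (schwartzPosition j) +
      (schwartzPosition j).comp (schwartzMultiplier v j) :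
        𝓢(Space ν, ℂ) →L[ℂ] 𝓢(Space ν, ℂ)) : 𝓢(Space ν, ℂ) →ₗ[ℂ] 𝓢(Space ν, ℂ))

/-- The embedding of the Schwartz space in `L²(ℝ^ν)`. -/
def schwartzToL2 : 𝓢(Space ν, ℂ) →ₗ[ℂ] L2 ν :=
  (SchwartzMap.toLpCLM ℂ ℂ 2 (volume : Measure (Space ν)) : 𝓢(Space ν, ℂ) →L[ℂ] L2 ν)

theorem schwartzToL2_injective : Function.Injective (schwartzToL2 (ν := ν)) :=
  SchwartzMap.injective_toLp 2 (volume : Measure (Space ν))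

/-- The operator `½ (v(D)·x + x·v(D))` in `L²(ℝ^ν)` with domain the Schwartz space. -/
def oneBodyConjugateCore (v : Space ν → Space ν) : L2 ν →ₗ.[ℂ] L2 ν where
  domain := LinearMap.range (schwartzToL2 (ν := ν))
  toFun := (schwartzToL2.comp (schwartzConjugate v)).comp
    ((LinearEquiv.ofInjective (schwartzToL2 (ν := ν)) schwartzToL2_injective).symm :
      LinearMap.range (schwartzToL2 (ν := ν)) →ₗ[ℂ] 𝓢(Space ν, ℂ))

/-- The operator `a`, the closure of `½ (v(D)·x + x·v(D))` on the Schwartz space. -/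
def oneBodyConjugate (v : Space ν → Space ν) : L2 ν →ₗ.[ℂ] L2 ν :=
  (oneBodyConjugateCore v).closure

/-- The conjugate operator `A = diag (0, a)` on `ℂ ⊕ D(a)`. -/
def conjugateOperator (v : Space ν → Space ν) : FiberSpace ν →ₗ.[ℂ] FiberSpace ν :=
  diagonal 0 (oneBodyConjugate v)

/-- The vector field `v_P(k) = ∇ω(k) - ∇Ω(P - k)`. -/
def relativeVelocity (Ω ω : Space ν → ℝ) (P k : Space ν) : Space ν :=
  gradient ω k - gradient Ω (P - k)

end

/-!
Put `m(k) = Ω(P - k) + ω(k)` and `v = ∇m`, the relative velocity. In Fourier space `a` is the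
first-order operator `(i/2π) (w · ∇ + ½ div w)` with `w(ξ) = v(2πξ)` (`fourier_schwartzConjugate`),
so formally `[m(D), i a] = v · ∇m (D) = |v|²(D)`.

The commutator. As `s ≤ 2`, the function `|v|²` is bounded by a multiple of `m + 1`
(`sq_norm_relativeVelocity_le`), so `|v|²(D)` is a bounded form on the domain of `H(P)`. The
identity is obtained by integration by parts for the bounded functions `m / (1 + ε m)` on Schwartz
functions, carried over to the domain of the closure `a`, and then `ε → 0`
(`commutator_multiplier`). The interaction is of rank two and its commutator is the finite rank
operator `(z, u) ↦ (i ⟪τ, u⟫, -i z τ)` with `τ = a ρ`; the vector `τ` exists because `ρ̂` is `C¹`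
and `⟨·⟩ |∇ρ̂|` is square integrable, while `v` grows at most linearly
(`exists_adjoint_couplingFunction`). The extension is unique because vectors whose second component
is a Schwartz function are a core of `H(P)` contained in the domain of `A_P` (`exists_seq_core`).

Positivity. The energy `m` is proper, so its energy shells are compact, and `v` does not vanish on
the shell of a `λ` which is not a threshold. Hence there are `κ, c > 0` with `c ≤ |v|²` where
`|m - λ| ≤ 2 κ` (`exists_le_sq_norm_relativeVelocity`). Let `E` be the spectral projection of `H(P)`
for `[λ - κ, λ + κ]` and `Q` that of `m(D)` for `|m - λ| > 2 κ`. Then `|v|²(D) ≥ c (1 - Q)` on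
the one-particle sector, whose complement is one-dimensional, and it remains to see that `Q E` is
compact, which makes the error in replacing `1 - Q` by `1` between the projections `E` compact. With
`B = (H(P) - λ) E` and `G = (H₀ - λ)⁻¹ Q` one has
`Q E = G (Q E) B - G V E`, where `‖G‖ ‖B‖ ≤ 1/2` and `V` is compact: so `Q E` is the norm limit of
compact Picard iterates (`isCompactOperator_mul_of_localized`). This gives
`exists_mourre_estimate`.

The spectral measure of `H(P)`. The resolvent `R = (H(P) + t)⁻¹` is a Neumann series for large `t`.
The Riesz-Markov theorem applied to `φ ↦ ⟪u, φ(R) u⟫` extends the continuous functional calculus of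
`R` to bounded Borel functions (`borelCalculus`), and the projection-valued measure of `H(P)` is the
image of that of `R` under `r ↦ 1/r - t` (`IsShiftedInverse.exists_spectralMeasure`).
-/

noncomputable section

/-! ### Bounded measurable functions -/

/-- Measurable functions with a uniform bound: they are square integrable for every finite
measure. -/
structure BoundedMeasurable {X F : Type*} [MeasurableSpace X] [NormedAddCommGroup F]
    [MeasurableSpace F] (f : X → F) : Prop where
  measurable : Measurable f
  bounded : ∃ C : ℝ, ∀ x, ‖f x‖ ≤ C

namespace BoundedMeasurable

variable {X F : Type*} [MeasurableSpace X] [NormedAddCommGroup F] [MeasurableSpace F]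
  [BorelSpace F] [SecondCountableTopology F] {f g : X → F}

omit [BorelSpace F] [SecondCountableTopology F] in
theorem const (c : F) : BoundedMeasurable fun _ : X => c :=
  ⟨measurable_const, ‖c‖, fun _ => le_rfl⟩

theorem add (hf : BoundedMeasurable f) (hg : BoundedMeasurable g) :
    BoundedMeasurable fun x => f x + g x := by
  obtain ⟨hf, C, hC⟩ := hf
  obtain ⟨hg, D, hD⟩ := hg
  exact ⟨hf.add hg, C + D, fun x => (norm_add_le _ _).trans (add_le_add (hC x) (hD x))⟩

theorem sub (hf : BoundedMeasurable f) (hg : BoundedMeasurable g) :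
    BoundedMeasurable fun x => f x - g x := by
  obtain ⟨hf, C, hC⟩ := hf
  obtain ⟨hg, D, hD⟩ := hg
  exact ⟨hf.sub hg, C + D, fun x => (norm_sub_le _ _).trans (add_le_add (hC x) (hD x))⟩

theorem mul {f g : X → ℝ} (hf : BoundedMeasurable f) (hg : BoundedMeasurable g) :
    BoundedMeasurable fun x => f x * g x := by
  obtain ⟨hf, C, hC⟩ := hf
  obtain ⟨hg, D, hD⟩ := hg
  refine ⟨hf.mul hg, C * D, fun x => ?_⟩
  rw [norm_mul]
  exact mul_le_mul (hC x) (hD x) (norm_nonneg _) ((norm_nonneg _).trans (hC x))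

theorem indicator_one {S : Set X} (hS : MeasurableSet S) :
    BoundedMeasurable (S.indicator (1 : X → ℝ)) := by
  refine ⟨measurable_one.indicator hS, 1, fun x => ?_⟩
  by_cases h : x ∈ S <;> simp [h]

theorem memLp (hf : BoundedMeasurable f) (p : ℝ≥0∞) (μ : Measure X) [IsFiniteMeasure μ] :
    MemLp f p μ := by
  obtain ⟨hf, C, hC⟩ := hf
  exact MemLp.of_bound hf.aestronglyMeasurable C (Eventually.of_forall hC)

theorem integrable (hf : BoundedMeasurable f) (μ : Measure X) [IsFiniteMeasure μ] :
    Integrable f μ := memLp_one_iff_integrable.1 (hf.memLp 1 μ)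

end BoundedMeasurable

/-! ### The bounded Borel functional calculus -/

section BorelCalculus

open CompactlySupported

variable {𝓗 : Type*} [NormedAddCommGroup 𝓗] [InnerProductSpace ℂ 𝓗] [CompleteSpace 𝓗]
  {X : Type*} [MetricSpace X] [CompactSpace X] [MeasurableSpace X] [BorelSpace X]
  (π : C(X, ℝ) →⋆ₐ[ℝ] (𝓗 →L[ℂ] 𝓗))

omit [CompactSpace X] [MeasurableSpace X] [BorelSpace X] in
theorem inner_continuousCalculus (φ : C(X, ℝ)) (u w : 𝓗) : ⟪π φ u, w⟫_ℂ = ⟪u, π φ w⟫_ℂ := by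
  have h : IsSelfAdjoint (π φ) := (IsSelfAdjoint.all φ).map π
  exact h.isSymmetric u w

omit [CompactSpace X] [MeasurableSpace X] [BorelSpace X] in
theorem inner_continuousCalculus_sq (φ : C(X, ℝ)) (u : 𝓗) :
    ⟪u, π (φ * φ) u⟫_ℂ = ((‖π φ u‖ ^ 2 : ℝ) : ℂ) := by
  rw [map_mul, mul_apply_eq_comp, ← inner_continuousCalculus, inner_self_eq_norm_sq_to_K]
  simp

/-- The functional `φ ↦ ⟪u, π(φ) u⟫`. It is positive because `π(φ) = π(√φ)²` for `φ ≥ 0`. -/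
def spectralFunctional (u : 𝓗) : C_c(X, ℝ) →ₚ[ℝ] ℝ :=
  PositiveLinearMap.mk₀
    { toFun := fun φ => (⟪u, π (φ : C(X, ℝ)) u⟫_ℂ).re
      map_add' := by
        intro φ ψ
        have h : ((φ + ψ : C_c(X, ℝ)) : C(X, ℝ)) = (φ : C(X, ℝ)) + (ψ : C(X, ℝ)) := rfl
        simp [h]
      map_smul' := by
        intro c φ
        have h : ((c • φ : C_c(X, ℝ)) : C(X, ℝ)) = c • (φ : C(X, ℝ)) := rfl
        simp [h, inner_smul_right_eq_smul] }
    (by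
      intro φ hφ
      let ψ : C(X, ℝ) := ⟨fun x => Real.sqrt (φ x), by fun_prop⟩
      have h : (φ : C(X, ℝ)) = ψ * ψ := by
        ext x
        exact (Real.mul_self_sqrt (hφ x)).symm
      change 0 ≤ (⟪u, π (φ : C(X, ℝ)) u⟫_ℂ).re
      rw [h, inner_continuousCalculus_sq, Complex.ofReal_re]
      positivity)

/-- The spectral measure `μ_u` of the vector `u`, on the space `X`: the Riesz-Markov measure of
`φ ↦ ⟪u, π(φ) u⟫`. -/
def vectorMeasure (u : 𝓗) : Measure X := RealRMK.rieszMeasure (spectralFunctional π u)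

instance (u : 𝓗) : IsFiniteMeasure (vectorMeasure π u) := by
  unfold vectorMeasure; infer_instance

theorem integral_vectorMeasure (u : 𝓗) (φ : C(X, ℝ)) :
    ((∫ x, φ x ∂(vectorMeasure π u) : ℝ) : ℂ) = ⟪u, π φ u⟫_ℂ := by
  let φ' : C_c(X, ℝ) := ⟨φ, HasCompactSupport.of_compactSpace _⟩
  have h : ∫ x, φ x ∂(vectorMeasure π u) = (⟪u, π φ u⟫_ℂ).re :=
    RealRMK.integral_rieszMeasure (spectralFunctional π u) φ'
  rw [h]
  refine Complex.conj_eq_iff_re.1 ?_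
  rw [inner_conj_symm, inner_continuousCalculus]

theorem norm_continuousCalculus (u : 𝓗) (φ : C(X, ℝ)) :
    ‖π φ u‖ = ‖ContinuousMap.toLp 2 (vectorMeasure π u) ℝ φ‖ := by
  have h1 := integral_vectorMeasure π u (φ * φ)
  rw [inner_continuousCalculus_sq] at h1
  have h2 : ‖ContinuousMap.toLp 2 (vectorMeasure π u) ℝ φ‖ ^ 2
      = ∫ x, (φ * φ) x ∂(vectorMeasure π u) := by
    rw [← real_inner_self_eq_norm_sq, ContinuousMap.inner_toLp]
    simp
  rw [← pow_left_inj₀ (norm_nonneg _) (norm_nonneg _) two_ne_zero, h2]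
  exact_mod_cast h1.symm

/-- The isometry `L²(μ_u) → 𝓗` that extends `φ ↦ π(φ) u` from the continuous functions. -/
def cyclicMap (u : 𝓗) : Lp ℝ 2 (vectorMeasure π u) →L[ℝ] 𝓗 :=
  LinearMap.extendOfNorm
    ({ toFun := fun φ => π φ u
       map_add' := fun φ ψ => by simp
       map_smul' := fun c φ => by simp } : C(X, ℝ) →ₗ[ℝ] 𝓗)
    (ContinuousMap.toLp 2 (vectorMeasure π u) ℝ :
      C(X, ℝ) →L[ℝ] Lp ℝ 2 (vectorMeasure π u)).toLinearMap

theorem denseRange_toLp (u : 𝓗) : DenseRange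
    (ContinuousMap.toLp 2 (vectorMeasure π u) ℝ : C(X, ℝ) →L[ℝ] Lp ℝ 2 (vectorMeasure π u)) :=
  ContinuousMap.toLp_denseRange ℝ _ ℝ (by simp)

theorem cyclicMap_toLp (u : 𝓗) (φ : C(X, ℝ)) :
    cyclicMap π u (ContinuousMap.toLp 2 (vectorMeasure π u) ℝ φ) = π φ u :=
  LinearMap.extendOfNorm_eq (e := (ContinuousMap.toLp 2 (vectorMeasure π u) ℝ :
      C(X, ℝ) →L[ℝ] Lp ℝ 2 (vectorMeasure π u)).toLinearMap) (denseRange_toLp π u)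
    ⟨1, fun φ => by rw [one_mul]; exact (norm_continuousCalculus π u φ).le⟩ φ

theorem norm_cyclicMap (u : 𝓗) (f : Lp ℝ 2 (vectorMeasure π u)) : ‖cyclicMap π u f‖ = ‖f‖ := by
  refine (denseRange_toLp π u).induction_on (p := fun f => ‖cyclicMap π u f‖ = ‖f‖) f
    (isClosed_eq (by fun_prop) (by fun_prop)) fun φ => ?_
  rw [cyclicMap_toLp, norm_continuousCalculus]

/-- Every bounded measurable function is an `L²` limit of continuous functions. -/
theorem exists_continuous_tendsto {g : X → ℝ} (hg : BoundedMeasurable g) (μ : Measure X)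
    [IsFiniteMeasure μ] :
    ∃ φ : ℕ → C(X, ℝ), Tendsto (fun n => eLpNorm (⇑(φ n) - g) 2 μ) atTop (𝓝 0) := by
  have h : ∀ n : ℕ, ∃ φ : C(X, ℝ), eLpNorm (⇑φ - g) 2 μ ≤ ((n : ℝ≥0∞) + 1)⁻¹ := by
    intro n
    obtain ⟨φ, hφ, -⟩ := (hg.memLp 2 μ).exists_boundedContinuous_eLpNorm_sub_le (by simp)
      (ε := ((n : ℝ≥0∞) + 1)⁻¹) (by simp)
    exact ⟨φ.toContinuousMap, by rw [eLpNorm_sub_comm]; exact hφ⟩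
  choose φ hφ using h
  refine ⟨φ, tendsto_of_tendsto_of_tendsto_of_le_of_le tendsto_const_nhds ?_
    (fun _ => zero_le) hφ⟩
  have := ENNReal.tendsto_inv_nat_nhds_zero.comp (tendsto_add_atTop_nat 1)
  simpa [Function.comp_def] using this

theorem tendsto_cyclicMap {g : X → ℝ} (hg : BoundedMeasurable g) {μ : Measure X} {u : 𝓗}
    (hμ : vectorMeasure π u ≤ μ) {φ : ℕ → C(X, ℝ)}
    (hφ : Tendsto (fun n => eLpNorm (⇑(φ n) - g) 2 μ) atTop (𝓝 0)) :
    Tendsto (fun n => π (φ n) u) atTop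
      (𝓝 (cyclicMap π u ((hg.memLp 2 (vectorMeasure π u)).toLp g))) := by
  have h : Tendsto (fun n => ContinuousMap.toLp 2 (vectorMeasure π u) ℝ (φ n)) atTop
      (𝓝 ((hg.memLp 2 (vectorMeasure π u)).toLp g)) := by
    rw [Lp.tendsto_Lp_iff_tendsto_eLpNorm']
    refine tendsto_of_tendsto_of_tendsto_of_le_of_le tendsto_const_nhds hφ
      (fun _ => zero_le) fun n => ?_
    refine le_trans (le_of_eq (eLpNorm_congr_ae ?_)) (eLpNorm_mono_measure _ hμ)
    exact (ContinuousMap.coeFn_toLp _ _).sub (MemLp.coeFn_toLp _)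
  refine (((cyclicMap π u).continuous.tendsto _).comp h).congr fun n => ?_
  exact cyclicMap_toLp π u (φ n)

/-- The operator `π(g)` for a bounded Borel function `g` (and `0` for other `g`). Its value at `u`
is the image of `g ∈ L²(μ_u)` in `𝓗`. It is linear in `u`, because one sequence of continuous
functions can approximate `g` for the spectral measures of several vectors at once. -/
def borelCalculus (g : X → ℝ) : 𝓗 →L[ℂ] 𝓗 := by
  classical
  exact if hg : BoundedMeasurable g then
    LinearMap.mkContinuousOfExistsBound
      ({ toFun := fun u => cyclicMap π u ((hg.memLp 2 (vectorMeasure π u)).toLp g)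
         map_add' := by
          intro u w
          set μ := vectorMeasure π u + vectorMeasure π w + vectorMeasure π (u + w) with hμ
          obtain ⟨φ, hφ⟩ := exists_continuous_tendsto hg μ
          have hu := tendsto_cyclicMap π hg (u := u) (μ := μ)
            (by rw [hμ, add_assoc]; exact Measure.le_add_right le_rfl) hφ
          have hw := tendsto_cyclicMap π hg (u := w) (μ := μ)
            (Measure.le_add_right (Measure.le_add_left le_rfl)) hφ
          have huw := tendsto_cyclicMap π hg (u := u + w) (μ := μ)
            (Measure.le_add_left le_rfl) hφ
          refine tendsto_nhds_unique huw ((hu.add hw).congr fun n => ?_)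
          rw [map_add]
         map_smul' := by
          intro c u
          set μ := vectorMeasure π u + vectorMeasure π (c • u) with hμ
          obtain ⟨φ, hφ⟩ := exists_continuous_tendsto hg μ
          have hu := tendsto_cyclicMap π hg (u := u) (μ := μ)
            (Measure.le_add_right le_rfl) hφ
          have huw := tendsto_cyclicMap π hg (u := c • u) (μ := μ)
            (Measure.le_add_left le_rfl) hφ
          refine tendsto_nhds_unique huw ((hu.const_smul c).congr fun n => ?_)
          rw [map_smul] } : 𝓗 →ₗ[ℂ] 𝓗)
      (by
        obtain ⟨C, hC⟩ := hg.bounded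
        have hC0 : ∀ u : 𝓗, ‖cyclicMap π u ((hg.memLp 2 (vectorMeasure π u)).toLp g)‖
            ≤ max C 0 * ‖u‖ := by
          intro u
          rw [norm_cyclicMap]
          have h1 : ‖u‖ = ‖ContinuousMap.toLp 2 (vectorMeasure π u) ℝ (1 : C(X, ℝ))‖ := by
            rw [← norm_continuousCalculus, map_one]; rfl
          rw [h1]
          refine Lp.norm_le_mul_norm_of_ae_le_mul ?_
          filter_upwards [MemLp.coeFn_toLp (hg.memLp 2 (vectorMeasure π u)),
            ContinuousMap.coeFn_toLp (p := 2) (𝕜 := ℝ) (vectorMeasure π u) (1 : C(X, ℝ))]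
            with x hx hx'
          rw [hx, hx']
          simpa using Or.inl (hC x)
        exact ⟨max C 0, hC0⟩)
  else 0

theorem borelCalculus_apply {g : X → ℝ} (hg : BoundedMeasurable g) (u : 𝓗) :
    borelCalculus π g u = cyclicMap π u ((hg.memLp 2 (vectorMeasure π u)).toLp g) := by
  rw [borelCalculus, dif_pos hg]; rfl

theorem tendsto_borelCalculus {g : X → ℝ} (hg : BoundedMeasurable g) {μ : Measure X} {u : 𝓗}
    (hμ : vectorMeasure π u ≤ μ) {φ : ℕ → C(X, ℝ)}
    (hφ : Tendsto (fun n => eLpNorm (⇑(φ n) - g) 2 μ) atTop (𝓝 0)) :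
    Tendsto (fun n => π (φ n) u) atTop (𝓝 (borelCalculus π g u)) := by
  rw [borelCalculus_apply π hg]
  exact tendsto_cyclicMap π hg hμ hφ

theorem boundedMeasurable_continuousMap (φ : C(X, ℝ)) : BoundedMeasurable (φ : X → ℝ) :=
  ⟨φ.continuous.measurable, ‖φ‖, φ.norm_coe_le_norm⟩

theorem borelCalculus_continuousMap (φ : C(X, ℝ)) : borelCalculus π φ = π φ := by
  ext u
  refine tendsto_nhds_unique (tendsto_borelCalculus π (boundedMeasurable_continuousMap φ) le_rfl
    (φ := fun _ => φ) ?_) tendsto_const_nhds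
  simp

theorem norm_sq_borelCalculus {g : X → ℝ} (hg : BoundedMeasurable g) (u : 𝓗) :
    ‖borelCalculus π g u‖ ^ 2 = ∫ x, g x ^ 2 ∂(vectorMeasure π u) := by
  rw [borelCalculus_apply π hg, norm_cyclicMap, ← real_inner_self_eq_norm_sq, L2.inner_def]
  refine integral_congr_ae ?_
  filter_upwards [MemLp.coeFn_toLp (hg.memLp 2 (vectorMeasure π u))] with x hx
  rw [hx]
  simp

theorem borelCalculus_add {g h : X → ℝ} (hg : BoundedMeasurable g) (hh : BoundedMeasurable h) :
    borelCalculus π (fun x => g x + h x) = borelCalculus π g + borelCalculus π h := by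
  ext u
  rw [add_apply, borelCalculus_apply π hg, borelCalculus_apply π hh,
    borelCalculus_apply π (hg.add hh), ← map_add, ← MemLp.toLp_add]
  rfl

theorem borelCalculus_sub {g h : X → ℝ} (hg : BoundedMeasurable g) (hh : BoundedMeasurable h) :
    borelCalculus π (fun x => g x - h x) = borelCalculus π g - borelCalculus π h := by
  rw [eq_sub_iff_add_eq, ← borelCalculus_add π (hg.sub hh) hh]
  simp

theorem borelCalculus_zero : borelCalculus π (fun _ => (0 : ℝ)) = 0 := by
  have h := borelCalculus_sub π (BoundedMeasurable.const (X := X) (0 : ℝ))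
    (BoundedMeasurable.const (X := X) (0 : ℝ))
  simpa using h

theorem inner_borelCalculus {g : X → ℝ} (hg : BoundedMeasurable g) (u w : 𝓗) :
    ⟪borelCalculus π g u, w⟫_ℂ = ⟪u, borelCalculus π g w⟫_ℂ := by
  obtain ⟨φ, hφ⟩ := exists_continuous_tendsto hg (vectorMeasure π u + vectorMeasure π w)
  have hu := tendsto_borelCalculus π hg (Measure.le_add_right le_rfl) hφ (u := u)
  have hw := tendsto_borelCalculus π hg (Measure.le_add_left le_rfl) hφ (u := w)
  refine tendsto_nhds_unique (hu.inner tendsto_const_nhds)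
    ((Tendsto.inner tendsto_const_nhds hw).congr fun n => ?_)
  rw [inner_continuousCalculus]

theorem inner_self_borelCalculus {g : X → ℝ} (hg : BoundedMeasurable g) (u : 𝓗) :
    ⟪u, borelCalculus π g u⟫_ℂ = ((∫ x, g x ∂(vectorMeasure π u) : ℝ) : ℂ) := by
  obtain ⟨φ, hφ⟩ := exists_continuous_tendsto hg (vectorMeasure π u)
  have hu := tendsto_borelCalculus π hg le_rfl hφ (u := u)
  have h1 : Tendsto (fun n => ∫ x, φ n x ∂(vectorMeasure π u)) atTop
      (𝓝 (∫ x, g x ∂(vectorMeasure π u))) := by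
    refine tendsto_integral_of_L1' _ (hg.integrable _).1 (Eventually.of_forall fun n =>
      (boundedMeasurable_continuousMap (φ n)).integrable _) ?_
    have h2 : Tendsto (fun n => eLpNorm (⇑(φ n) - g) 2 (vectorMeasure π u)
        * vectorMeasure π u univ ^ (1 / (1 : ℝ≥0∞).toReal - 1 / (2 : ℝ≥0∞).toReal))
        atTop (𝓝 0) := by
      have := ENNReal.Tendsto.mul_const hφ (b := vectorMeasure π u univ ^
        (1 / (1 : ℝ≥0∞).toReal - 1 / (2 : ℝ≥0∞).toReal)) (Or.inr
          (ENNReal.rpow_ne_top_of_nonneg (by norm_num) (measure_ne_top _ _)))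
      simpa using this
    refine tendsto_of_tendsto_of_tendsto_of_le_of_le tendsto_const_nhds h2
      (fun _ => zero_le) fun n => ?_
    exact eLpNorm_le_eLpNorm_mul_rpow_measure_univ (by norm_num)
      ((boundedMeasurable_continuousMap (φ n)).measurable.sub hg.measurable).aestronglyMeasurable
  refine tendsto_nhds_unique (Tendsto.inner tendsto_const_nhds hu)
    (((Complex.continuous_ofReal.tendsto _).comp h1).congr fun n => ?_)
  exact integral_vectorMeasure π u (φ n)

theorem borelCalculus_commute {g h : X → ℝ} (hg : BoundedMeasurable g)
    (hh : BoundedMeasurable h) :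
    borelCalculus π g * borelCalculus π h = borelCalculus π h * borelCalculus π g := by
  have key : ∀ φ : C(X, ℝ), ∀ u, borelCalculus π g (π φ u) = π φ (borelCalculus π g u) := by
    intro φ u
    obtain ⟨ψ, hψ⟩ := exists_continuous_tendsto hg (vectorMeasure π u + vectorMeasure π (π φ u))
    have h1 := tendsto_borelCalculus π hg (Measure.le_add_right le_rfl) hψ (u := u)
    have h2 := tendsto_borelCalculus π hg (Measure.le_add_left le_rfl) hψ (u := π φ u)
    refine tendsto_nhds_unique h2 ((((π φ).continuous.tendsto _).comp h1).congr fun n => ?_)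
    rw [Function.comp_apply, ← mul_apply_eq_comp, ← mul_apply_eq_comp,
      ← map_mul, ← map_mul, mul_comm]
  ext u
  obtain ⟨ψ, hψ⟩ := exists_continuous_tendsto hh
    (vectorMeasure π u + vectorMeasure π (borelCalculus π g u))
  have h1 := tendsto_borelCalculus π hh (Measure.le_add_right le_rfl) hψ (u := u)
  have h2 := tendsto_borelCalculus π hh (Measure.le_add_left le_rfl) hψ
    (u := borelCalculus π g u)
  refine tendsto_nhds_unique ((((borelCalculus π g).continuous.tendsto _).comp h1).congr
    fun n => ?_) h2
  exact key (ψ n) u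

/-- Both sides are self-adjoint, so it suffices to compare their quadratic forms. -/
theorem borelCalculus_sq {g : X → ℝ} (hg : BoundedMeasurable g) :
    borelCalculus π g * borelCalculus π g = borelCalculus π fun x => g x * g x := by
  refine ContinuousLinearMap.coe_injective ((ext_inner_map _ _).1 fun u => ?_)
  rw [ContinuousLinearMap.coe_coe, ContinuousLinearMap.coe_coe]
  rw [mul_apply_eq_comp, inner_borelCalculus π hg, inner_borelCalculus π (hg.mul hg),
    inner_self_borelCalculus π (hg.mul hg), inner_self_eq_norm_sq_to_K]
  have h := norm_sq_borelCalculus π hg u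
  simp only [pow_two] at h ⊢
  rw [← h]
  simp

/-- This follows from `borelCalculus_sq` by polarisation. -/
theorem borelCalculus_mul {g h : X → ℝ} (hg : BoundedMeasurable g) (hh : BoundedMeasurable h) :
    borelCalculus π (fun x => g x * h x) = borelCalculus π g * borelCalculus π h := by
  have h1 := borelCalculus_sq π (hg.add hh)
  have h2 : (fun x => (g x + h x) * (g x + h x))
      = fun x => (g x * g x + h x * h x) + (g x * h x + g x * h x) := by
    ext x; ring
  rw [h2, borelCalculus_add π ((hg.mul hg).add (hh.mul hh)) ((hg.mul hh).add (hg.mul hh)),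
    borelCalculus_add π (hg.mul hg) (hh.mul hh), borelCalculus_add π (hg.mul hh) (hg.mul hh),
    borelCalculus_add π hg hh, add_mul, mul_add, mul_add, borelCalculus_sq π hg,
    borelCalculus_sq π hh, ← borelCalculus_commute π hg hh] at h1
  have h3 : (2 : ℂ) • borelCalculus π (fun x => g x * h x)
      = (2 : ℂ) • (borelCalculus π g * borelCalculus π h) := by
    rw [two_smul, two_smul]
    refine add_left_cancel (a := borelCalculus π (fun x => g x * g x)
      + borelCalculus π (fun x => h x * h x)) ?_
    rw [← h1]
    abel
  exact smul_right_injective _ (two_ne_zero' ℂ) h3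

/-- Dominated convergence for the Borel calculus. -/
theorem tendsto_borelCalculus_of_dominated {ι : Type*} {l : Filter ι} [l.IsCountablyGenerated]
    {g : ι → X → ℝ} {h : X → ℝ} (hg : ∀ i, BoundedMeasurable (g i)) (hh : BoundedMeasurable h)
    (C : ℝ) (hC : ∀ i x, |g i x - h x| ≤ C) (hlim : ∀ x, Tendsto (fun i => g i x) l (𝓝 (h x)))
    (u : 𝓗) : Tendsto (fun i => borelCalculus π (g i) u) l (𝓝 (borelCalculus π h u)) := by
  rw [tendsto_iff_norm_sub_tendsto_zero]
  have h1 : Tendsto (fun i => ∫ x, (g i x - h x) ^ 2 ∂(vectorMeasure π u)) l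
      (𝓝 (∫ _, (0 : ℝ) ∂(vectorMeasure π u))) := by
    refine tendsto_integral_filter_of_dominated_convergence (fun _ => C ^ 2)
      (Eventually.of_forall fun i =>
        (((hg i).sub hh).measurable.pow_const 2).aestronglyMeasurable)
      (Eventually.of_forall fun i => Eventually.of_forall fun x => ?_) (integrable_const _)
      (Eventually.of_forall fun x => ?_)
    · rw [Real.norm_eq_abs, abs_pow]
      exact pow_le_pow_left₀ (abs_nonneg _) (hC i x) 2
    · have := ((hlim x).sub_const (h x)).pow 2
      simpa using this
  rw [integral_zero] at h1
  have h2 : ∀ i, ‖borelCalculus π (g i) u - borelCalculus π h u‖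
      = Real.sqrt (∫ x, (g i x - h x) ^ 2 ∂(vectorMeasure π u)) := by
    intro i
    rw [← norm_sq_borelCalculus π ((hg i).sub hh), Real.sqrt_sq (norm_nonneg _),
      borelCalculus_sub π (hg i) hh, sub_apply]
  simp only [h2]
  have h3 := (Real.continuous_sqrt.tendsto 0).comp h1
  rw [Real.sqrt_zero] at h3
  exact h3

end BorelCalculus

/-! ### The spectral measure of an operator with a bounded self-adjoint inverse -/

/-- Dominated convergence in `L²`. -/
theorem tendsto_eLpNorm_two_of_dominated {X : Type*} [MeasurableSpace X] {μ : Measure X}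
    {F : ℕ → X → ℝ} {f b : X → ℝ} (hF : ∀ n, AEStronglyMeasurable (F n) μ)
    (hf : AEStronglyMeasurable f μ) (hb : MemLp b 2 μ) (hbound : ∀ n x, ‖F n x - f x‖ ≤ ‖b x‖)
    (hlim : ∀ x, Tendsto (fun n => F n x) atTop (𝓝 (f x))) :
    Tendsto (fun n => eLpNorm (F n - f) 2 μ) atTop (𝓝 0) := by
  have h2 : ∀ g : X → ℝ, eLpNorm g 2 μ = (∫⁻ x, ‖g x‖ₑ ^ (2 : ℝ) ∂μ) ^ (1 / 2 : ℝ) := by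
    intro g
    rw [eLpNorm_eq_lintegral_rpow_enorm_toReal (by simp) (by simp)]
    simp
  have hfin : ∫⁻ x, ‖b x‖ₑ ^ (2 : ℝ) ∂μ ≠ ∞ := by
    have := lintegral_rpow_enorm_lt_top_of_eLpNorm_lt_top (p := 2) (by simp) (by simp) hb.2
    simpa using this.ne
  have h3 : Tendsto (fun n => ∫⁻ x, ‖(F n - f) x‖ₑ ^ (2 : ℝ) ∂μ) atTop
      (𝓝 (∫⁻ _, 0 ∂μ)) := by
    refine tendsto_lintegral_of_dominated_convergence' (fun x => ‖b x‖ₑ ^ (2 : ℝ))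
      (fun n => ((hF n).sub hf).enorm.pow_const _) (fun n => Eventually.of_forall fun x => ?_) hfin
      (Eventually.of_forall fun x => ?_)
    · refine ENNReal.rpow_le_rpow ?_ (by norm_num)
      exact enorm_le_iff_norm_le.2 (hbound n x)
    · have h4 := (((hlim x).sub_const (f x)).enorm).ennrpow_const 2
      simpa using h4
  rw [lintegral_zero] at h3
  have h5 := h3.ennrpow_const (1 / 2 : ℝ)
  rw [ENNReal.zero_rpow_of_pos (by norm_num)] at h5
  exact h5.congr fun n => (h2 _).symm

section SpectralMeasure

variable {𝓗 : Type*} [NormedAddCommGroup 𝓗] [InnerProductSpace ℂ 𝓗] [CompleteSpace 𝓗]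
  {X : Type*} [MetricSpace X] [CompactSpace X] [MeasurableSpace X] [BorelSpace X]
  (π : C(X, ℝ) →⋆ₐ[ℝ] (𝓗 →L[ℂ] 𝓗))

theorem isStarProjection_borelCalculus {S : Set X} (hS : MeasurableSet S) :
    IsStarProjection (borelCalculus π (S.indicator 1)) := by
  have hb := BoundedMeasurable.indicator_one hS
  refine ⟨?_, ?_⟩
  · rw [IsIdempotentElem, borelCalculus_sq π hb]
    congr 1
    ext x
    by_cases h : x ∈ S <;> simp [h]
  · rw [ContinuousLinearMap.isSelfAdjoint_iff_isSymmetric]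
    exact fun u w => inner_borelCalculus π hb u w

theorem borelCalculus_finset_sum {ι : Type*} (F : Finset ι) {g : ι → X → ℝ}
    (hg : ∀ i, BoundedMeasurable (g i)) :
    BoundedMeasurable (fun x => ∑ i ∈ F, g i x) ∧
      borelCalculus π (fun x => ∑ i ∈ F, g i x) = ∑ i ∈ F, borelCalculus π (g i) := by
  classical
  induction F using Finset.induction_on with
  | empty => simpa using ⟨BoundedMeasurable.const 0, borelCalculus_zero π⟩
  | insert i F hi ih =>
    simp only [Finset.sum_insert hi]
    refine ⟨(hg i).add ih.1, ?_⟩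
    rw [borelCalculus_add π (hg i) ih.1, ih.2]

theorem borelCalculus_const (a : ℝ) : borelCalculus π (fun _ => a) = (a : ℂ) • 1 := by
  have h := borelCalculus_continuousMap π (algebraMap ℝ C(X, ℝ) a)
  rw [AlgHomClass.commutes, Algebra.algebraMap_eq_smul_one, Algebra.algebraMap_eq_smul_one] at h
  rw [Complex.coe_smul, ← h]
  congr 1
  ext x
  simp

/-- The image under `h` of the projection-valued measure of `π`. The set `X₀` has full spectral
measure, and only the values of `h` on `X₀` matter. -/
def imagePVM (h : X → ℝ) (hh : Measurable h) (X₀ : Set X) (hX₀ : MeasurableSet X₀)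
    (hnull : borelCalculus π (X₀.indicator 1) = 1) : ProjectionValuedMeasure 𝓗 where
  proj S := borelCalculus π ((X₀ ∩ h ⁻¹' S).indicator 1)
  isStarProjection S hS := isStarProjection_borelCalculus π (hX₀.inter (hh hS))
  univ := by simpa using hnull
  iUnion S hS hd u := by
    have hb : ∀ i, BoundedMeasurable ((X₀ ∩ h ⁻¹' S i).indicator (1 : X → ℝ)) := fun i =>
      BoundedMeasurable.indicator_one (hX₀.inter (hh (hS i)))
    have hU : BoundedMeasurable ((X₀ ∩ h ⁻¹' ⋃ i, S i).indicator (1 : X → ℝ)) :=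
      BoundedMeasurable.indicator_one (hX₀.inter (hh (MeasurableSet.iUnion hS)))
    have hpt : ∀ x, HasSum (fun i => (X₀ ∩ h ⁻¹' S i).indicator (1 : X → ℝ) x)
        ((X₀ ∩ h ⁻¹' ⋃ i, S i).indicator (1 : X → ℝ) x) := by
      intro x
      by_cases hx : x ∈ X₀ ∩ h ⁻¹' ⋃ i, S i
      · obtain ⟨hx0, hx1⟩ := hx
        obtain ⟨j, hj⟩ := mem_iUnion.1 hx1
        have hj' : x ∈ X₀ ∩ h ⁻¹' S j := ⟨hx0, hj⟩
        have hx' : x ∈ X₀ ∩ h ⁻¹' ⋃ i, S i := ⟨hx0, hx1⟩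
        have h1 : (X₀ ∩ h ⁻¹' ⋃ i, S i).indicator (1 : X → ℝ) x
            = (X₀ ∩ h ⁻¹' S j).indicator (1 : X → ℝ) x := by
          rw [indicator_of_mem hx', indicator_of_mem hj']
        rw [h1]
        refine hasSum_single j fun i hi => indicator_of_notMem (fun hxi => ?_) _
        exact (Set.disjoint_left.1 (hd hi)) hxi.2 hj
      · rw [indicator_of_notMem hx]
        have h1 : (fun i => (X₀ ∩ h ⁻¹' S i).indicator (1 : X → ℝ) x) = fun _ => 0 := by
          ext i
          exact indicator_of_notMem (fun hxi => hx ⟨hxi.1, mem_iUnion.2 ⟨i, hxi.2⟩⟩) _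
        rw [h1]
        exact hasSum_zero
    have hle : ∀ x, (X₀ ∩ h ⁻¹' ⋃ i, S i).indicator (1 : X → ℝ) x ≤ 1 := fun x =>
      indicator_le_self' (fun _ _ => zero_le_one) x
    have hnn : ∀ (T : Set X) x, 0 ≤ T.indicator (1 : X → ℝ) x := fun T x =>
      indicator_nonneg (fun _ _ => zero_le_one) x
    have := tendsto_borelCalculus_of_dominated π (l := atTop)
      (fun F => (borelCalculus_finset_sum π F hb).1) hU 1 (fun F x => ?_) (fun x => hpt x) u
    · refine this.congr fun F => ?_
      rw [(borelCalculus_finset_sum π F hb).2, sum_apply]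
    · have h1 : ∑ i ∈ F, (X₀ ∩ h ⁻¹' S i).indicator (1 : X → ℝ) x ≤ _ :=
        sum_le_hasSum F (fun i _ => hnn _ x) (hpt x)
      have h2 : 0 ≤ ∑ i ∈ F, (X₀ ∩ h ⁻¹' S i).indicator (1 : X → ℝ) x :=
        Finset.sum_nonneg fun i _ => hnn _ x
      rw [abs_le]
      constructor <;> linarith [hle x]

theorem measureReal_vectorMeasure {S : Set X} (hS : MeasurableSet S) (u : 𝓗) :
    ⟪u, borelCalculus π (S.indicator 1) u⟫_ℂ = (((vectorMeasure π u).real S : ℝ) : ℂ) := by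
  rw [inner_self_borelCalculus π (BoundedMeasurable.indicator_one hS), integral_indicator_one hS]

theorem vectorMeasure_null {X₀ : Set X} (hX₀ : MeasurableSet X₀)
    (hnull : borelCalculus π (X₀.indicator 1) = 1) (u : 𝓗) : ∀ᵐ x ∂(vectorMeasure π u), x ∈ X₀ := by
  have hb := BoundedMeasurable.indicator_one hX₀.compl
  have h1 : borelCalculus π (X₀ᶜ.indicator 1) = 0 := by
    have h := borelCalculus_add π hb (BoundedMeasurable.indicator_one hX₀)
    have h2 : (fun x => X₀ᶜ.indicator (1 : X → ℝ) x + X₀.indicator 1 x)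
        = (univ : Set X).indicator 1 := by
      ext x
      by_cases hx : x ∈ X₀ <;> simp [hx]
    have h3 : borelCalculus π ((univ : Set X).indicator 1) = 1 := by
      have h4 : (univ : Set X).indicator (1 : X → ℝ) = ((1 : C(X, ℝ)) : X → ℝ) := by
        ext x; simp
      rw [h4, borelCalculus_continuousMap, map_one]
    rw [h2, h3, hnull] at h
    simpa using h.symm
  have h := measureReal_vectorMeasure π hX₀.compl u
  rw [h1] at h
  simp only [zero_apply, inner_zero_right] at h
  have h5 : (vectorMeasure π u).real X₀ᶜ = 0 := by exact_mod_cast h.symm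
  rw [measureReal_eq_zero_iff] at h5
  exact h5

theorem scalarMeasure_imagePVM (h : X → ℝ) (hh : Measurable h) (X₀ : Set X)
    (hX₀ : MeasurableSet X₀) (hnull : borelCalculus π (X₀.indicator 1) = 1) (u : 𝓗) :
    (imagePVM π h hh X₀ hX₀ hnull).scalarMeasure u = (vectorMeasure π u).map h := by
  ext S hS
  rw [ProjectionValuedMeasure.scalarMeasure, Measure.ofMeasurable_apply S hS,
    Measure.map_apply hh hS]
  change ENNReal.ofReal (⟪u, borelCalculus π ((X₀ ∩ h ⁻¹' S).indicator 1) u⟫_ℂ).re = _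
  rw [measureReal_vectorMeasure π (hX₀.inter (hh hS)), Complex.ofReal_re, ofReal_measureReal]
  refine measure_congr ?_
  filter_upwards [vectorMeasure_null π hX₀ hnull u] with x hx
  exact propext ⟨fun hm => hm.2, fun hm => ⟨hx, hm⟩⟩

/-- Passing from `u` to `π(g) u` multiplies the spectral measure by `g²`. -/
theorem vectorMeasure_borelCalculus {g : X → ℝ} (hg : BoundedMeasurable g) (u : 𝓗) :
    vectorMeasure π (borelCalculus π g u)
      = (vectorMeasure π u).withDensity fun x => ENNReal.ofReal (g x ^ 2) := by
  ext S hS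
  have hS' := BoundedMeasurable.indicator_one hS
  have h1 := measureReal_vectorMeasure π hS (borelCalculus π g u)
  have h2 : ⟪borelCalculus π g u, borelCalculus π (S.indicator 1) (borelCalculus π g u)⟫_ℂ
      = ((∫ x, g x * (S.indicator 1 x * g x) ∂(vectorMeasure π u) : ℝ) : ℂ) := by
    rw [← inner_self_borelCalculus π (hg.mul (hS'.mul hg)), borelCalculus_mul π hg (hS'.mul hg),
      borelCalculus_mul π hS' hg, inner_borelCalculus π hg]
    rfl
  rw [h2] at h1
  have h3 : (vectorMeasure π (borelCalculus π g u)).real S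
      = ∫ x in S, g x ^ 2 ∂(vectorMeasure π u) := by
    rw [← integral_indicator hS]
    have h4 : (∫ x, g x * (S.indicator 1 x * g x) ∂(vectorMeasure π u))
        = (vectorMeasure π (borelCalculus π g u)).real S := by exact_mod_cast h1
    rw [← h4]
    congr 1
    ext x
    by_cases hx : x ∈ S <;> simp [hx, pow_two]
  rw [withDensity_apply _ hS, ← ofReal_measureReal, h3, ofReal_integral_eq_lintegral_ofReal]
  · have := (hg.mul hg).integrable (vectorMeasure π u)
    simp only [← pow_two] at this
    exact this.integrableOn
  · exact Eventually.of_forall fun x => sq_nonneg _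

end SpectralMeasure

section Resolvent

variable {𝓗 : Type*} [NormedAddCommGroup 𝓗] [InnerProductSpace ℂ 𝓗] [CompleteSpace 𝓗]

/-- `R` is a bounded self-adjoint operator and the two-sided inverse of `H + c`. -/
structure IsShiftedInverse (H : 𝓗 →ₗ.[ℂ] 𝓗) (c : ℝ) (R : 𝓗 →L[ℂ] 𝓗) : Prop where
  isSelfAdjoint : IsSelfAdjoint R
  mem_domain : ∀ w, R w ∈ H.domain
  apply_inv : ∀ w, H ⟨R w, mem_domain w⟩ = w - (c : ℂ) • R w
  inv_apply : ∀ u : H.domain, R (H u + (c : ℂ) • (u : 𝓗)) = u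

theorem IsShiftedInverse.eq_zero {H : 𝓗 →ₗ.[ℂ] 𝓗} {c : ℝ} {R : 𝓗 →L[ℂ] 𝓗}
    (h : IsShiftedInverse H c R) {w : 𝓗} (hw : R w = 0) : w = 0 := by
  have h1 := h.apply_inv w
  have h2 : (⟨R w, h.mem_domain w⟩ : H.domain) = 0 := Subtype.ext hw
  rw [h2, hw, smul_zero, sub_zero, LinearPMap.map_zero] at h1
  exact h1.symm

/-- The spectral theorem for an operator that is bounded below: the spectral measure exists, and
the projections of bounded intervals map into the domain. The operator `B` is `(H - λ) E(I)`. -/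
theorem IsShiftedInverse.exists_spectralMeasure {H : 𝓗 →ₗ.[ℂ] 𝓗} {c : ℝ} {R : 𝓗 →L[ℂ] 𝓗}
    (hR : IsShiftedInverse H c R) :
    ∃ E : ProjectionValuedMeasure 𝓗, IsSpectralMeasure H E ∧
      ∀ lam κ : ℝ, 0 ≤ κ → ∃ B : 𝓗 →L[ℂ] 𝓗, ‖B‖ ≤ κ ∧
        E.proj (Icc (lam - κ) (lam + κ)) * B = B ∧
        ∀ u, ∃ hu : E.proj (Icc (lam - κ) (lam + κ)) u ∈ H.domain,
          H ⟨E.proj (Icc (lam - κ) (lam + κ)) u, hu⟩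
            = B u + (lam : ℂ) • E.proj (Icc (lam - κ) (lam + κ)) u := by
  have : CompactSpace (spectrum ℝ R) := isCompact_iff_compactSpace.1 (spectrum.isCompact R)
  let π : C(spectrum ℝ R, ℝ) →⋆ₐ[ℝ] (𝓗 →L[ℂ] 𝓗) := cfcHom hR.isSelfAdjoint
  let r : C(spectrum ℝ R, ℝ) := (ContinuousMap.id ℝ).restrict (spectrum ℝ R)
  have hπr : π r = R := cfcHom_id hR.isSelfAdjoint
  have hr : BoundedMeasurable (r : spectrum ℝ R → ℝ) := boundedMeasurable_continuousMap r
  have hΦr : borelCalculus π r = R := by rw [borelCalculus_continuousMap, hπr]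
  -- `H = h(R)`, where `h r = 1 / r - c`; the point `r = 0`, where `h` has a junk value, is a null
  -- set for the spectral measure because `R` is injective
  let h : spectrum ℝ R → ℝ := fun x => (r x)⁻¹ - c
  have hh : Measurable h := hr.measurable.inv.sub_const c
  let X₀ : Set (spectrum ℝ R) := {x | r x ≠ 0}
  have hX₀ : MeasurableSet X₀ := (measurableSet_eq_fun hr.measurable measurable_const).compl
  have hX₀' := BoundedMeasurable.indicator_one hX₀
  have hone : borelCalculus π (fun _ => (1 : ℝ)) = 1 := by
    have := borelCalculus_continuousMap π 1
    rwa [map_one] at this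
  have hnull : borelCalculus π (X₀.indicator 1) = 1 := by
    have hz : R * (1 - borelCalculus π (X₀.indicator 1)) = 0 := by
      rw [← hone, ← borelCalculus_sub π (BoundedMeasurable.const 1) hX₀']
      nth_rewrite 1 [← hΦr]
      rw [← borelCalculus_mul π hr ((BoundedMeasurable.const 1).sub hX₀'),
        ← borelCalculus_zero π]
      congr 1
      ext x
      by_cases hx : r x = 0
      · simp [hx]
      · have : x ∈ X₀ := hx
        simp [this]
    ext u
    have h1 := hR.eq_zero (w := (1 - borelCalculus π (X₀.indicator 1)) u)
      (by rw [← mul_apply_eq_comp, hz]; rfl)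
    rw [sub_apply, sub_eq_zero] at h1
    exact h1.symm
  have hHR : ∀ (w u : 𝓗) (hu : R w = u), ∃ hd : u ∈ H.domain, H ⟨u, hd⟩ = w - (c : ℂ) • u := by
    rintro w u rfl
    exact ⟨hR.mem_domain w, hR.apply_inv w⟩
  refine ⟨imagePVM π h hh X₀ hX₀ hnull, ⟨fun u => ?_, fun u => ?_⟩, fun lam κ hκ => ?_⟩
  · rw [scalarMeasure_imagePVM, integrable_map_measure (by fun_prop) hh.aemeasurable]
    constructor
    · intro hu
      -- for `u = R w` the measure `μ_u = r² μ_w` compensates the pole of `h²`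
      have hw := hR.inv_apply ⟨u, hu⟩
      set w := H ⟨u, hu⟩ + (c : ℂ) • u with hwdef
      have hu' : u = borelCalculus π r w := by rw [hΦr]; exact hw.symm
      rw [hu', vectorMeasure_borelCalculus π hr,
        integrable_withDensity_iff_integrable_smul' (by fun_prop)
          (Eventually.of_forall fun _ => ENNReal.ofReal_lt_top)]
      have hb : BoundedMeasurable fun x => X₀.indicator 1 x *
          ((1 - c * r x) * (1 - c * r x)) := by
        have h1 := (BoundedMeasurable.const (X := spectrum ℝ R) (1 : ℝ)).sub
          ((BoundedMeasurable.const (X := spectrum ℝ R) c).mul hr)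
        exact hX₀'.mul (h1.mul h1)
      refine (hb.integrable _).congr (Eventually.of_forall fun x => ?_)
      dsimp only [Function.comp_apply, h]
      rw [ENNReal.toReal_ofReal (sq_nonneg _), smul_eq_mul]
      by_cases hx : r x = 0
      · have : x ∉ X₀ := fun h => h hx
        simp [this, hx]
      · have : x ∈ X₀ := hx
        simp only [this, indicator_of_mem, Pi.one_apply]
        field_simp
    · intro hi
      -- `w = R⁻¹ u` is the limit of the images of `u` under truncations of `R⁻¹`
      have hrinv : MemLp (fun x => (r x)⁻¹) 2 (vectorMeasure π u) := by
        have h1 : MemLp h 2 (vectorMeasure π u) :=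
          (memLp_two_iff_integrable_sq hh.aestronglyMeasurable).2 hi
        have h2 := h1.add (memLp_const c)
        refine (memLp_congr_ae (Eventually.of_forall fun x => ?_)).1 h2
        simp [h]
      let g : ℕ → spectrum ℝ R → ℝ := fun n =>
        {x | ((n : ℝ) + 1)⁻¹ ≤ |r x|}.indicator fun x => (r x)⁻¹
      have hS : ∀ n : ℕ, MeasurableSet {x : spectrum ℝ R | ((n : ℝ) + 1)⁻¹ ≤ |r x|} := fun n =>
        measurableSet_le measurable_const (by fun_prop)
      have hg : ∀ n, BoundedMeasurable (g n) := by
        intro n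
        refine ⟨hr.measurable.inv.indicator (hS n), n + 1, fun x => ?_⟩
        by_cases hx : x ∈ {x : spectrum ℝ R | ((n : ℝ) + 1)⁻¹ ≤ |r x|}
        · simp only [g, indicator_of_mem hx]
          rw [norm_inv, Real.norm_eq_abs]
          exact inv_le_of_inv_le₀ (by positivity) hx
        · simp only [g, indicator_of_notMem hx]
          rw [norm_zero]
          positivity
      have hev : ∀ x, r x ≠ 0 → ∀ᶠ n : ℕ in atTop, ((n : ℝ) + 1)⁻¹ ≤ |r x| := by
        intro x hx
        have := tendsto_one_div_add_atTop_nhds_zero_nat (𝕜 := ℝ)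
        filter_upwards [this.eventually_le_const (abs_pos.2 hx)] with n hn
        rwa [one_div] at hn
      have hlimg : ∀ x, Tendsto (fun n => g n x) atTop (𝓝 (r x)⁻¹) := by
        intro x
        refine tendsto_const_nhds.congr' ?_
        by_cases hx : r x = 0
        · refine Eventually.of_forall fun n => ?_
          by_cases hx' : x ∈ {x : spectrum ℝ R | ((n : ℝ) + 1)⁻¹ ≤ |r x|}
          · simp only [g, indicator_of_mem hx']
          · simp only [g, indicator_of_notMem hx', hx, inv_zero]
        · filter_upwards [hev x hx] with n hn
          have hn' : x ∈ {x : spectrum ℝ R | ((n : ℝ) + 1)⁻¹ ≤ |r x|} := hn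
          simp only [g, indicator_of_mem hn']
      have hLp : Tendsto (fun n => ((hg n).memLp 2 (vectorMeasure π u)).toLp (g n)) atTop
          (𝓝 (hrinv.toLp _)) := by
        rw [Lp.tendsto_Lp_iff_tendsto_eLpNorm'']
        refine tendsto_eLpNorm_two_of_dominated (fun n => (hg n).measurable.aestronglyMeasurable)
          hrinv.1 hrinv (fun n x => ?_) hlimg
        by_cases hx : x ∈ {x : spectrum ℝ R | ((n : ℝ) + 1)⁻¹ ≤ |r x|}
        · simp [g, indicator_of_mem hx]
        · simp [g, indicator_of_notMem hx]
      have hw := ((cyclicMap π u).continuous.tendsto _).comp hLp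
      set w := cyclicMap π u (hrinv.toLp _)
      have h1 : Tendsto (fun n => borelCalculus π (g n) u) atTop (𝓝 w) := by
        refine hw.congr fun n => ?_
        rw [borelCalculus_apply π (hg n)]; rfl
      have h2 := (R.continuous.tendsto _).comp h1
      have h3 : Tendsto (fun n => borelCalculus π (fun x => r x * g n x) u) atTop
          (𝓝 (borelCalculus π (X₀.indicator 1) u)) := by
        refine tendsto_borelCalculus_of_dominated π (fun n => hr.mul (hg n)) hX₀' 1
          (fun n x => ?_) (fun x => ?_) u
        · by_cases hx : r x = 0
          · have : x ∉ X₀ := fun h => h hx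
            simp [hx, this]
          · have hx0 : x ∈ X₀ := hx
            by_cases hx' : x ∈ {x : spectrum ℝ R | ((n : ℝ) + 1)⁻¹ ≤ |r x|}
            · simp [g, indicator_of_mem hx', hx0, hx]
            · simp [g, indicator_of_notMem hx', hx0]
        · have := (hlimg x).const_mul (r x)
          by_cases hx : r x = 0
          · have hx0 : x ∉ X₀ := fun h => h hx
            simp [hx, hx0]
          · have hx0 : x ∈ X₀ := hx
            simpa [hx, hx0] using this
      have h4 : R w = u := by
        refine tendsto_nhds_unique h2 ((h3.congr fun n => ?_).trans_eq (by rw [hnull]; rfl))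
        rw [borelCalculus_mul π hr (hg n), hΦr]; rfl
      rw [← h4]
      exact hR.mem_domain w
  · rw [scalarMeasure_imagePVM, integral_map hh.aemeasurable (by fun_prop)]
    have hw := hR.inv_apply u
    set w := H u + (c : ℂ) • (u : 𝓗) with hwdef
    have hHu : H u = w - (c : ℂ) • (u : 𝓗) := by rw [hwdef, add_sub_cancel_right]
    have hu' : (u : 𝓗) = borelCalculus π r w := by rw [hΦr]; exact hw.symm
    rw [hHu, hu', vectorMeasure_borelCalculus π hr,
      integral_withDensity_eq_integral_toReal_smul (by fun_prop)
        (Eventually.of_forall fun _ => ENNReal.ofReal_lt_top)]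
    have hb1 : BoundedMeasurable fun x => r x - c * (r x * r x) :=
      hr.sub ((BoundedMeasurable.const c).mul (hr.mul hr))
    have h5 : ∀ x, (ENNReal.ofReal (r x ^ 2)).toReal • h x = r x - c * (r x * r x) := by
      intro x
      dsimp only [h]
      rw [ENNReal.toReal_ofReal (sq_nonneg _), smul_eq_mul]
      by_cases hx : r x = 0
      · simp [hx]
      · field_simp
    simp only [h5]
    have hrr := hr.mul hr
    rw [← inner_self_borelCalculus π hb1,
      borelCalculus_sub π hr ((BoundedMeasurable.const c).mul hrr),
      borelCalculus_mul π (BoundedMeasurable.const c) hrr, borelCalculus_mul π hr hr,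
      borelCalculus_const, hΦr, ← hΦr, inner_borelCalculus π hr, hΦr]
    simp
  · -- the operator `B` is `b(R)`, where `b` is `h - lam` on the interval and `0` elsewhere
    let S : Set (spectrum ℝ R) := X₀ ∩ h ⁻¹' Icc (lam - κ) (lam + κ)
    have hS : MeasurableSet S := hX₀.inter (hh measurableSet_Icc)
    have hS' := BoundedMeasurable.indicator_one hS
    change ∃ B : 𝓗 →L[ℂ] 𝓗, ‖B‖ ≤ κ ∧ borelCalculus π (S.indicator 1) * B = B ∧
        ∀ u, ∃ hu : borelCalculus π (S.indicator 1) u ∈ H.domain,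
          H ⟨borelCalculus π (S.indicator 1) u, hu⟩
            = B u + (lam : ℂ) • borelCalculus π (S.indicator 1) u
    let b : spectrum ℝ R → ℝ := S.indicator fun x => h x - lam
    have hbκ : ∀ x, ‖b x‖ ≤ κ := by
      intro x
      by_cases hx : x ∈ S
      · simp only [b, indicator_of_mem hx]
        have := hx.2
        rw [mem_preimage, mem_Icc] at this
        rw [Real.norm_eq_abs, abs_le]
        constructor <;> linarith
      · simp only [b, indicator_of_notMem hx, norm_zero, hκ]
    have hb : BoundedMeasurable b := ⟨(hh.sub_const lam).indicator hS, κ, hbκ⟩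
    -- `g` is `1 / r` on the interval, written so that its boundedness is visible
    let g : spectrum ℝ R → ℝ := fun x => b x + (lam + c) * S.indicator 1 x
    have hg : BoundedMeasurable g := hb.add ((BoundedMeasurable.const (lam + c)).mul hS')
    have hrg : (fun x => r x * g x) = S.indicator 1 := by
      ext x
      by_cases hx : x ∈ S
      · have hx0 : r x ≠ 0 := hx.1
        simp only [g, b, indicator_of_mem hx, h, Pi.one_apply]
        field_simp
        ring
      · simp only [g, b, indicator_of_notMem hx]
        simp
    refine ⟨borelCalculus π b, ?_, ?_, fun u => ?_⟩
    · refine ContinuousLinearMap.opNorm_le_bound _ hκ fun u => ?_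
      refine le_of_sq_le_sq ?_ (by positivity)
      rw [norm_sq_borelCalculus π hb, mul_pow]
      have h1 : (‖u‖ ^ 2 : ℝ) = ∫ _, (1 : ℝ) ^ 2 ∂(vectorMeasure π u) := by
        rw [← norm_sq_borelCalculus π (BoundedMeasurable.const 1), hone]; rfl
      rw [h1, ← integral_const_mul]
      refine integral_mono (by simpa [pow_two] using (hb.mul hb).integrable _)
        (integrable_const _) fun x => ?_
      rw [← sq_abs, one_pow, mul_one]
      exact pow_le_pow_left₀ (abs_nonneg _) (hbκ x) 2
    · rw [← borelCalculus_mul π hS' hb]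
      congr 1
      ext x
      by_cases hx : x ∈ S <;> simp [b, hx]
    · obtain ⟨hd, hH⟩ := hHR (borelCalculus π g u) (borelCalculus π (S.indicator 1) u) (by
        rw [← hrg, borelCalculus_mul π hr hg, hΦr]; rfl)
      refine ⟨hd, ?_⟩
      rw [hH, borelCalculus_add π hb ((BoundedMeasurable.const (lam + c)).mul hS'),
        borelCalculus_mul π (BoundedMeasurable.const (lam + c)) hS', borelCalculus_const]
      simp only [add_apply, mul_apply_eq_comp, smul_apply, one_apply_eq_self]
      push_cast
      module

end Resolvent

/-! ### Perturbation theory -/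

section Perturbation

variable {𝓗 : Type*} [NormedAddCommGroup 𝓗] [InnerProductSpace ℂ 𝓗] [CompleteSpace 𝓗]

/-- A solution `X` of `X = G X B + K` with `‖G‖ ‖B‖ < 1` is the norm limit of the Picard iterates
starting at `0`; if `K` is compact, then so are the iterates and hence `X`. -/
theorem isCompactOperator_of_eq_mul_mul_add {X G B K : 𝓗 →L[ℂ] 𝓗} (hX : X = G * X * B + K)
    (hK : IsCompactOperator K) (hGB : ‖G‖ * ‖B‖ < 1) : IsCompactOperator X := by
  have h : ∀ n : ℕ, ∃ Y : 𝓗 →L[ℂ] 𝓗, IsCompactOperator Y ∧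
      ‖Y - X‖ ≤ (‖G‖ * ‖B‖) ^ n * ‖X‖ := by
    intro n
    induction n with
    | zero => exact ⟨0, isCompactOperator_zero, by simp⟩
    | succ n ih =>
      obtain ⟨Y, hY, hn⟩ := ih
      refine ⟨G * Y * B + K, IsCompactOperator.add ((hY.clm_comp G).comp_clm B) hK, ?_⟩
      have h1 : G * Y * B + K - X = G * (Y - X) * B := by
        nth_rewrite 1 [hX]
        noncomm_ring
      rw [h1]
      calc ‖G * (Y - X) * B‖ ≤ ‖G‖ * ‖Y - X‖ * ‖B‖ :=
            (norm_mul_le _ _).trans (mul_le_mul_of_nonneg_right (norm_mul_le _ _) (norm_nonneg _))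
        _ ≤ ‖G‖ * ((‖G‖ * ‖B‖) ^ n * ‖X‖) * ‖B‖ := by gcongr
        _ = (‖G‖ * ‖B‖) ^ (n + 1) * ‖X‖ := by ring
  choose Y hY hn using h
  refine isCompactOperator_of_tendsto (l := atTop) (F := Y) ?_ (Eventually.of_forall hY)
  rw [tendsto_iff_norm_sub_tendsto_zero]
  refine squeeze_zero (fun _ => norm_nonneg _) hn ?_
  simpa using (tendsto_pow_atTop_nhds_zero_of_lt_one (by positivity) hGB).mul_const ‖X‖

/-- Spectral localisation of `H = H₀ + V` near `lam` and spectral localisation of `H₀` away from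
`lam` have a compact product when `V` is compact. Here `p` is the projection of `H` for the interval
of radius `κ`, `B = (H - lam) p`, `q` is the complementary projection of `H₀`, and
`G = (H₀ - lam)⁻¹ q`. -/
theorem isCompactOperator_mul_of_localized {H₀ : 𝓗 →ₗ.[ℂ] 𝓗} {V G q p B : 𝓗 →L[ℂ] 𝓗} {lam κ : ℝ}
    (hV : IsCompactOperator V) (hp : ∀ u, p u ∈ H₀.domain)
    (hH : ∀ u, V (p u) + H₀ ⟨p u, hp u⟩ = B u + (lam : ℂ) • p u) (hpB : p * B = B)
    (hG : ∀ u : H₀.domain, G (H₀ u - (lam : ℂ) • (u : 𝓗)) = q u) (hGq : G * q = G)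
    (hκ : 0 < κ) (hB : ‖B‖ ≤ κ) (hGn : ‖G‖ ≤ (2 * κ)⁻¹) : IsCompactOperator (q * p) := by
  -- apply `G` to `(H₀ - lam) p = B - V p`, and use `G = G q` and `B = p B`
  have h1 : q * p = G * (q * p) * B + -(G * V * p) := by
    have h2 : G * (q * p) * B = G * B := by
      rw [← mul_assoc, hGq, mul_assoc, hpB]
    rw [h2]
    ext u
    have h3 := hG ⟨p u, hp u⟩
    have h4 : H₀ ⟨p u, hp u⟩ - (lam : ℂ) • p u = B u - V (p u) := by
      have := hH u
      rw [eq_comm, ← sub_eq_iff_eq_add] at this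
      rw [sub_eq_sub_iff_add_eq_add, ← hH u]
      abel
    rw [h4, map_sub] at h3
    change q (p u) = G (B u) + -(G (V (p u)))
    rw [← h3, sub_eq_add_neg]
  refine isCompactOperator_of_eq_mul_mul_add h1 ((hV.clm_comp G).comp_clm p).neg ?_
  calc ‖G‖ * ‖B‖ ≤ (2 * κ)⁻¹ * κ := by gcongr
    _ < 1 := by field_simp; norm_num

/-- A Neumann series argument: the inverse of `H₀ + c` gives that of `V + H₀ + c`. -/
theorem IsShiftedInverse.exists_of_norm_lt {H₀ : 𝓗 →ₗ.[ℂ] 𝓗} {V R₀ : 𝓗 →L[ℂ] 𝓗} {c : ℝ}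
    (hR₀ : IsShiftedInverse H₀ c R₀) (hV : IsSelfAdjoint V) (hVR : ‖V * R₀‖ < 1) :
    ∃ R, IsShiftedInverse ((V : 𝓗 →ₗ[ℂ] 𝓗) +ᵥ H₀) c R := by
  -- the inverse is `R₀ (1 + V R₀)⁻¹`
  obtain ⟨T, hT⟩ : IsUnit (1 + V * R₀) := by
    have := isUnit_one_sub_of_norm_lt_one (x := -(V * R₀)) (by rwa [norm_neg])
    rwa [sub_neg_eq_add] at this
  set S : 𝓗 →L[ℂ] 𝓗 := ((T⁻¹ : (𝓗 →L[ℂ] 𝓗)ˣ) : 𝓗 →L[ℂ] 𝓗) with hS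
  have h1 : ∀ w, S w + V (R₀ (S w)) = w := by
    intro w
    have : (1 + V * R₀) * S = 1 := by rw [← hT, hS, Units.mul_inv]
    exact congrArg (fun A : 𝓗 →L[ℂ] 𝓗 => A w) this
  have h2 : ∀ w, S (w + V (R₀ w)) = w := by
    intro w
    have : S * (1 + V * R₀) = 1 := by rw [← hT, hS, Units.inv_mul]
    exact congrArg (fun A : 𝓗 →L[ℂ] 𝓗 => A w) this
  have hmem : ∀ w, (R₀ * S) w ∈ ((V : 𝓗 →ₗ[ℂ] 𝓗) +ᵥ H₀).domain := fun w => hR₀.mem_domain (S w)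
  have happ : ∀ w, ((V : 𝓗 →ₗ[ℂ] 𝓗) +ᵥ H₀) ⟨(R₀ * S) w, hmem w⟩
      = w - (c : ℂ) • (R₀ * S) w := by
    intro w
    rw [LinearPMap.vadd_apply]
    change V (R₀ (S w)) + H₀ ⟨R₀ (S w), hR₀.mem_domain (S w)⟩ = w - (c : ℂ) • R₀ (S w)
    rw [hR₀.apply_inv]
    conv_rhs => enter [1]; rw [← h1 w]
    abel
  have hinv : ∀ u : ((V : 𝓗 →ₗ[ℂ] 𝓗) +ᵥ H₀).domain,
      (R₀ * S) (((V : 𝓗 →ₗ[ℂ] 𝓗) +ᵥ H₀) u + (c : ℂ) • (u : 𝓗)) = u := by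
    intro u
    have h3 := hR₀.inv_apply u
    set w := H₀ u + (c : ℂ) • (u : 𝓗) with hw
    have h4 : ((V : 𝓗 →ₗ[ℂ] 𝓗) +ᵥ H₀) u + (c : ℂ) • (u : 𝓗) = w + V (R₀ w) := by
      rw [LinearPMap.vadd_apply, h3, hw, ContinuousLinearMap.coe_coe]
      abel
    rw [mul_apply_eq_comp, h4, h2, h3]
  refine ⟨R₀ * S, ⟨?_, hmem, happ, hinv⟩⟩
  rw [ContinuousLinearMap.isSelfAdjoint_iff_isSymmetric]
  intro u w
  have hR₀s : ∀ x y, ⟪R₀ x, y⟫_ℂ = ⟪x, R₀ y⟫_ℂ := hR₀.isSelfAdjoint.isSymmetric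
  have hVs : ∀ x y, ⟪V x, y⟫_ℂ = ⟪x, V y⟫_ℂ := hV.isSymmetric
  change ⟪R₀ (S u), w⟫_ℂ = ⟪u, R₀ (S w)⟫_ℂ
  conv_lhs => rw [← h1 w]
  conv_rhs => rw [← h1 u]
  rw [inner_add_right, inner_add_left, hR₀s, hVs]

end Perturbation

/-! ### Bounded Fourier multipliers -/

section Multipliers

variable {ν : ℕ}

theorem fourierEquivL2_injective {u w : L2 ν}
    (h : (fourierEquivL2 ν u : Space ν → ℂ) =ᵐ[volume] fourierEquivL2 ν w) : u = w :=
  (fourierEquivL2 ν).injective (Lp.ext h)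

theorem inner_fourierEquivL2 (u w : L2 ν) :
    ⟪fourierEquivL2 ν u, fourierEquivL2 ν w⟫_ℂ = ⟪u, w⟫_ℂ :=
  (Lp.fourierTransformₗᵢ (Space ν) ℂ).inner_map_map u w

theorem norm_fourierEquivL2 (u : L2 ν) : ‖fourierEquivL2 ν u‖ = ‖u‖ :=
  (Lp.fourierTransformₗᵢ (Space ν) ℂ).norm_map u

theorem inner_eq_integral_fourier (u w : L2 ν) : ⟪u, w⟫_ℂ =
    ∫ ξ, (starRingEnd ℂ) ((fourierEquivL2 ν u : Space ν → ℂ) ξ)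
      * (fourierEquivL2 ν w : Space ν → ℂ) ξ := by
  rw [← inner_fourierEquivL2, L2.inner_def]
  refine integral_congr_ae (Eventually.of_forall fun ξ => ?_)
  dsimp only
  rw [RCLike.inner_apply, mul_comm]

theorem mem_multiplier_domain {m : Space ν → ℝ} {u : L2 ν} : u ∈ (multiplier m).domain ↔
    MemLp (fun ξ => (m ((2 * Real.pi) • ξ) : ℂ) * (fourierEquivL2 ν u : Space ν → ℂ) ξ) 2 volume :=
  Iff.rfl

theorem fourierEquivL2_multiplier (m : Space ν → ℝ) (u : (multiplier m).domain) :
    (fourierEquivL2 ν (multiplier m u) : Space ν → ℂ) =ᵐ[volume]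
      fun ξ => (m ((2 * Real.pi) • ξ) : ℂ) * (fourierEquivL2 ν (u : L2 ν) : Space ν → ℂ) ξ := by
  have h : fourierEquivL2 ν (multiplier m u)
      = MemLp.toLp _ (mem_multiplier_domain.1 u.2) := LinearEquiv.apply_symm_apply _ _
  rw [h]
  exact MemLp.coeFn_toLp _

theorem BoundedMeasurable.comp_smul {f : Space ν → ℝ} (hf : BoundedMeasurable f) :
    BoundedMeasurable fun ξ : Space ν => f ((2 * Real.pi) • ξ) := by
  obtain ⟨hm, C, hC⟩ := hf
  exact ⟨hm.comp (measurable_const_smul _), C, fun ξ => hC _⟩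

theorem BoundedMeasurable.memLp_mul {f : Space ν → ℝ} (hf : BoundedMeasurable f) (u : L2 ν) :
    MemLp (fun ξ => (f ξ : ℂ) * (u : Space ν → ℂ) ξ) 2 volume := by
  obtain ⟨hm, C, hC⟩ := hf
  refine MemLp.of_le_mul (Lp.memLp u) ((Complex.measurable_ofReal.comp hm).aestronglyMeasurable.mul
    (Lp.memLp u).1) (c := C) (Eventually.of_forall fun ξ => ?_)
  rw [norm_mul, Complex.norm_real]
  exact mul_le_mul_of_nonneg_right (hC ξ) (norm_nonneg _)

theorem BoundedMeasurable.mem_domain {f : Space ν → ℝ} (hf : BoundedMeasurable f) (u : L2 ν) :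
    u ∈ (multiplier f).domain :=
  mem_multiplier_domain.2 (hf.comp_smul.memLp_mul _)

theorem norm_multiplier_le {f : Space ν → ℝ} {C : ℝ} (hC : ∀ k, |f k| ≤ C)
    (u : (multiplier f).domain) : ‖multiplier f u‖ ≤ C * ‖(u : L2 ν)‖ := by
  rw [← norm_fourierEquivL2, ← norm_fourierEquivL2 (u : L2 ν)]
  refine Lp.norm_le_mul_norm_of_ae_le_mul ?_
  filter_upwards [fourierEquivL2_multiplier f u] with ξ hξ
  rw [hξ, norm_mul, Complex.norm_real]
  exact mul_le_mul_of_nonneg_right (hC _) (norm_nonneg _)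

/-- The bounded operator `f(D)`, for a bounded measurable function `f` (and `0` for other `f`). -/
def boundedMultiplier (f : Space ν → ℝ) : L2 ν →L[ℂ] L2 ν := by
  classical
  exact if hf : BoundedMeasurable f then
    LinearMap.mkContinuousOfExistsBound
      ((multiplier f).toFun.comp (LinearMap.id.codRestrict (multiplier f).domain hf.mem_domain))
      (by
        obtain ⟨C, hC⟩ := hf.bounded
        exact ⟨C, fun u => norm_multiplier_le hC _⟩)
  else 0

theorem boundedMultiplier_apply {f : Space ν → ℝ} (hf : BoundedMeasurable f) (u : L2 ν) :
    boundedMultiplier f u = multiplier f ⟨u, hf.mem_domain u⟩ := by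
  rw [boundedMultiplier, dif_pos hf]; rfl

theorem fourierEquivL2_boundedMultiplier {f : Space ν → ℝ} (hf : BoundedMeasurable f)
    (u : L2 ν) : (fourierEquivL2 ν (boundedMultiplier f u) : Space ν → ℂ) =ᵐ[volume]
      fun ξ => (f ((2 * Real.pi) • ξ) : ℂ) * (fourierEquivL2 ν u : Space ν → ℂ) ξ := by
  rw [boundedMultiplier_apply hf]
  exact fourierEquivL2_multiplier f _

theorem norm_boundedMultiplier_apply_le {f : Space ν → ℝ} (hf : BoundedMeasurable f) {C : ℝ}
    (hC : ∀ k, |f k| ≤ C) (u : L2 ν) : ‖boundedMultiplier f u‖ ≤ C * ‖u‖ := by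
  rw [boundedMultiplier_apply hf]
  exact norm_multiplier_le hC _

theorem boundedMultiplier_add {f g : Space ν → ℝ} (hf : BoundedMeasurable f)
    (hg : BoundedMeasurable g) :
    boundedMultiplier (fun k => f k + g k) = boundedMultiplier f + boundedMultiplier g := by
  ext1 u
  refine fourierEquivL2_injective ?_
  rw [add_apply, map_add]
  filter_upwards [fourierEquivL2_boundedMultiplier (hf.add hg) u,
    fourierEquivL2_boundedMultiplier hf u, fourierEquivL2_boundedMultiplier hg u,
    Lp.coeFn_add (fourierEquivL2 ν (boundedMultiplier f u))
      (fourierEquivL2 ν (boundedMultiplier g u))] with ξ h1 h2 h3 h4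
  rw [h1, h4, Pi.add_apply, h2, h3]
  push_cast
  ring

theorem boundedMultiplier_mul {f g : Space ν → ℝ} (hf : BoundedMeasurable f)
    (hg : BoundedMeasurable g) :
    boundedMultiplier (fun k => f k * g k) = boundedMultiplier f * boundedMultiplier g := by
  ext1 u
  refine fourierEquivL2_injective ?_
  rw [mul_apply_eq_comp]
  filter_upwards [fourierEquivL2_boundedMultiplier (hf.mul hg) u,
    fourierEquivL2_boundedMultiplier hf (boundedMultiplier g u),
    fourierEquivL2_boundedMultiplier hg u] with ξ h1 h2 h3
  rw [h1, h2, h3]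
  push_cast
  ring

theorem boundedMultiplier_one : boundedMultiplier (fun _ : Space ν => 1) = 1 := by
  ext1 u
  refine fourierEquivL2_injective ?_
  filter_upwards [fourierEquivL2_boundedMultiplier (BoundedMeasurable.const (1 : ℝ)) u] with ξ h
  rw [h]
  simp

theorem boundedMultiplier_zero : boundedMultiplier (fun _ : Space ν => 0) = 0 := by
  have h := boundedMultiplier_add (ν := ν) (BoundedMeasurable.const 0) (BoundedMeasurable.const 0)
  simpa using h

theorem inner_boundedMultiplier {f : Space ν → ℝ} (hf : BoundedMeasurable f) (u w : L2 ν) :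
    ⟪boundedMultiplier f u, w⟫_ℂ = ⟪u, boundedMultiplier f w⟫_ℂ := by
  rw [inner_eq_integral_fourier, inner_eq_integral_fourier]
  refine integral_congr_ae ?_
  filter_upwards [fourierEquivL2_boundedMultiplier hf u,
    fourierEquivL2_boundedMultiplier hf w] with ξ h1 h2
  rw [h1, h2, map_mul, Complex.conj_ofReal]
  ring

theorem inner_boundedMultiplier_nonneg {f : Space ν → ℝ} (hf : BoundedMeasurable f)
    (h0 : ∀ k, 0 ≤ f k) (u : L2 ν) :
    ∃ a : ℝ, 0 ≤ a ∧ ⟪u, boundedMultiplier f u⟫_ℂ = (a : ℂ) := by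
  refine ⟨∫ ξ, f ((2 * Real.pi) • ξ) * ‖(fourierEquivL2 ν u : Space ν → ℂ) ξ‖ ^ 2,
    integral_nonneg fun ξ => mul_nonneg (h0 _) (sq_nonneg _), ?_⟩
  rw [inner_eq_integral_fourier, ← integral_complex_ofReal]
  refine integral_congr_ae ?_
  filter_upwards [fourierEquivL2_boundedMultiplier hf u] with ξ h
  rw [h, mul_left_comm, ← Complex.normSq_eq_conj_mul_self, Complex.normSq_eq_norm_sq]
  push_cast
  ring

theorem boundedMultiplier_multiplier {m f g : Space ν → ℝ} (hf : BoundedMeasurable f)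
    (hg : BoundedMeasurable g) (h : ∀ k, f k * m k = g k) (u : (multiplier m).domain) :
    boundedMultiplier f (multiplier m u) = boundedMultiplier g (u : L2 ν) := by
  refine fourierEquivL2_injective ?_
  filter_upwards [fourierEquivL2_boundedMultiplier hf (multiplier m u),
    fourierEquivL2_boundedMultiplier hg (u : L2 ν), fourierEquivL2_multiplier m u] with ξ h1 h2 h3
  rw [h1, h2, h3, ← h]
  push_cast
  ring

theorem multiplier_boundedMultiplier {m f g : Space ν → ℝ} (hf : BoundedMeasurable f)
    (hg : BoundedMeasurable g) (h : ∀ k, m k * f k = g k) (u : L2 ν) :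
    ∃ hd : boundedMultiplier f u ∈ (multiplier m).domain,
      multiplier m ⟨boundedMultiplier f u, hd⟩ = boundedMultiplier g u := by
  have h1 : (fun ξ => (m ((2 * Real.pi) • ξ) : ℂ)
      * (fourierEquivL2 ν (boundedMultiplier f u) : Space ν → ℂ) ξ)
      =ᵐ[volume] fourierEquivL2 ν (boundedMultiplier g u) := by
    filter_upwards [fourierEquivL2_boundedMultiplier hf u,
      fourierEquivL2_boundedMultiplier hg u] with ξ h1 h2
    rw [h1, h2, ← h]
    push_cast
    ring
  have hd : boundedMultiplier f u ∈ (multiplier m).domain :=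
    mem_multiplier_domain.2 ((memLp_congr_ae h1).2 (Lp.memLp _))
  exact ⟨hd, fourierEquivL2_injective ((fourierEquivL2_multiplier m _).trans h1)⟩

end Multipliers

/-! ### Diagonal operators on `ℂ ⊕ L²` -/

section Block

variable {ν : ℕ}

/-- The bounded operator `(z, u) ↦ (a z, f(D) u)`. -/
def blockMultiplier (a : ℝ) (f : Space ν → ℝ) : FiberSpace ν →L[ℂ] FiberSpace ν :=
  ((WithLp.prodContinuousLinearEquiv 2 ℂ ℂ (L2 ν)).symm : ℂ × L2 ν →L[ℂ] FiberSpace ν) ∘L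
    (((a : ℂ) • ContinuousLinearMap.id ℂ ℂ).prodMap (boundedMultiplier f)) ∘L
      (WithLp.prodContinuousLinearEquiv 2 ℂ ℂ (L2 ν) : FiberSpace ν →L[ℂ] ℂ × L2 ν)

theorem blockMultiplier_apply (a : ℝ) (f : Space ν → ℝ) (u : FiberSpace ν) :
    blockMultiplier a f u = WithLp.toLp 2 ((a : ℂ) * u.fst, boundedMultiplier f u.snd) := rfl

theorem blockMultiplier_fst (a : ℝ) (f : Space ν → ℝ) (u : FiberSpace ν) :
    (blockMultiplier a f u).fst = (a : ℂ) * u.fst := rfl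

theorem blockMultiplier_snd (a : ℝ) (f : Space ν → ℝ) (u : FiberSpace ν) :
    (blockMultiplier a f u).snd = boundedMultiplier f u.snd := rfl

theorem inner_fiberSpace (u w : FiberSpace ν) :
    ⟪u, w⟫_ℂ = (starRingEnd ℂ) u.fst * w.fst + ⟪u.snd, w.snd⟫_ℂ := by
  rw [WithLp.prod_inner_apply, RCLike.inner_apply, mul_comm]
  rfl

theorem fiberSpace_ext {u w : FiberSpace ν} (h1 : u.fst = w.fst) (h2 : u.snd = w.snd) : u = w :=
  (WithLp.ofLp_injective 2) (Prod.ext h1 h2)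

theorem blockMultiplier_mul {a b : ℝ} {f g : Space ν → ℝ} (hf : BoundedMeasurable f)
    (hg : BoundedMeasurable g) : blockMultiplier a f * blockMultiplier b g
      = blockMultiplier (a * b) fun k => f k * g k := by
  ext1 u
  refine fiberSpace_ext ?_ ?_
  · simp [blockMultiplier_apply, mul_assoc]
  · simp [blockMultiplier_apply, boundedMultiplier_mul hf hg]

theorem blockMultiplier_add {a b : ℝ} {f g : Space ν → ℝ} (hf : BoundedMeasurable f)
    (hg : BoundedMeasurable g) : blockMultiplier a f + blockMultiplier b g
      = blockMultiplier (a + b) fun k => f k + g k := by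
  ext1 u
  refine fiberSpace_ext ?_ ?_
  · simp [blockMultiplier_apply, add_mul]
  · simp [blockMultiplier_apply, boundedMultiplier_add hf hg]

theorem blockMultiplier_smul {a : ℝ} {f : Space ν → ℝ} (hf : BoundedMeasurable f) (t : ℝ) :
    (t : ℂ) • blockMultiplier a f = blockMultiplier (t * a) fun k => t * f k := by
  ext1 u
  refine fiberSpace_ext ?_ ?_
  · rw [smul_apply, WithLp.smul_fst, blockMultiplier_fst, blockMultiplier_fst, smul_eq_mul]
    push_cast
    ring
  · refine fourierEquivL2_injective ?_
    rw [smul_apply, WithLp.smul_snd, blockMultiplier_snd, blockMultiplier_snd, map_smul]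
    filter_upwards [fourierEquivL2_boundedMultiplier ((BoundedMeasurable.const t).mul hf) u.snd,
      fourierEquivL2_boundedMultiplier hf u.snd,
      Lp.coeFn_smul (t : ℂ) (fourierEquivL2 ν (boundedMultiplier f u.snd))] with ξ h1 h2 h3
    rw [h1, h3, Pi.smul_apply, h2, smul_eq_mul]
    push_cast
    ring

theorem blockMultiplier_one : blockMultiplier 1 (fun _ : Space ν => 1) = 1 := by
  ext1 u
  refine fiberSpace_ext ?_ ?_
  · simp [blockMultiplier_apply]
  · simp [blockMultiplier_apply, boundedMultiplier_one]

theorem inner_blockMultiplier {a : ℝ} {f : Space ν → ℝ} (hf : BoundedMeasurable f)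
    (u w : FiberSpace ν) : ⟪blockMultiplier a f u, w⟫_ℂ = ⟪u, blockMultiplier a f w⟫_ℂ := by
  simp only [inner_fiberSpace, blockMultiplier_fst, blockMultiplier_snd,
    inner_boundedMultiplier hf, map_mul, Complex.conj_ofReal]
  ring

theorem inner_blockMultiplier_nonneg {a : ℝ} {f : Space ν → ℝ} (hf : BoundedMeasurable f)
    (ha : 0 ≤ a) (h0 : ∀ k, 0 ≤ f k) (u : FiberSpace ν) :
    ∃ b : ℝ, 0 ≤ b ∧ ⟪u, blockMultiplier a f u⟫_ℂ = (b : ℂ) := by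
  obtain ⟨b, hb, h⟩ := inner_boundedMultiplier_nonneg hf h0 u.snd
  refine ⟨a * ‖u.fst‖ ^ 2 + b, by positivity, ?_⟩
  rw [inner_fiberSpace, blockMultiplier_fst, blockMultiplier_snd, h, mul_left_comm,
    ← Complex.normSq_eq_conj_mul_self, Complex.normSq_eq_norm_sq]
  push_cast
  rfl

theorem norm_blockMultiplier_le {a C : ℝ} {f : Space ν → ℝ} (hf : BoundedMeasurable f)
    (ha : |a| ≤ C) (hC : ∀ k, |f k| ≤ C) : ‖blockMultiplier a f‖ ≤ C := by
  have hC0 : 0 ≤ C := (abs_nonneg _).trans ha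
  refine ContinuousLinearMap.opNorm_le_bound _ hC0 fun u => ?_
  refine le_of_sq_le_sq ?_ (by positivity)
  rw [mul_pow, WithLp.prod_norm_sq_eq_of_L2, WithLp.prod_norm_sq_eq_of_L2 u, mul_add, ← mul_pow,
    ← mul_pow]
  refine add_le_add (pow_le_pow_left₀ (norm_nonneg _) ?_ 2) (pow_le_pow_left₀ (norm_nonneg _) ?_ 2)
  · rw [blockMultiplier_apply, WithLp.toLp_fst, norm_mul, Complex.norm_real]
    exact mul_le_mul_of_nonneg_right ha (norm_nonneg _)
  · exact norm_boundedMultiplier_apply_le hf hC _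

theorem diagonal_apply (e : ℂ) (T : L2 ν →ₗ.[ℂ] L2 ν) (u : (diagonal e T).domain) :
    diagonal e T u = WithLp.toLp 2 (e * (u : FiberSpace ν).fst, T ⟨(u : FiberSpace ν).snd, u.2⟩) :=
  rfl

/-- If `f (m + t) = g` then `f(D) (m(D) + t) = g(D)`, with `f` and `g` bounded. -/
theorem blockMultiplier_diagonal {e t a b : ℝ} {m f g : Space ν → ℝ} (hf : BoundedMeasurable f)
    (hg : BoundedMeasurable g) (hab : a * (e + t) = b) (hfg : ∀ k, f k * (m k + t) = g k)
    (u : (diagonal (e : ℂ) (multiplier m)).domain) :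
    blockMultiplier a f (diagonal (e : ℂ) (multiplier m) u + (t : ℂ) • (u : FiberSpace ν))
      = blockMultiplier b g u := by
  have h1 := boundedMultiplier_multiplier (m := m) hf
    (hg.sub ((BoundedMeasurable.const t).mul hf)) (fun k => by rw [← hfg]; ring)
    ⟨(u : FiberSpace ν).snd, u.2⟩
  refine fiberSpace_ext ?_ ?_
  · simp only [blockMultiplier_apply, diagonal_apply, WithLp.toLp_fst, WithLp.add_fst,
      WithLp.smul_fst, smul_eq_mul, ← hab]
    push_cast
    ring
  · simp only [blockMultiplier_apply, diagonal_apply, WithLp.toLp_snd, WithLp.add_snd,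
      WithLp.smul_snd, map_add, map_smul, h1]
    have h2 : boundedMultiplier g
        = boundedMultiplier (fun k => g k - t * f k) + boundedMultiplier (fun k => t * f k) := by
      rw [← boundedMultiplier_add (hg.sub ((BoundedMeasurable.const t).mul hf))
        ((BoundedMeasurable.const t).mul hf)]
      simp
    have h3 := congrArg (fun A : FiberSpace ν →L[ℂ] FiberSpace ν => (A (u : FiberSpace ν)).snd)
      (blockMultiplier_smul (a := 0) hf t)
    simp only [smul_apply, blockMultiplier_apply, WithLp.smul_snd, WithLp.toLp_snd] at h3
    rw [h2, add_apply, h3]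

theorem boundedMeasurable_inv_add {m : Space ν → ℝ} (hm : Measurable m) (hm0 : ∀ k, 0 ≤ m k)
    {c : ℝ} (hc : 0 < c) : BoundedMeasurable fun k => (m k + c)⁻¹ := by
  refine ⟨(hm.add_const c).inv, c⁻¹, fun k => ?_⟩
  rw [norm_inv, Real.norm_of_nonneg (by linarith [hm0 k])]
  exact inv_anti₀ hc (by linarith [hm0 k])

theorem isShiftedInverse_diagonal {e c : ℝ} {m : Space ν → ℝ} (he : 0 ≤ e) (hm : Measurable m)
    (hm0 : ∀ k, 0 ≤ m k) (hc : 0 < c) :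
    IsShiftedInverse (diagonal (e : ℂ) (multiplier m)) c
      (blockMultiplier (e + c)⁻¹ fun k => (m k + c)⁻¹) := by
  have hf := boundedMeasurable_inv_add hm hm0 hc
  have hec : (e + c) ≠ 0 := by positivity
  have hmc : ∀ k, m k + c ≠ 0 := fun k => by linarith [hm0 k]
  have hg : BoundedMeasurable fun k => 1 - c * (m k + c)⁻¹ :=
    (BoundedMeasurable.const 1).sub ((BoundedMeasurable.const c).mul hf)
  have hd := multiplier_boundedMultiplier (m := m) hf hg (fun k => by field_simp [hmc k]; ring)
  refine ⟨?_, fun w => (hd w.snd).1, fun w => ?_, fun u => ?_⟩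
  · rw [ContinuousLinearMap.isSelfAdjoint_iff_isSymmetric]
    exact fun u w => inner_blockMultiplier hf u w
  · have h1 : (1 : FiberSpace ν →L[ℂ] FiberSpace ν)
        = blockMultiplier (1 - c * (e + c)⁻¹) (fun k => 1 - c * (m k + c)⁻¹)
          + (c : ℂ) • blockMultiplier (e + c)⁻¹ fun k => (m k + c)⁻¹ := by
      rw [blockMultiplier_smul hf, blockMultiplier_add hg ((BoundedMeasurable.const c).mul hf),
        ← blockMultiplier_one]
      simp
    have h2 := congrArg (fun A : FiberSpace ν →L[ℂ] FiberSpace ν => A w) h1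
    simp only [one_apply_eq_self, add_apply, smul_apply] at h2
    rw [eq_sub_iff_add_eq]
    refine Eq.trans ?_ h2.symm
    congr 1
    refine fiberSpace_ext ?_ (hd w.snd).2
    rw [diagonal_apply, WithLp.toLp_fst, blockMultiplier_fst, blockMultiplier_fst]
    push_cast
    have : (e : ℂ) + c ≠ 0 := by exact_mod_cast hec
    field_simp
    ring
  · have h1 := blockMultiplier_diagonal (e := e) (t := c) (a := (e + c)⁻¹) (b := 1) (m := m) hf
      (BoundedMeasurable.const 1) (inv_mul_cancel₀ hec) (fun k => inv_mul_cancel₀ (hmc k)) u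
    rw [h1, blockMultiplier_one]
    rfl

end Block

/-! ### Operators of rank one -/

section RankOne

variable {𝓗 : Type*} [NormedAddCommGroup 𝓗] [InnerProductSpace ℂ 𝓗]

theorem isCompactOperator_rankOne (x y : 𝓗) :
    IsCompactOperator (InnerProductSpace.rankOne ℂ x y) := by
  have h : IsCompactOperator (innerSL ℂ y : 𝓗 →L[ℂ] ℂ) :=
    isCompactOperator_of_locallyCompactSpace_dom (innerSL ℂ y)
  exact h.clm_comp (ContinuousLinearMap.toSpanSingleton ℂ x)

variable {ν : ℕ}

/-- The unit vector `(1, 0)` of `ℂ ⊕ L²`. -/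
def vacuum (ν : ℕ) : FiberSpace ν := WithLp.toLp 2 (1, 0)

/-- The vector `(0, u)` of `ℂ ⊕ L²`. -/
def oneParticle (u : L2 ν) : FiberSpace ν := WithLp.toLp 2 (0, u)

theorem inner_vacuum (u : FiberSpace ν) : ⟪vacuum ν, u⟫_ℂ = u.fst := by
  simp [vacuum, WithLp.prod_inner_apply]

theorem inner_oneParticle (τ : L2 ν) (u : FiberSpace ν) : ⟪oneParticle τ, u⟫_ℂ = ⟪τ, u.snd⟫_ℂ := by
  simp [oneParticle, WithLp.prod_inner_apply]

theorem rankOne_vacuum_vacuum :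
    InnerProductSpace.rankOne ℂ (vacuum ν) (vacuum ν) = blockMultiplier 1 fun _ => 0 := by
  ext1 u
  rw [InnerProductSpace.rankOne_apply, inner_vacuum]
  refine fiberSpace_ext ?_ ?_
  · simp [vacuum, blockMultiplier_apply]
  · simp [vacuum, blockMultiplier_apply, boundedMultiplier_zero]

/-- The interaction as a bounded operator. -/
def interactionL (ρ : L2 ν) : FiberSpace ν →L[ℂ] FiberSpace ν :=
  InnerProductSpace.rankOne ℂ (vacuum ν) (oneParticle ρ)
    + InnerProductSpace.rankOne ℂ (oneParticle ρ) (vacuum ν)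

theorem coe_interactionL (ρ : L2 ν) :
    (interactionL ρ : FiberSpace ν →ₗ[ℂ] FiberSpace ν) = interaction ρ := by
  ext1 u
  change ⟪oneParticle ρ, u⟫_ℂ • vacuum ν + ⟪vacuum ν, u⟫_ℂ • oneParticle ρ = interaction ρ u
  rw [inner_oneParticle, inner_vacuum]
  refine fiberSpace_ext ?_ ?_
  · simp [vacuum, oneParticle, interaction]
  · simp [vacuum, oneParticle, interaction]

theorem isCompactOperator_interactionL (ρ : L2 ν) : IsCompactOperator (interactionL ρ) :=
  (isCompactOperator_rankOne _ _).add (isCompactOperator_rankOne _ _)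

theorem isSelfAdjoint_interactionL (ρ : L2 ν) : IsSelfAdjoint (interactionL ρ) := by
  rw [IsSelfAdjoint, interactionL, ContinuousLinearMap.star_eq_adjoint, map_add,
    InnerProductSpace.adjoint_rankOne,
    InnerProductSpace.adjoint_rankOne, add_comm]

end RankOne

/-! ### The positive commutator estimate -/

section Estimate

variable {ν : ℕ}

/-- The Mourre estimate for `H = V + diag (e, m(D))`, for a commutator of the form
`diag (0, q(D)) + K₁`, where `V` and `K₁` are compact and `q` is bounded below by `c > 0` where `m`
is within `2 κ` of `lam`. -/
theorem exists_mourre_estimate {e lam κ c A : ℝ} {m q : Space ν → ℝ}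
    {V K₁ : FiberSpace ν →L[ℂ] FiberSpace ν} (he : 0 ≤ e) (hm : Measurable m)
    (hm0 : ∀ k, 0 ≤ m k) (hq : Measurable q) (hq0 : ∀ k, 0 ≤ q k) (hqA : ∀ k, q k ≤ A * (m k + 1))
    (hV : IsCompactOperator V) (hVs : IsSelfAdjoint V) (hK₁ : IsCompactOperator K₁) (hκ : 0 < κ)
    (hc : ∀ k, |m k - lam| ≤ 2 * κ → c ≤ q k) :
    ∃ E : ProjectionValuedMeasure (FiberSpace ν),
      IsSpectralMeasure ((V : FiberSpace ν →ₗ[ℂ] FiberSpace ν) +ᵥ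
        diagonal (e : ℂ) (multiplier m)) E ∧
      ∃ K T : FiberSpace ν →L[ℂ] FiberSpace ν, IsCompactOperator K ∧
        (∃ hp : ∀ u, E.proj (Icc (lam - κ) (lam + κ)) u
            ∈ (diagonal (e : ℂ) (multiplier m)).domain,
          ∀ u w, ⟪u, T w⟫_ℂ = ⟪E.proj (Icc (lam - κ) (lam + κ)) u,
              blockMultiplier 0 (fun k => q k * (m k + 1)⁻¹)
                (diagonal (e : ℂ) (multiplier m) ⟨_, hp w⟩
                  + E.proj (Icc (lam - κ) (lam + κ)) w)⟫_ℂ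
            + ⟪E.proj (Icc (lam - κ) (lam + κ)) u, K₁ (E.proj (Icc (lam - κ) (lam + κ)) w)⟫_ℂ) ∧
        (c : ℂ) • E.proj (Icc (lam - κ) (lam + κ)) + K ≤ T := by
  set H₀ := diagonal (e : ℂ) (multiplier m) with hH₀
  -- `H₀ ≥ 0`, so that `‖V (H₀ + ‖V‖ + 1)⁻¹‖ < 1`
  obtain ⟨R, hR⟩ : ∃ R, IsShiftedInverse ((V : FiberSpace ν →ₗ[ℂ] FiberSpace ν) +ᵥ H₀)
      (‖V‖ + 1) R := by
    have hc1 : 0 < ‖V‖ + 1 := by positivity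
    refine (isShiftedInverse_diagonal he hm hm0 hc1).exists_of_norm_lt hVs ?_
    have h1 := norm_blockMultiplier_le (a := (e + (‖V‖ + 1))⁻¹) (C := (‖V‖ + 1)⁻¹)
      (boundedMeasurable_inv_add hm hm0 hc1)
      (by
        rw [abs_of_nonneg (by positivity)]
        exact inv_anti₀ hc1 (by linarith))
      (fun k => by
        have := hm0 k
        rw [abs_of_nonneg (by positivity)]
        exact inv_anti₀ hc1 (by linarith))
    calc _ ≤ ‖V‖ * (‖V‖ + 1)⁻¹ := (norm_mul_le _ _).trans (by gcongr)
      _ < 1 := by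
        rw [← div_eq_mul_inv, div_lt_one hc1]
        linarith
  obtain ⟨E, hE, hloc⟩ := hR.exists_spectralMeasure
  refine ⟨E, hE, ?_⟩
  obtain ⟨B, hB, hEB, hH⟩ := hloc lam κ hκ.le
  set p := E.proj (Icc (lam - κ) (lam + κ)) with hpdef
  have hp : ∀ u, p u ∈ H₀.domain := fun u => (hH u).1
  have hH' : ∀ u, V (p u) + H₀ ⟨p u, hp u⟩ = B u + (lam : ℂ) • p u := fun u => (hH u).2
  have hstar : IsStarProjection p := E.isStarProjection _ measurableSet_Icc
  have hps : ∀ u w, ⟪p u, w⟫_ℂ = ⟪u, p w⟫_ℂ := hstar.isSelfAdjoint.isSymmetric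
  -- the set where `m` is close to `lam`, and the multipliers of the argument
  let S : Set (Space ν) := {k | |m k - lam| ≤ 2 * κ}
  have hS : MeasurableSet S := measurableSet_le (hm.sub_const lam).abs measurable_const
  have hS1 := BoundedMeasurable.indicator_one hS
  have hS2 := BoundedMeasurable.indicator_one hS.compl
  have hinv := boundedMeasurable_inv_add hm hm0 one_pos
  have hqb : BoundedMeasurable fun k => q k * (m k + 1)⁻¹ := by
    refine ⟨hq.mul hinv.measurable, A, fun k => ?_⟩
    have h1 : 0 < m k + 1 := by linarith [hm0 k]
    rw [Real.norm_of_nonneg (mul_nonneg (hq0 k) (inv_nonneg.2 h1.le)), ← div_eq_mul_inv,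
      div_le_iff₀ h1]
    exact hqA k
  -- `g(D)` is the inverse of `m(D) - lam` off the energy shell
  let g : Space ν → ℝ := Sᶜ.indicator fun k => (m k - lam)⁻¹
  have hgC : ∀ k, |g k| ≤ (2 * κ)⁻¹ := by
    intro k
    by_cases hk : k ∈ Sᶜ
    · simp only [g, indicator_of_mem hk, abs_inv]
      exact inv_anti₀ (by positivity) (not_le.1 (show ¬|m k - lam| ≤ 2 * κ from hk)).le
    · simp only [g, indicator_of_notMem hk, abs_zero]
      positivity
  have hg : BoundedMeasurable g := ⟨(hm.sub_const lam).inv.indicator hS.compl, _, hgC⟩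
  have hQE : IsCompactOperator (blockMultiplier 0 (Sᶜ.indicator 1) * p) := by
    refine isCompactOperator_mul_of_localized (G := blockMultiplier 0 g) hV hp hH' hEB
      (fun u => ?_) ?_ hκ hB (norm_blockMultiplier_le hg (by rw [abs_zero]; positivity) hgC)
    · rw [← blockMultiplier_diagonal (e := e) (t := -lam) (a := 0) (b := 0) (m := m) hg hS2
        (by simp) (fun k => ?_) u]
      · rw [Complex.ofReal_neg, neg_smul, ← sub_eq_add_neg]
      · by_cases hk : k ∈ Sᶜ
        · have h1 : m k - lam ≠ 0 := fun h => hk (by simp only [S, mem_ofPred_eq, h]; simp [hκ.le])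
          simp only [g, indicator_of_mem hk, ← sub_eq_add_neg, Pi.one_apply]
          exact inv_mul_cancel₀ h1
        · simp [g, indicator_of_notMem hk]
    · rw [blockMultiplier_mul hg hS2, mul_zero]
      congr 1
      ext k
      by_cases hk : k ∈ Sᶜ
      · simp only [g, indicator_of_mem hk, Pi.one_apply, mul_one]
      · simp only [g, indicator_of_notMem hk, zero_mul]
  -- `N = (H₀ + 1) p`, a bounded operator
  let N : FiberSpace ν →L[ℂ] FiberSpace ν := B + ((lam : ℂ) + 1) • p - V * p
  have hN : ∀ u, N u = H₀ ⟨p u, hp u⟩ + p u := by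
    intro u
    have h1 : H₀ ⟨p u, hp u⟩ = B u + (lam : ℂ) • p u - V (p u) := by rw [← hH' u]; abel
    rw [h1]
    simp only [N, sub_apply, add_apply, smul_apply, mul_apply_eq_comp]
    module
  set M := blockMultiplier 0 fun k => q k * (m k + 1)⁻¹ with hM
  set Q := blockMultiplier 0 (Sᶜ.indicator (1 : Space ν → ℝ)) with hQ
  set P₀ := InnerProductSpace.rankOne ℂ (vacuum ν) (vacuum ν) with hP₀
  -- the error is `K₁` and the part of `c p` off the energy shell: `1 = 1_S(D) + Q + P₀`
  refine ⟨p * K₁ * p - (c : ℂ) • (p * (Q * p)) - (c : ℂ) • (p * P₀ * p),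
    p * M * N + p * K₁ * p, ?_, ⟨hp, fun u w => ?_⟩, ?_⟩
  · refine IsCompactOperator.sub (IsCompactOperator.sub ((hK₁.clm_comp p).comp_clm p) ?_) ?_
    · exact (hQE.clm_comp p).smul (c : ℂ)
    · exact (((isCompactOperator_rankOne _ _).clm_comp p).comp_clm p).smul (c : ℂ)
  · rw [← hN, hps, hps, ← inner_add_right]
    rfl
  · rw [ContinuousLinearMap.le_def, ContinuousLinearMap.isPositive_iff_complex]
    -- the difference of the two sides is `p (M (H₀ + 1) - c 1_S(D)) p`
    have hdiff : p * M * N + p * K₁ * p - ((c : ℂ) • p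
        + (p * K₁ * p - (c : ℂ) • (p * (Q * p)) - (c : ℂ) • (p * P₀ * p)))
        = p * (M * N - (c : ℂ) • (blockMultiplier 0 (S.indicator 1) * p)) := by
      have h1 : (1 : FiberSpace ν →L[ℂ] FiberSpace ν)
          = blockMultiplier 0 (S.indicator 1) + Q + P₀ := by
        rw [hP₀, rankOne_vacuum_vacuum, hQ, blockMultiplier_add hS1 hS2,
          blockMultiplier_add (hS1.add hS2) (BoundedMeasurable.const 0), ← blockMultiplier_one]
        congr 1
        · norm_num
        · ext k
          by_cases hk : k ∈ S <;> simp [hk]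
      have h2 : (c : ℂ) • p = (c : ℂ) • (p * (blockMultiplier 0 (S.indicator 1) + Q + P₀) * p) := by
        rw [← h1, mul_one, hstar.isIdempotentElem]
      rw [h2]
      simp only [mul_add, add_mul, mul_sub, smul_add, mul_smul_comm, mul_assoc]
      abel
    rw [hdiff]
    -- writing `p = (H₀ + 1)⁻¹ N`, this is `N* (m + 1)⁻² (q - c 1_S)(D) N`
    intro u
    have hgap : BoundedMeasurable fun k =>
        q k * (m k + 1)⁻¹ - c * (S.indicator 1 k * (m k + 1)⁻¹) :=
      hqb.sub ((BoundedMeasurable.const c).mul (hS1.mul hinv))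
    have hpR : p u = blockMultiplier (e + 1)⁻¹ (fun k => (m k + 1)⁻¹) (N u) := by
      have := (isShiftedInverse_diagonal he hm hm0 one_pos).inv_apply ⟨p u, hp u⟩
      rw [Complex.ofReal_one, one_smul] at this
      rw [hN]
      exact this.symm
    have h3 : (M * N - (c : ℂ) • (blockMultiplier 0 (S.indicator 1) * p)) u
        = blockMultiplier 0 (fun k => q k * (m k + 1)⁻¹ - c * (S.indicator 1 k * (m k + 1)⁻¹))
          (N u) := by
      have h4 : M = blockMultiplier 0
          (fun k => q k * (m k + 1)⁻¹ - c * (S.indicator 1 k * (m k + 1)⁻¹))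
          + (c : ℂ) • (blockMultiplier 0 (S.indicator 1)
            * blockMultiplier (e + 1)⁻¹ fun k => (m k + 1)⁻¹) := by
        rw [blockMultiplier_mul hS1 hinv, blockMultiplier_smul (hS1.mul hinv),
          blockMultiplier_add hgap ((BoundedMeasurable.const c).mul (hS1.mul hinv)), hM]
        simp
      rw [h4]
      simp only [sub_apply, add_apply, smul_apply, mul_apply_eq_comp, hpR]
      abel
    have hpos : ∀ k, 0 ≤ (m k + 1)⁻¹
        * (q k * (m k + 1)⁻¹ - c * (S.indicator 1 k * (m k + 1)⁻¹)) := by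
      intro k
      have h1 : 0 ≤ (m k + 1)⁻¹ := inv_nonneg.2 (by linarith [hm0 k])
      refine mul_nonneg h1 ?_
      rw [← mul_assoc, ← sub_mul]
      refine mul_nonneg ?_ h1
      by_cases hk : k ∈ S
      · simpa [hk] using hc k hk
      · simpa [hk] using hq0 k
    obtain ⟨b, hb, h5⟩ := inner_blockMultiplier_nonneg (a := (e + 1)⁻¹ * 0)
      (hinv.mul hgap) (by simp) hpos (N u)
    have h6 : ⟪(p * (M * N - (c : ℂ) • (blockMultiplier 0 (S.indicator 1) * p))) u, u⟫_ℂ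
        = (b : ℂ) := by
      rw [← inner_conj_symm, mul_apply_eq_comp, ← hps, h3, hpR, inner_blockMultiplier hinv,
        ← mul_apply_eq_comp, blockMultiplier_mul hinv hgap, h5, Complex.conj_ofReal]
    rw [h6]
    exact ⟨by simp, by simpa using hb⟩

end Estimate

/-! ### The conjugate operator in Fourier space -/

section TemperateGrowth

theorem hasTemperateGrowth_fderiv {E F : Type*} [NormedAddCommGroup E] [NormedSpace ℝ E]
    [NormedAddCommGroup F] [NormedSpace ℝ F] {f : E → F} (hf : ContDiff ℝ ((⊤ : ℕ∞) : WithTop ℕ∞) f)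
    (hb : ∀ n : ℕ, 1 ≤ n → ∃ (k : ℕ) (C : ℝ), ∀ x, ‖iteratedFDeriv ℝ n f x‖ ≤ C * (1 + ‖x‖) ^ k) :
    (fderiv ℝ f).HasTemperateGrowth := by
  refine ⟨hf.fderiv_right (by simp), fun n => ?_⟩
  obtain ⟨k, C, h⟩ := hb (n + 1) (by omega)
  exact ⟨k, C, fun x => by rw [norm_iteratedFDeriv_fderiv]; exact h x⟩

theorem hasTemperateGrowth_fderiv_apply {E F : Type*} [NormedAddCommGroup E] [NormedSpace ℝ E]
    [NormedAddCommGroup F] [NormedSpace ℝ F] {f : E → F} (hf : (fderiv ℝ f).HasTemperateGrowth)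
    (y : E) : (fun x => fderiv ℝ f x y).HasTemperateGrowth :=
  (ContinuousLinearMap.apply ℝ F y).hasTemperateGrowth.comp hf

end TemperateGrowth

section Transport

open scoped LineDeriv

variable {ν : ℕ}

/-- The standard basis vectors of `ℝ^ν`. -/
abbrev basisVector (j : Fin ν) : Space ν := EuclideanSpace.single j 1

/-- The operator `(i / 2π) (w · ∇ + ½ div w)`, the conjugate operator on the Fourier side. -/
def transport (w : Fin ν → Space ν → ℝ) (g : Space ν → ℂ) (ξ : Space ν) : ℂ :=
  (Complex.I / (2 * Real.pi)) * ∑ j, ((w j ξ : ℂ) * fderiv ℝ g ξ (basisVector j)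
    + (1 / 2 : ℂ) * (fderiv ℝ (w j) ξ (basisVector j) : ℂ) * g ξ)

variable {w : Fin ν → Space ν → ℝ} (hw : ∀ j, (w j).HasTemperateGrowth)
include hw

theorem hasTemperateGrowth_partial (j : Fin ν) :
    (fun ξ => fderiv ℝ (w j) ξ (basisVector j)).HasTemperateGrowth := by
  refine hasTemperateGrowth_fderiv_apply (hasTemperateGrowth_fderiv ?_ fun n _ => (hw j).2 n) _
  exact (hw j).1

omit hw in
theorem fourierEquivL2_schwartzToL2 (φ : 𝓢(Space ν, ℂ)) :
    (fourierEquivL2 ν (schwartzToL2 φ) : Space ν → ℂ) =ᵐ[volume] (𝓕 φ : 𝓢(Space ν, ℂ)) := by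
  have h : fourierEquivL2 ν (schwartzToL2 φ) = (𝓕 φ).toLp 2 := SchwartzMap.toLp_fourier_eq φ
  rw [h]
  exact SchwartzMap.coeFn_toLp _ _ _

omit hw in
/-- Products of functions of temperate growth with Schwartz functions are square integrable. -/
theorem memLp_mul_schwartz {g : Space ν → ℝ} (hg : g.HasTemperateGrowth) (h : 𝓢(Space ν, ℂ)) :
    MemLp (fun ξ => (g ξ : ℂ) * h ξ) 2 volume := by
  have h1 := (SchwartzMap.smulLeftCLM ℂ g h).memLp 2 volume
  refine (memLp_congr_ae (Eventually.of_forall fun ξ => ?_)).1 h1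
  rw [SchwartzMap.smulLeftCLM_apply_apply hg]
  simp

theorem memLp_mul_fderiv_schwartz (j : Fin ν) (h : 𝓢(Space ν, ℂ)) :
    MemLp (fun ξ => (w j ξ : ℂ) * fderiv ℝ h ξ (basisVector j)) 2 volume :=
  memLp_mul_schwartz (hw j) (∂_{basisVector j} h)

theorem memLp_transport_schwartz (h : 𝓢(Space ν, ℂ)) : MemLp (transport w h) 2 volume := by
  have h1 : ∀ j, MemLp (fun ξ => (w j ξ : ℂ) * fderiv ℝ h ξ (basisVector j)
      + (1 / 2 : ℂ) * (fderiv ℝ (w j) ξ (basisVector j) : ℂ) * h ξ) 2 volume := by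
    intro j
    simp only [mul_assoc]
    exact (memLp_mul_fderiv_schwartz hw j h).add
      ((memLp_mul_schwartz (hasTemperateGrowth_partial hw j) h).const_mul _)
  exact (memLp_finsetSum Finset.univ fun j _ => h1 j).const_mul (Complex.I / (2 * Real.pi))

/-- Integration by parts: `i (w · ∇ + ½ div w)` is symmetric. -/
theorem integral_conj_mul_transport {g : Space ν → ℂ} (hg : Differentiable ℝ g)
    (hg2 : MemLp g 2 volume) (hdg : ∀ j, MemLp (fun ξ => fderiv ℝ g ξ (basisVector j)) 2 volume)
    (h : 𝓢(Space ν, ℂ)) :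
    ∫ ξ, (starRingEnd ℂ) (g ξ) * transport w h ξ
      = ∫ ξ, (starRingEnd ℂ) (transport w g ξ) * h ξ := by
  have hmul : ∀ {f₁ f₂ : Space ν → ℂ}, MemLp f₁ 2 volume → MemLp f₂ 2 volume →
      Integrable (fun ξ => (starRingEnd ℂ) (f₁ ξ) * f₂ ξ) := fun h1 h2 => h1.star.integrable_mul h2
  have hconj : ∀ ξ y, fderiv ℝ (fun ξ => (starRingEnd ℂ) (g ξ)) ξ y
      = (starRingEnd ℂ) (fderiv ℝ g ξ y) := by
    intro ξ y
    have h1 := (Complex.conjCLE.toContinuousLinearMap.hasFDerivAt.comp ξ (hg ξ).hasFDerivAt).fderiv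
    have h2 : (fun ξ => (starRingEnd ℂ) (g ξ))
        = (Complex.conjCLE.toContinuousLinearMap : ℂ → ℂ) ∘ g := rfl
    rw [h2, h1]
    rfl
  have hdw : ∀ j, Differentiable ℝ (w j) := fun j => (hw j).1.differentiable (by simp)
  have hdw' : ∀ j, Differentiable ℝ fun ξ => (w j ξ : ℂ) := fun j =>
    Complex.ofRealCLM.differentiable.comp (hdw j)
  have hgc : Differentiable ℝ fun ξ => (starRingEnd ℂ) (g ξ) :=
    Complex.conjCLE.toContinuousLinearMap.differentiable.comp hg
  have hprod : ∀ j ξ, fderiv ℝ (fun ξ => (starRingEnd ℂ) (g ξ) * (w j ξ : ℂ)) ξ (basisVector j)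
      = (starRingEnd ℂ) (g ξ) * (fderiv ℝ (w j) ξ (basisVector j) : ℂ)
        + (starRingEnd ℂ) (fderiv ℝ g ξ (basisVector j)) * (w j ξ : ℂ) := by
    intro j ξ
    have h1 := (((hgc ξ).hasFDerivAt).mul ((hdw' j ξ).hasFDerivAt)).fderiv
    have h2 : fderiv ℝ (fun ξ => (w j ξ : ℂ)) ξ (basisVector j)
        = (fderiv ℝ (w j) ξ (basisVector j) : ℂ) := by
      have := (Complex.ofRealCLM.hasFDerivAt.comp ξ (hdw j ξ).hasFDerivAt).fderiv
      have h3 : (fun ξ => (w j ξ : ℂ)) = (Complex.ofRealCLM : ℝ → ℂ) ∘ w j := rfl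
      rw [h3, this]
      rfl
    change fderiv ℝ ((fun ξ => (starRingEnd ℂ) (g ξ)) * fun ξ => (w j ξ : ℂ)) ξ _ = _
    rw [h1, add_apply, smul_apply, smul_apply, h2, hconj, smul_eq_mul, smul_eq_mul]
    ring
  -- integrability of the three kinds of terms
  have I1 : ∀ j, Integrable fun ξ =>
      (starRingEnd ℂ) (g ξ) * ((w j ξ : ℂ) * fderiv ℝ h ξ (basisVector j)) := fun j =>
    hmul hg2 (memLp_mul_fderiv_schwartz hw j h)
  have I2 : ∀ j, Integrable fun ξ =>
      (starRingEnd ℂ) (g ξ) * ((fderiv ℝ (w j) ξ (basisVector j) : ℂ) * h ξ) := fun j =>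
    hmul hg2 (memLp_mul_schwartz (hasTemperateGrowth_partial hw j) h)
  have I3 : ∀ j, Integrable fun ξ =>
      (starRingEnd ℂ) (fderiv ℝ g ξ (basisVector j)) * ((w j ξ : ℂ) * h ξ) := fun j =>
    hmul (hdg j) (memLp_mul_schwartz (hw j) h)
  have I4 : ∀ j, Integrable fun ξ => (starRingEnd ℂ) (g ξ) * ((w j ξ : ℂ) * h ξ) := fun j =>
    hmul hg2 (memLp_mul_schwartz (hw j) h)
  have key : ∀ j, ∫ ξ, (starRingEnd ℂ) (g ξ) * ((w j ξ : ℂ) * fderiv ℝ h ξ (basisVector j))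
      = -((∫ ξ, (starRingEnd ℂ) (g ξ) * ((fderiv ℝ (w j) ξ (basisVector j) : ℂ) * h ξ))
        + ∫ ξ, (starRingEnd ℂ) (fderiv ℝ g ξ (basisVector j)) * ((w j ξ : ℂ) * h ξ)) := by
    intro j
    have e1 : ∀ ξ, fderiv ℝ (fun ξ => (starRingEnd ℂ) (g ξ) * (w j ξ : ℂ)) ξ (basisVector j) * h ξ
        = (starRingEnd ℂ) (g ξ) * ((fderiv ℝ (w j) ξ (basisVector j) : ℂ) * h ξ)
        + (starRingEnd ℂ) (fderiv ℝ g ξ (basisVector j)) * ((w j ξ : ℂ) * h ξ) := by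
      intro ξ
      rw [hprod]
      ring
    have h1 := integral_mul_fderiv_eq_neg_fderiv_mul_of_integrable (μ := volume)
      (f := fun ξ => (starRingEnd ℂ) (g ξ) * (w j ξ : ℂ)) (g := h) (v := basisVector j)
      (by simp only [e1]; exact (I2 j).add (I3 j)) (by simp only [mul_assoc]; exact I1 j)
      (by simp only [mul_assoc]; exact I4 j) (fun ξ _ => (hgc ξ).mul (hdw' j ξ))
      (fun ξ _ => h.differentiableAt)
    simp only [e1, mul_assoc] at h1
    rw [h1, integral_add (I2 j) (I3 j)]
  have L : ∫ ξ, (starRingEnd ℂ) (g ξ) * transport w h ξ = (Complex.I / (2 * Real.pi)) * ∑ j,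
      ((∫ ξ, (starRingEnd ℂ) (g ξ) * ((w j ξ : ℂ) * fderiv ℝ h ξ (basisVector j)))
        + (1 / 2 : ℂ) * ∫ ξ, (starRingEnd ℂ) (g ξ)
          * ((fderiv ℝ (w j) ξ (basisVector j) : ℂ) * h ξ)) := by
    have e2 : ∀ ξ, (starRingEnd ℂ) (g ξ) * transport w h ξ = (Complex.I / (2 * Real.pi)) * ∑ j,
        ((starRingEnd ℂ) (g ξ) * ((w j ξ : ℂ) * fderiv ℝ h ξ (basisVector j))
          + (1 / 2 : ℂ) * ((starRingEnd ℂ) (g ξ)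
            * ((fderiv ℝ (w j) ξ (basisVector j) : ℂ) * h ξ))) := by
      intro ξ
      rw [transport, mul_left_comm, Finset.mul_sum]
      congr 1
      refine Finset.sum_congr rfl fun j _ => ?_
      ring
    simp only [e2]
    have I5 := fun j => (I1 j).add ((I2 j).const_mul (1 / 2 : ℂ))
    simp only [Pi.add_def] at I5
    rw [integral_const_mul, integral_finsetSum _ fun j _ => I5 j]
    congr 1
    refine Finset.sum_congr rfl fun j _ => ?_
    rw [integral_add (I1 j) ((I2 j).const_mul _), integral_const_mul]
  have Rr : ∫ ξ, (starRingEnd ℂ) (transport w g ξ) * h ξ = (-(Complex.I / (2 * Real.pi))) * ∑ j,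
      ((∫ ξ, (starRingEnd ℂ) (fderiv ℝ g ξ (basisVector j)) * ((w j ξ : ℂ) * h ξ))
        + (1 / 2 : ℂ) * ∫ ξ, (starRingEnd ℂ) (g ξ)
          * ((fderiv ℝ (w j) ξ (basisVector j) : ℂ) * h ξ)) := by
    have e2 : ∀ ξ, (starRingEnd ℂ) (transport w g ξ) * h ξ = (-(Complex.I / (2 * Real.pi))) * ∑ j,
        ((starRingEnd ℂ) (fderiv ℝ g ξ (basisVector j)) * ((w j ξ : ℂ) * h ξ)
          + (1 / 2 : ℂ) * ((starRingEnd ℂ) (g ξ)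
            * ((fderiv ℝ (w j) ξ (basisVector j) : ℂ) * h ξ))) := by
      intro ξ
      have h1 : (starRingEnd ℂ) (Complex.I / (2 * Real.pi)) = -(Complex.I / (2 * Real.pi)) := by
        rw [map_div₀, map_mul, Complex.conj_I, Complex.conj_ofReal, map_ofNat, neg_div]
      rw [transport, map_mul, h1, mul_assoc, map_sum, Finset.sum_mul]
      congr 1
      refine Finset.sum_congr rfl fun j _ => ?_
      simp only [map_add, map_mul, Complex.conj_ofReal, map_div₀, map_one, map_ofNat]
      ring
    simp only [e2]
    have I5 := fun j => (I3 j).add ((I2 j).const_mul (1 / 2 : ℂ))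
    simp only [Pi.add_def] at I5
    rw [integral_const_mul, integral_finsetSum _ fun j _ => I5 j]
    congr 1
    refine Finset.sum_congr rfl fun j _ => ?_
    rw [integral_add (I3 j) ((I2 j).const_mul _), integral_const_mul]
  rw [L, Rr, neg_mul, ← mul_neg, ← Finset.sum_neg_distrib]
  congr 1
  refine Finset.sum_congr rfl fun j _ => ?_
  rw [key]
  ring

omit hw in
theorem fourier_schwartzPosition (j : Fin ν) (φ : 𝓢(Space ν, ℂ)) (ξ : Space ν) :
    (𝓕 (schwartzPosition j φ) : 𝓢(Space ν, ℂ)) ξ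
      = (Complex.I / (2 * Real.pi)) * fderiv ℝ (𝓕 φ : 𝓢(Space ν, ℂ)) ξ (basisVector j) := by
  have h1 := congrArg (fun f : 𝓢(Space ν, ℂ) => f ξ)
    (SchwartzMap.lineDerivOp_fourier_eq φ (basisVector j))
  have h2 : schwartzPosition j φ
      = SchwartzMap.smulLeftCLM ℂ (fun x : Space ν => inner ℝ x (basisVector j)) φ := by
    have h3 : (fun x : Space ν => inner ℝ x (basisVector j)) = fun x => x j := by
      ext x
      simp [EuclideanSpace.inner_single_right]
    have h4 : (fun x : Space ν => x j).HasTemperateGrowth := by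
      rw [← h3]
      fun_prop
    rw [h3]
    exact SchwartzMap.smulLeftCLM_ofReal ℂ h4 φ
  rw [← h2] at h1
  rw [SchwartzMap.lineDerivOp_apply_eq_fderiv, FourierTransform.fourier_smul,
    smul_apply, smul_eq_mul] at h1
  rw [h1]
  have : (Real.pi : ℂ) ≠ 0 := by exact_mod_cast Real.pi_ne_zero
  field_simp
  rw [Complex.I_sq]
  ring

/-- In Fourier space the conjugate operator acts as `transport w`, `w(ξ) = v(2πξ)`: the position `x`
is `(i / 2π) ∇` there, and `½ div w` is half of its commutator with multiplication by `w`. -/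
theorem fourier_schwartzConjugate {v : Space ν → Space ν}
    (hv : ∀ j ξ, v ((2 * Real.pi) • ξ) j = w j ξ) (φ : 𝓢(Space ν, ℂ)) (ξ : Space ν) :
    (𝓕 (schwartzConjugate v φ) : 𝓢(Space ν, ℂ)) ξ = transport w (𝓕 φ : 𝓢(Space ν, ℂ)) ξ := by
  have hM : ∀ j (ψ : 𝓢(Space ν, ℂ)), 𝓕 (schwartzMultiplier v j ψ)
      = SchwartzMap.smulLeftCLM ℂ (w j) (𝓕 ψ) := by
    intro j ψ
    rw [schwartzMultiplier, SchwartzMap.fourierMultiplierCLM_apply]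
    simp only [hv]
    rw [FourierTransform.fourier_fourierInv_eq]
    exact SchwartzMap.smulLeftCLM_ofReal ℂ (hw j) _
  have hM' : ∀ j (ψ : 𝓢(Space ν, ℂ)) ξ, (𝓕 (schwartzMultiplier v j ψ) : 𝓢(Space ν, ℂ)) ξ
      = (w j ξ : ℂ) * (𝓕 ψ : 𝓢(Space ν, ℂ)) ξ := by
    intro j ψ ξ
    rw [hM, SchwartzMap.smulLeftCLM_apply_apply (hw j)]
    simp
  have hdw : ∀ j, Differentiable ℝ (w j) := fun j => (hw j).1.differentiable (by simp)
  have hd : ∀ j, fderiv ℝ (𝓕 (schwartzMultiplier v j φ) : 𝓢(Space ν, ℂ)) ξ (basisVector j)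
      = (fderiv ℝ (w j) ξ (basisVector j) : ℂ) * (𝓕 φ : 𝓢(Space ν, ℂ)) ξ
        + (w j ξ : ℂ) * fderiv ℝ (𝓕 φ : 𝓢(Space ν, ℂ)) ξ (basisVector j) := by
    intro j
    have h1 : ((𝓕 (schwartzMultiplier v j φ) : 𝓢(Space ν, ℂ)) : Space ν → ℂ)
        = fun ξ => w j ξ • (𝓕 φ : 𝓢(Space ν, ℂ)) ξ := by
      ext ξ
      rw [hM']
      simp
    have h2 := ((hdw j ξ).hasFDerivAt.smul
      (𝓕 φ : 𝓢(Space ν, ℂ)).differentiableAt.hasFDerivAt).fderiv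
    rw [h1]
    change fderiv ℝ (w j • ⇑(𝓕 φ : 𝓢(Space ν, ℂ))) ξ _ = _
    rw [h2]
    simp
    ring
  have hsum : (𝓕 (schwartzConjugate v φ) : 𝓢(Space ν, ℂ)) ξ = (1 / 2 : ℂ) * ∑ j,
      ((𝓕 (schwartzMultiplier v j (schwartzPosition j φ)) : 𝓢(Space ν, ℂ)) ξ
        + (𝓕 (schwartzPosition j (schwartzMultiplier v j φ)) : 𝓢(Space ν, ℂ)) ξ) := by
    have h1 : 𝓕 (schwartzConjugate v φ) = (1 / 2 : ℂ) • ∑ j,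
        (𝓕 (schwartzMultiplier v j (schwartzPosition j φ))
          + 𝓕 (schwartzPosition j (schwartzMultiplier v j φ))) := by
      have h2 : schwartzConjugate v φ = (1 / 2 : ℂ) • ∑ j,
          (schwartzMultiplier v j (schwartzPosition j φ)
            + schwartzPosition j (schwartzMultiplier v j φ)) := by
        simp [schwartzConjugate]
      change FourierTransform.fourierCLM ℂ 𝓢(Space ν, ℂ) (schwartzConjugate v φ) = _
      rw [h2, map_smul, map_sum]
      simp only [map_add]
      rfl
    rw [h1, smul_apply, sum_apply, smul_eq_mul]
    simp
  rw [hsum, transport, Finset.mul_sum, Finset.mul_sum]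
  refine Finset.sum_congr rfl fun j _ => ?_
  rw [hM', fourier_schwartzPosition, fourier_schwartzPosition, hd]
  ring

end Transport

/-! ### Commutators with Fourier multipliers -/

section Closure

open scoped LineDeriv

variable {ν : ℕ}

theorem schwartzToL2_mem_domain (v : Space ν → Space ν) (φ : 𝓢(Space ν, ℂ)) :
    schwartzToL2 φ ∈ (oneBodyConjugate v).domain :=
  (LinearPMap.le_closure (oneBodyConjugateCore v)).1 ⟨φ, rfl⟩

/-- Every vector in the domain of the closure is a limit of Schwartz functions in the graph norm.
Closability of the core is not needed here, as the closure of a non-closable operator is by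
convention the operator itself. -/
theorem exists_seq_oneBodyConjugate (v : Space ν → Space ν) (u : (oneBodyConjugate v).domain) :
    ∃ φ : ℕ → 𝓢(Space ν, ℂ), Tendsto (fun n => schwartzToL2 (φ n)) atTop (𝓝 (u : L2 ν)) ∧
      Tendsto (fun n => schwartzToL2 (schwartzConjugate v (φ n))) atTop
        (𝓝 (oneBodyConjugate v u)) := by
  have h1 : ((u : L2 ν), oneBodyConjugate v u)
      ∈ _root_.closure ((oneBodyConjugateCore v).graph : Set (L2 ν × L2 ν)) := by
    have h2 : ((u : L2 ν), oneBodyConjugate v u) ∈ (oneBodyConjugateCore v).closure.graph :=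
      LinearPMap.mem_graph _ u
    by_cases hc : (oneBodyConjugateCore v).IsClosable
    · rw [← hc.graph_closure_eq_closure_graph] at h2
      exact h2
    · rw [LinearPMap.closure_def' hc] at h2
      exact subset_closure h2
  obtain ⟨x, hx, hlim⟩ := mem_closure_iff_seq_limit.1 h1
  have h3 : ∀ n, ∃ φ : 𝓢(Space ν, ℂ),
      x n = (schwartzToL2 φ, schwartzToL2 (schwartzConjugate v φ)) := by
    intro n
    obtain ⟨y, hy1, hy2⟩ := (LinearPMap.mem_graph_iff _).1 (hx n)
    obtain ⟨φ, hφ⟩ := y.2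
    refine ⟨φ, Prod.ext (hy1.symm.trans hφ.symm) (hy2.symm.trans ?_)⟩
    have h4 : (LinearEquiv.ofInjective (schwartzToL2 (ν := ν)) schwartzToL2_injective).symm y
        = φ :=
      (LinearEquiv.symm_apply_eq _).2 (Subtype.ext hφ.symm)
    change schwartzToL2 (schwartzConjugate v
      ((LinearEquiv.ofInjective (schwartzToL2 (ν := ν)) schwartzToL2_injective).symm y)) = _
    rw [h4]
  choose φ hφ using h3
  simp only [funext hφ] at hlim
  exact ⟨φ, (continuous_fst.tendsto _).comp hlim, (continuous_snd.tendsto _).comp hlim⟩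

theorem inner_oneBodyConjugate {v : Space ν → Space ν} {ρ τ : L2 ν}
    (h : ∀ φ, ⟪ρ, schwartzToL2 (schwartzConjugate v φ)⟫_ℂ = ⟪τ, schwartzToL2 φ⟫_ℂ)
    (u : (oneBodyConjugate v).domain) : ⟪ρ, oneBodyConjugate v u⟫_ℂ = ⟪τ, (u : L2 ν)⟫_ℂ := by
  obtain ⟨φ, h1, h2⟩ := exists_seq_oneBodyConjugate v u
  exact tendsto_nhds_unique (Tendsto.inner tendsto_const_nhds h2)
    ((Tendsto.inner tendsto_const_nhds h1).congr fun n => (h (φ n)).symm)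

variable {v : Space ν → Space ν} {w : Fin ν → Space ν → ℝ}
  (hw : ∀ j, (w j).HasTemperateGrowth) (hv : ∀ j ξ, v ((2 * Real.pi) • ξ) j = w j ξ)
include hw hv

theorem fourierEquivL2_schwartzConjugate (φ : 𝓢(Space ν, ℂ)) :
    (fourierEquivL2 ν (schwartzToL2 (schwartzConjugate v φ)) : Space ν → ℂ) =ᵐ[volume]
      transport w (𝓕 φ : 𝓢(Space ν, ℂ)) := by
  filter_upwards [fourierEquivL2_schwartzToL2 (schwartzConjugate v φ)] with ξ h
  rw [h, fourier_schwartzConjugate hw hv]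

/-- A vector whose Fourier transform `g` is `C¹`, with `⟨·⟩ |∇g|` square integrable, is in the
domain of the adjoint of the conjugate operator. -/
theorem exists_adjoint_schwartzConjugate {C : ℝ} (hC : ∀ j ξ, |w j ξ| ≤ C * japaneseBracket ξ)
    (hC' : ∀ j ξ, |fderiv ℝ (w j) ξ (basisVector j)| ≤ C) {ρ : L2 ν} {g : Space ν → ℂ}
    (hρ : (fourierEquivL2 ν ρ : Space ν → ℂ) =ᵐ[volume] g) (hg : ContDiff ℝ 1 g)
    (hdg : MemLp (fun ξ => japaneseBracket ξ * ‖fderiv ℝ g ξ‖) 2 volume) :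
    ∃ τ : L2 ν, ∀ φ, ⟪ρ, schwartzToL2 (schwartzConjugate v φ)⟫_ℂ = ⟪τ, schwartzToL2 φ⟫_ℂ := by
  have hg2 : MemLp g 2 volume := (memLp_congr_ae hρ).1 (Lp.memLp _)
  have hJ : ∀ ξ : Space ν, 1 ≤ japaneseBracket ξ := fun ξ =>
    Real.one_le_sqrt.2 (by nlinarith [sq_nonneg ‖ξ‖])
  have hJ0 : ∀ ξ : Space ν, 0 ≤ japaneseBracket ξ := fun ξ => zero_le_one.trans (hJ ξ)
  have hcont : ∀ j, Continuous fun ξ => fderiv ℝ g ξ (basisVector j) := fun j =>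
    (hg.continuous_fderiv (by simp)).clm_apply continuous_const
  have hle : ∀ j ξ, ‖fderiv ℝ g ξ (basisVector j)‖ ≤ ‖fderiv ℝ g ξ‖ := by
    intro j ξ
    refine (ContinuousLinearMap.le_opNorm _ _).trans ?_
    simp
  have hd1 : ∀ j, MemLp (fun ξ => fderiv ℝ g ξ (basisVector j)) 2 volume := by
    intro j
    refine hdg.of_le_mul (c := 1) (hcont j).aestronglyMeasurable (Eventually.of_forall fun ξ => ?_)
    rw [one_mul, Real.norm_of_nonneg (mul_nonneg (hJ0 ξ) (norm_nonneg _))]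
    exact (hle j ξ).trans (le_mul_of_one_le_left (norm_nonneg _) (hJ ξ))
  have hwc : ∀ j, Continuous (w j) := fun j => (hw j).1.continuous
  have hd2 : ∀ j, MemLp (fun ξ => (w j ξ : ℂ) * fderiv ℝ g ξ (basisVector j)) 2 volume := by
    intro j
    refine hdg.of_le_mul (c := C) ((Complex.continuous_ofReal.comp (hwc j)).mul
      (hcont j)).aestronglyMeasurable (Eventually.of_forall fun ξ => ?_)
    rw [norm_mul, Complex.norm_real, Real.norm_of_nonneg (mul_nonneg (hJ0 ξ) (norm_nonneg _)),
      ← mul_assoc]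
    exact mul_le_mul (hC j ξ) (hle j ξ) (norm_nonneg _) ((abs_nonneg _).trans (hC j ξ))
  have hd3 : ∀ j, MemLp (fun ξ => (1 / 2 : ℂ) * (fderiv ℝ (w j) ξ (basisVector j) : ℂ) * g ξ)
      2 volume := by
    intro j
    simp only [mul_assoc]
    refine MemLp.const_mul (hg2.of_le_mul (c := C) ((Complex.continuous_ofReal.comp
      (hasTemperateGrowth_partial hw j).1.continuous).mul hg.continuous).aestronglyMeasurable
      (Eventually.of_forall fun ξ => ?_)) _
    change ‖(fderiv ℝ (w j) ξ (basisVector j) : ℂ) * g ξ‖ ≤ _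
    rw [norm_mul]
    exact mul_le_mul_of_nonneg_right (by simpa using hC' j ξ) (norm_nonneg _)
  have hT : MemLp (transport w g) 2 volume :=
    (memLp_finsetSum Finset.univ fun j _ => (hd2 j).add (hd3 j)).const_mul
      (Complex.I / (2 * Real.pi))
  refine ⟨(fourierEquivL2 ν).symm (hT.toLp _), fun φ => ?_⟩
  rw [inner_eq_integral_fourier, inner_eq_integral_fourier, LinearEquiv.apply_symm_apply]
  have h1 := integral_conj_mul_transport hw (hg.differentiable (by simp)) hg2 hd1 (𝓕 φ)
  refine Eq.trans (integral_congr_ae ?_) (h1.trans (integral_congr_ae ?_))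
  · filter_upwards [hρ, fourierEquivL2_schwartzConjugate hw hv φ] with ξ h2 h3
    rw [h2, h3]
  · filter_upwards [hT.coeFn_toLp, fourierEquivL2_schwartzToL2 φ] with ξ h2 h3
    rw [h2, h3]

/-- The commutator of `f(D)` with `i a` is `(v · ∇f)(D)`, for bounded `f` with bounded gradient. On
Schwartz functions this is the symmetry of `transport w`, applied to the product of `f(2πξ)` and a
Schwartz function. -/
theorem commutator_boundedMultiplier {f q : Space ν → ℝ} (hf : BoundedMeasurable f)
    (hq : BoundedMeasurable q) (hd : ContDiff ℝ 1 fun ξ : Space ν => f ((2 * Real.pi) • ξ)) {C : ℝ}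
    (hC : ∀ j ξ, |fderiv ℝ (fun ξ : Space ν => f ((2 * Real.pi) • ξ)) ξ (basisVector j)| ≤ C)
    (hfq : ∀ ξ, q ((2 * Real.pi) • ξ) = (2 * Real.pi)⁻¹ * ∑ j, w j ξ *
      fderiv ℝ (fun ξ : Space ν => f ((2 * Real.pi) • ξ)) ξ (basisVector j))
    (u y : (oneBodyConjugate v).domain) :
    Complex.I * ⟪boundedMultiplier f u, oneBodyConjugate v y⟫_ℂ
      - Complex.I * ⟪oneBodyConjugate v u, boundedMultiplier f y⟫_ℂ
      = ⟪(u : L2 ν), boundedMultiplier q y⟫_ℂ := by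
  set F : Space ν → ℝ := fun ξ => f ((2 * Real.pi) • ξ) with hF
  have hFb : BoundedMeasurable F := hf.comp_smul
  have key : ∀ φ ψ : 𝓢(Space ν, ℂ),
      Complex.I * ⟪boundedMultiplier f (schwartzToL2 φ), schwartzToL2 (schwartzConjugate v ψ)⟫_ℂ
      - Complex.I * ⟪schwartzToL2 (schwartzConjugate v φ), boundedMultiplier f (schwartzToL2 ψ)⟫_ℂ
      = ⟪schwartzToL2 φ, boundedMultiplier q (schwartzToL2 ψ)⟫_ℂ := by
    intro φ ψ
    set φ' : 𝓢(Space ν, ℂ) := 𝓕 φ with hφ'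
    set ψ' : 𝓢(Space ν, ℂ) := 𝓕 ψ with hψ'
    have hFd : Differentiable ℝ F := hd.differentiable (by simp)
    have hprod : ∀ ξ y, fderiv ℝ (fun ξ => (F ξ : ℂ) * φ' ξ) ξ y
        = (F ξ : ℂ) * fderiv ℝ φ' ξ y + (fderiv ℝ F ξ y : ℂ) * φ' ξ := by
      intro ξ y
      have h1 : (fun ξ => (F ξ : ℂ) * φ' ξ) = F • (φ' : Space ν → ℂ) := by
        ext ξ
        simp
      rw [h1, ((hFd ξ).hasFDerivAt.smul φ'.differentiableAt.hasFDerivAt).fderiv]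
      simp
    have hmem : ∀ {G : Space ν → ℝ} {D : ℝ} (_ : Continuous G) (_ : ∀ ξ, |G ξ| ≤ D)
        (h : 𝓢(Space ν, ℂ)), MemLp (fun ξ => (G ξ : ℂ) * h ξ) 2 volume := by
      intro G D hG hD h
      refine (h.memLp 2 volume).of_le_mul (c := D) ((Complex.continuous_ofReal.comp hG).mul
        h.continuous).aestronglyMeasurable (Eventually.of_forall fun ξ => ?_)
      rw [norm_mul, Complex.norm_real]
      exact mul_le_mul_of_nonneg_right (hD ξ) (norm_nonneg _)
    obtain ⟨D, hD⟩ := hFb.bounded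
    have hdF : ∀ j, Continuous fun ξ => fderiv ℝ F ξ (basisVector j) := fun j =>
      (hd.continuous_fderiv (by simp)).clm_apply continuous_const
    have h1 := integral_conj_mul_transport hw (g := fun ξ => (F ξ : ℂ) * φ' ξ)
      ((Complex.ofRealCLM.differentiable.comp hFd).mul φ'.differentiable)
      (hmem hFd.continuous hD φ')
      (fun j => by
        simp only [hprod]
        exact (hmem hFd.continuous hD (∂_{basisVector j} φ')).add (hmem (hdF j) (hC j) φ')) ψ'
    have h2 : ∀ ξ, transport w (fun ξ => (F ξ : ℂ) * φ' ξ) ξ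
        = F ξ * transport w φ' ξ + Complex.I * q ((2 * Real.pi) • ξ) * φ' ξ := by
      intro ξ
      simp only [transport, hprod, hfq]
      push_cast
      simp only [Finset.mul_sum, Finset.sum_mul, ← Finset.sum_add_distrib]
      refine Finset.sum_congr rfl fun j _ => ?_
      ring
    have e1 : ⟪boundedMultiplier f (schwartzToL2 φ), schwartzToL2 (schwartzConjugate v ψ)⟫_ℂ
        = ∫ ξ, (starRingEnd ℂ) ((F ξ : ℂ) * φ' ξ) * transport w ψ' ξ := by
      rw [inner_eq_integral_fourier]
      refine integral_congr_ae ?_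
      filter_upwards [fourierEquivL2_boundedMultiplier hf (schwartzToL2 φ),
        fourierEquivL2_schwartzToL2 φ, fourierEquivL2_schwartzConjugate hw hv ψ] with ξ a1 a2 a3
      rw [a1, a2, a3]
    have e2 : ⟪schwartzToL2 (schwartzConjugate v φ), boundedMultiplier f (schwartzToL2 ψ)⟫_ℂ
        = ∫ ξ, (starRingEnd ℂ) (transport w φ' ξ) * ((F ξ : ℂ) * ψ' ξ) := by
      rw [inner_eq_integral_fourier]
      refine integral_congr_ae ?_
      filter_upwards [fourierEquivL2_boundedMultiplier hf (schwartzToL2 ψ),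
        fourierEquivL2_schwartzToL2 ψ, fourierEquivL2_schwartzConjugate hw hv φ] with ξ a1 a2 a3
      rw [a1, a2, a3]
    have e3 : ⟪schwartzToL2 φ, boundedMultiplier q (schwartzToL2 ψ)⟫_ℂ
        = ∫ ξ, (starRingEnd ℂ) (φ' ξ) * ((q ((2 * Real.pi) • ξ) : ℂ) * ψ' ξ) := by
      rw [inner_eq_integral_fourier]
      refine integral_congr_ae ?_
      filter_upwards [fourierEquivL2_boundedMultiplier hq (schwartzToL2 ψ),
        fourierEquivL2_schwartzToL2 ψ, fourierEquivL2_schwartzToL2 φ] with ξ a1 a2 a3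
      rw [a1, a2, a3]
    have i2 : Integrable fun ξ => (starRingEnd ℂ) (transport w φ' ξ) * ((F ξ : ℂ) * ψ' ξ) :=
      (memLp_transport_schwartz hw φ').star.integrable_mul (hmem hFd.continuous hD ψ')
    have i3 : Integrable fun ξ =>
        (starRingEnd ℂ) (φ' ξ) * ((q ((2 * Real.pi) • ξ) : ℂ) * ψ' ξ) := by
      have h3 := hq.comp_smul.memLp_mul (schwartzToL2 ψ')
      have h4 : MemLp (fun ξ => (q ((2 * Real.pi) • ξ) : ℂ) * ψ' ξ) 2 volume := by
        refine (memLp_congr_ae ?_).1 h3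
        filter_upwards [SchwartzMap.coeFn_toLp ψ' 2 (volume : Measure (Space ν))] with ξ hξ
        rw [← hξ]
        rfl
      exact (φ'.memLp 2 volume).star.integrable_mul h4
    have h5 : ∀ ξ, (starRingEnd ℂ) (transport w (fun ξ => (F ξ : ℂ) * φ' ξ) ξ) * ψ' ξ
        = (starRingEnd ℂ) (transport w φ' ξ) * ((F ξ : ℂ) * ψ' ξ)
          + (-Complex.I) * ((starRingEnd ℂ) (φ' ξ) * ((q ((2 * Real.pi) • ξ) : ℂ) * ψ' ξ)) := by
      intro ξ
      rw [h2]
      simp only [map_add, map_mul, Complex.conj_ofReal, Complex.conj_I]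
      ring
    simp only [h5] at h1
    rw [integral_add i2 (i3.const_mul _), integral_const_mul, ← e1, ← e2, ← e3] at h1
    rw [h1]
    linear_combination (-⟪schwartzToL2 φ, boundedMultiplier q (schwartzToL2 ψ)⟫_ℂ) * Complex.I_sq
  obtain ⟨φ, hφ1, hφ2⟩ := exists_seq_oneBodyConjugate v u
  obtain ⟨ψ, hψ1, hψ2⟩ := exists_seq_oneBodyConjugate v y
  refine tendsto_nhds_unique (((((((boundedMultiplier f).continuous.tendsto _).comp hφ1).inner
    hψ2).const_mul Complex.I).sub ((hφ2.inner
      (((boundedMultiplier f).continuous.tendsto _).comp hψ1)).const_mul Complex.I)).congr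
        fun n => key (φ n) (ψ n)) ?_
  exact hφ1.inner (((boundedMultiplier q).continuous.tendsto _).comp hψ1)

end Closure

section FreeCommutator

variable {ν : ℕ}

/-- Bounded multipliers that converge pointwise to `1` converge weakly to the identity. -/
theorem tendsto_inner_boundedMultiplier {r : ℕ → Space ν → ℝ} (hr : ∀ n, BoundedMeasurable (r n))
    (h1 : ∀ n k, |r n k| ≤ 1) (hlim : ∀ k, Tendsto (fun n => r n k) atTop (𝓝 1)) (x y : L2 ν) :
    Tendsto (fun n => ⟪x, boundedMultiplier (r n) y⟫_ℂ) atTop (𝓝 ⟪x, y⟫_ℂ) := by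
  have h2 : ∀ n, ⟪x, boundedMultiplier (r n) y⟫_ℂ = ∫ ξ, (r n ((2 * Real.pi) • ξ) : ℂ) *
      ((starRingEnd ℂ) ((fourierEquivL2 ν x : Space ν → ℂ) ξ)
        * (fourierEquivL2 ν y : Space ν → ℂ) ξ) := by
    intro n
    rw [inner_eq_integral_fourier]
    refine integral_congr_ae ?_
    filter_upwards [fourierEquivL2_boundedMultiplier (hr n) y] with ξ h
    rw [h, mul_left_comm]
  have hi : Integrable fun ξ => (starRingEnd ℂ) ((fourierEquivL2 ν x : Space ν → ℂ) ξ)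
      * (fourierEquivL2 ν y : Space ν → ℂ) ξ :=
    (Lp.memLp (fourierEquivL2 ν x)).star.integrable_mul (Lp.memLp (fourierEquivL2 ν y))
  simp only [h2]
  rw [inner_eq_integral_fourier]
  refine tendsto_integral_of_dominated_convergence _ (fun n => ?_) hi.norm
    (fun n => Eventually.of_forall fun ξ => ?_) (Eventually.of_forall fun ξ => ?_)
  · exact (Complex.measurable_ofReal.comp (hr n).comp_smul.measurable).aestronglyMeasurable.mul hi.1
  · rw [norm_mul, Complex.norm_real]
    exact mul_le_of_le_one_left (norm_nonneg _) (h1 n _)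
  · have h3 := ((Complex.continuous_ofReal.tendsto _).comp
      (hlim ((2 * Real.pi) • ξ))).mul_const ((starRingEnd ℂ)
        ((fourierEquivL2 ν x : Space ν → ℂ) ξ) * (fourierEquivL2 ν y : Space ν → ℂ) ξ)
    simpa using h3

/-- The commutator of `m(D)` with `i a` is `|v|²(D)`, where `v = ∇m`: the identity is proved for
the bounded functions `m / (1 + ε m)` in place of `m`, and `ε` tends to `0`. -/
theorem commutator_multiplier {v : Space ν → Space ν} {w : Fin ν → Space ν → ℝ}
    (hw : ∀ j, (w j).HasTemperateGrowth) (hv : ∀ j ξ, v ((2 * Real.pi) • ξ) j = w j ξ)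
    {m q : Space ν → ℝ} {A : ℝ} (hm : ContDiff ℝ 1 m) (hm0 : ∀ k, 0 ≤ m k)
    (hmw : ∀ j ξ, fderiv ℝ m ((2 * Real.pi) • ξ) (basisVector j) = w j ξ)
    (hqm : Measurable q) (hq : ∀ ξ, q ((2 * Real.pi) • ξ) = ∑ j, w j ξ ^ 2)
    (hq0 : ∀ k, 0 ≤ q k) (hA : 0 ≤ A) (hqA : ∀ k, q k ≤ A * (m k + 1))
    (u y : (multiplier m).domain) (hu : (u : L2 ν) ∈ (oneBodyConjugate v).domain)
    (hy : (y : L2 ν) ∈ (oneBodyConjugate v).domain) :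
    Complex.I * ⟪multiplier m u, oneBodyConjugate v ⟨y, hy⟩⟫_ℂ
      - Complex.I * ⟪oneBodyConjugate v ⟨u, hu⟩, multiplier m y⟫_ℂ
      = ⟪(u : L2 ν), boundedMultiplier (fun k => q k * (m k + 1)⁻¹) (multiplier m y + y)⟫_ℂ := by
  let ε : ℕ → ℝ := fun n => ((n : ℝ) + 1)⁻¹
  have hε : ∀ n, 0 < ε n := fun n => by positivity
  let r : ℕ → Space ν → ℝ := fun n k => (1 + ε n * m k)⁻¹
  have hpos : ∀ n k, 1 ≤ 1 + ε n * m k := fun n k =>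
    le_add_of_nonneg_right (mul_nonneg (hε n).le (hm0 k))
  have hpos' : ∀ n k, 1 + ε n * m k ≠ 0 := fun n k => (zero_lt_one.trans_le (hpos n k)).ne'
  have hmm : Measurable m := hm.continuous.measurable
  have hr0 : ∀ n k, 0 ≤ r n k := fun n k => inv_nonneg.2 (zero_le_one.trans (hpos n k))
  have hr1 : ∀ n k, |r n k| ≤ 1 := fun n k => by
    rw [abs_of_nonneg (hr0 n k)]
    exact inv_le_one_of_one_le₀ (hpos n k)
  have hrm : ∀ n, Measurable (r n) := fun n => ((hmm.const_mul _).const_add _).inv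
  have hr : ∀ n, BoundedMeasurable (r n) := fun n => ⟨hrm n, 1, hr1 n⟩
  have hεlim : Tendsto ε atTop (𝓝 0) := by
    have := tendsto_one_div_add_atTop_nhds_zero_nat (𝕜 := ℝ)
    simpa [ε, one_div] using this
  have hrlim : ∀ k, Tendsto (fun n => r n k) atTop (𝓝 1) := by
    intro k
    have h1 := ((hεlim.mul_const (m k)).const_add 1).inv₀ (by simp)
    simpa using h1
  have hinv := boundedMeasurable_inv_add hmm hm0 one_pos
  have hqb : BoundedMeasurable fun k => q k * (m k + 1)⁻¹ := by
    refine ⟨hqm.mul hinv.measurable, A, fun k => ?_⟩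
    have h1 : 0 < m k + 1 := by linarith [hm0 k]
    rw [Real.norm_of_nonneg (mul_nonneg (hq0 k) (inv_nonneg.2 h1.le)), ← div_eq_mul_inv,
      div_le_iff₀ h1]
    exact hqA k
  -- `(1 + m) / (1 + ε m)` is bounded
  have hrmb : ∀ n k, r n k * (m k + 1) ≤ (ε n)⁻¹ := by
    intro n k
    have h1 : ε n ≤ 1 := inv_le_one_of_one_le₀ (by simp)
    rw [inv_mul_le_iff₀ (zero_lt_one.trans_le (hpos n k)), ← div_eq_mul_inv, le_div_iff₀ (hε n)]
    nlinarith [hm0 k]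
  have hf : ∀ n, BoundedMeasurable fun k => r n k * m k := by
    intro n
    refine ⟨(hrm n).mul hmm, (ε n)⁻¹, fun k => ?_⟩
    rw [Real.norm_of_nonneg (mul_nonneg (hr0 n k) (hm0 k))]
    exact (mul_le_mul_of_nonneg_left (by linarith) (hr0 n k)).trans (hrmb n k)
  have hg : ∀ n, BoundedMeasurable fun k => r n k * r n k * q k := by
    intro n
    refine ⟨((hrm n).mul (hrm n)).mul hqm, (ε n)⁻¹ * A, fun k => ?_⟩
    rw [Real.norm_of_nonneg (mul_nonneg (mul_nonneg (hr0 n k) (hr0 n k)) (hq0 k))]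
    calc r n k * r n k * q k ≤ r n k * r n k * (A * (m k + 1)) :=
          mul_le_mul_of_nonneg_left (hqA k) (mul_nonneg (hr0 n k) (hr0 n k))
      _ = r n k * (r n k * (m k + 1)) * A := by ring
      _ ≤ 1 * (ε n)⁻¹ * A := by
          refine mul_le_mul_of_nonneg_right ?_ hA
          exact mul_le_mul ((le_abs_self _).trans (hr1 n k)) (hrmb n k)
            (mul_nonneg (hr0 n k) (by linarith [hm0 k])) zero_le_one
      _ = (ε n)⁻¹ * A := by ring
  have hderiv : ∀ n ξ, HasFDerivAt (fun ξ : Space ν => r n ((2 * Real.pi) • ξ)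
      * m ((2 * Real.pi) • ξ)) ((r n ((2 * Real.pi) • ξ) ^ 2 * (2 * Real.pi)) •
        fderiv ℝ m ((2 * Real.pi) • ξ)) ξ := by
    intro n ξ
    have h1 : HasFDerivAt (fun ξ : Space ν => m ((2 * Real.pi) • ξ))
        ((2 * Real.pi) • fderiv ℝ m ((2 * Real.pi) • ξ)) ξ := by
      have h2 := ((hm.differentiable (by simp)) ((2 * Real.pi) • ξ)).hasFDerivAt.comp ξ
        ((hasFDerivAt_id ξ).const_smul (2 * Real.pi))
      refine h2.congr_fderiv ?_
      ext y
      simp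
    have h3 := ((h1.const_mul (ε n)).const_add 1)
    have h4 := ((hasDerivAt_inv (hpos' n ((2 * Real.pi) • ξ))).comp_hasFDerivAt ξ h3).mul h1
    refine h4.congr_fderiv ?_
    ext y
    have h5 := hpos' n ((2 * Real.pi) • ξ)
    simp only [r, add_apply, smul_apply, smul_eq_mul, Function.comp_apply]
    field_simp
    ring
  have hd : ∀ n, ContDiff ℝ 1 fun ξ : Space ν => r n ((2 * Real.pi) • ξ)
      * m ((2 * Real.pi) • ξ) := by
    intro n
    have h1 : ContDiff ℝ 1 fun ξ : Space ν => m ((2 * Real.pi) • ξ) :=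
      hm.comp (contDiff_const_smul _)
    exact ((contDiff_const.add (contDiff_const.mul h1)).inv fun ξ => hpos' n _).mul h1
  have hC : ∀ n, ∃ C : ℝ, ∀ j ξ, |fderiv ℝ (fun ξ : Space ν => r n ((2 * Real.pi) • ξ)
      * m ((2 * Real.pi) • ξ)) ξ (basisVector j)| ≤ C := by
    intro n
    refine ⟨2 * Real.pi * (1 + (ε n)⁻¹ * A), fun j ξ => ?_⟩
    rw [(hderiv n ξ).fderiv, smul_apply, hmw, smul_eq_mul, abs_mul, abs_mul, abs_pow,
      abs_of_nonneg (hr0 _ _), abs_of_nonneg Real.two_pi_pos.le]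
    set k := (2 * Real.pi) • ξ
    have h1 : |w j ξ| ≤ 1 + q k := by
      have h2 : w j ξ ^ 2 ≤ q k := by
        rw [hq]
        exact Finset.single_le_sum (f := fun j => w j ξ ^ 2) (fun i _ => sq_nonneg _)
          (Finset.mem_univ j)
      rw [← sq_abs] at h2
      nlinarith [sq_nonneg (|w j ξ| - 1), abs_nonneg (w j ξ)]
    have h3 : r n k ^ 2 ≤ r n k := by
      rw [pow_two]
      exact mul_le_of_le_one_left (hr0 n k) ((le_abs_self _).trans (hr1 n k))
    have h4 : r n k ^ 2 * |w j ξ| ≤ 1 + (ε n)⁻¹ * A := by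
      calc r n k ^ 2 * |w j ξ| ≤ r n k * (1 + A * (m k + 1)) :=
            mul_le_mul h3 (h1.trans (by linarith [hqA k])) (abs_nonneg _) (hr0 n k)
        _ = r n k + r n k * (m k + 1) * A := by ring
        _ ≤ 1 + (ε n)⁻¹ * A := add_le_add ((le_abs_self _).trans (hr1 n k))
            (mul_le_mul_of_nonneg_right (hrmb n k) hA)
    calc r n k ^ 2 * (2 * Real.pi) * |w j ξ| = 2 * Real.pi * (r n k ^ 2 * |w j ξ|) := by ring
      _ ≤ 2 * Real.pi * (1 + (ε n)⁻¹ * A) := mul_le_mul_of_nonneg_left h4 Real.two_pi_pos.le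
  have hcomm : ∀ n, Complex.I * ⟪boundedMultiplier (fun k => r n k * m k) (u : L2 ν),
        oneBodyConjugate v ⟨y, hy⟩⟫_ℂ
      - Complex.I * ⟪oneBodyConjugate v ⟨u, hu⟩,
        boundedMultiplier (fun k => r n k * m k) (y : L2 ν)⟫_ℂ
      = ⟪(u : L2 ν), boundedMultiplier (fun k => r n k * r n k * q k) (y : L2 ν)⟫_ℂ := by
    intro n
    obtain ⟨C, hC⟩ := hC n
    refine commutator_boundedMultiplier hw hv (hf n) (hg n) (hd n) hC (fun ξ => ?_) ⟨u, hu⟩ ⟨y, hy⟩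
    rw [(hderiv n ξ).fderiv, hq]
    simp only [smul_apply, hmw, smul_eq_mul, Finset.mul_sum]
    refine Finset.sum_congr rfl fun j _ => ?_
    have := Real.two_pi_pos.ne'
    field_simp
  -- the three terms, written with bounded multipliers that converge weakly to the identity
  have t1 : ∀ n, boundedMultiplier (fun k => r n k * m k) (u : L2 ν)
      = boundedMultiplier (r n) (multiplier m u) := fun n =>
    (boundedMultiplier_multiplier (hr n) (hf n) (fun k => rfl) u).symm
  have t2 : ∀ n, boundedMultiplier (fun k => r n k * m k) (y : L2 ν)
      = boundedMultiplier (r n) (multiplier m y) := fun n =>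
    (boundedMultiplier_multiplier (hr n) (hf n) (fun k => rfl) y).symm
  have t3 : ∀ n, boundedMultiplier (fun k => r n k * r n k * q k) (y : L2 ν)
      = boundedMultiplier (fun k => r n k * r n k)
        (boundedMultiplier (fun k => q k * (m k + 1)⁻¹) (multiplier m y + y)) := by
    intro n
    have hrr := (hr n).mul (hr n)
    have h1 := hrr.mul hqb
    have h2 := (hg n).sub h1
    rw [← mul_apply_eq_comp, ← boundedMultiplier_mul hrr hqb, map_add,
      boundedMultiplier_multiplier h1 h2 (fun k => ?_) y, ← add_apply,
      ← boundedMultiplier_add h2 h1]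
    · simp
    · have : m k + 1 ≠ 0 := by linarith [hm0 k]
      field_simp
      ring
  simp only [t1, t2, t3, inner_boundedMultiplier (hr _)] at hcomm
  refine tendsto_nhds_unique (((tendsto_inner_boundedMultiplier hr hr1 hrlim _ _).const_mul
    Complex.I).sub ((tendsto_inner_boundedMultiplier hr hr1 hrlim _ _).const_mul Complex.I)) ?_
  simp only [hcomm]
  refine tendsto_inner_boundedMultiplier (fun n => (hr n).mul (hr n)) (fun n k => ?_)
    (fun k => ?_) _ _
  · rw [abs_mul]
    exact mul_le_one₀ (hr1 n k) (abs_nonneg _) (hr1 n k)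
  · simpa using (hrlim k).mul (hrlim k)

end FreeCommutator

/-! ### The energy of the free fiber Hamiltonian -/

section Energy

variable {ν : ℕ}

theorem one_le_japaneseBracket (x : Space ν) : 1 ≤ japaneseBracket x :=
  Real.one_le_sqrt.2 (by nlinarith [sq_nonneg ‖x‖])

theorem norm_le_japaneseBracket (x : Space ν) : ‖x‖ ≤ japaneseBracket x :=
  Real.le_sqrt_of_sq_le (by linarith)

theorem japaneseBracket_le (x : Space ν) : japaneseBracket x ≤ 1 + ‖x‖ :=
  Real.sqrt_le_iff.2 ⟨by positivity, by nlinarith [norm_nonneg x]⟩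

theorem japaneseBracket_rpow_le (x : Space ν) {a b : ℝ} (h : a ≤ b) :
    japaneseBracket x ^ a ≤ japaneseBracket x ^ b :=
  Real.rpow_le_rpow_of_exponent_le (one_le_japaneseBracket x) h

theorem inner_gradient_basisVector (f : Space ν → ℝ) (k : Space ν) (j : Fin ν) :
    gradient f k j = fderiv ℝ f k (basisVector j) := by
  rw [← inner_gradient_left, EuclideanSpace.inner_single_right]
  simp

theorem norm_gradient (f : Space ν → ℝ) (k : Space ν) : ‖gradient f k‖ = ‖fderiv ℝ f k‖ :=
  LinearIsometryEquiv.norm_map _ _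

/-- The dispersion relation `k ↦ Ω(P - k) + ω(k)` of the one-particle sector at total
momentum `P`. -/
def fiberEnergy (Ω ω : Space ν → ℝ) (P k : Space ν) : ℝ := Ω (P - k) + ω k

variable {s : ℝ} {Ω ω : Space ν → ℝ} (hΩ : MatterDispersion s Ω) (hω : FieldDispersion s ω)
  (P : Space ν)
include hΩ hω

theorem fiberEnergy_nonneg (k : Space ν) : 0 ≤ fiberEnergy Ω ω P k :=
  add_nonneg (hΩ.nonneg _) (hω.nonneg _)

theorem contDiff_fiberEnergy : ContDiff ℝ ((⊤ : ℕ∞) : WithTop ℕ∞) (fiberEnergy Ω ω P) :=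
  (hΩ.analytic.contDiff.comp (contDiff_const.sub contDiff_id)).add hω.analytic.contDiff

theorem gradient_fiberEnergy : gradient (fiberEnergy Ω ω P) = relativeVelocity Ω ω P := by
  funext k
  have hΩd : Differentiable ℝ Ω := (hΩ.analytic.contDiff (n := 1)).differentiable (by simp)
  have hωd : Differentiable ℝ ω := (hω.analytic.contDiff (n := 1)).differentiable (by simp)
  have h1 : HasFDerivAt (fiberEnergy Ω ω P) (fderiv ℝ ω k - fderiv ℝ Ω (P - k)) k := by
    have h2 := ((hΩd (P - k)).hasFDerivAt.comp k ((hasFDerivAt_id k).const_sub P)).add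
      (hωd k).hasFDerivAt
    refine h2.congr_fderiv ?_
    ext y
    simp
    ring
  rw [gradient, h1.fderiv, map_sub]
  rfl

theorem norm_iteratedFDeriv_fiberEnergy_le (n : ℕ) (hn : 1 ≤ n) :
    ∃ C : ℝ, 0 < C ∧ ∀ k, ‖iteratedFDeriv ℝ n (fiberEnergy Ω ω P) k‖
      ≤ C * japaneseBracket (P - k) ^ (s - n) + C := by
  obtain ⟨C₁, h0, h1⟩ := hΩ.deriv_bound n
  obtain ⟨C₂, h2⟩ := hω.deriv_bound n hn
  refine ⟨max C₁ C₂, lt_max_of_lt_left h0, fun k => ?_⟩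
  have hc1 : ContDiff ℝ n fun k => Ω (P - k) :=
    hΩ.analytic.contDiff.comp (contDiff_const.sub contDiff_id)
  have hc2 : ContDiff ℝ n ω := hω.analytic.contDiff
  have h3 : ‖iteratedFDeriv ℝ n (fun k => Ω (P - k)) k‖ = ‖iteratedFDeriv ℝ n Ω (P - k)‖ := by
    have h4 : (fun k => Ω (P - k)) = fun k => (Ω ∘ LinearIsometryEquiv.neg ℝ) (k - P) := by
      ext k
      simp
    rw [h4, iteratedFDeriv_comp_sub, LinearIsometryEquiv.norm_iteratedFDeriv_comp_right]
    simp
  have h5 : fiberEnergy Ω ω P = (fun k => Ω (P - k)) + ω := rfl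
  rw [h5, iteratedFDeriv_add_apply hc1.contDiffAt hc2.contDiffAt]
  refine (norm_add_le _ _).trans (add_le_add ?_ ((h2 k).trans (le_max_right _ _)))
  rw [h3]
  exact (h1 _).trans (mul_le_mul_of_nonneg_right (le_max_left _ _)
    (Real.rpow_nonneg (zero_le_one.trans (one_le_japaneseBracket _)) _))

theorem hasTemperateGrowth_fderiv_fiberEnergy :
    (fderiv ℝ (fiberEnergy Ω ω P)).HasTemperateGrowth := by
  refine hasTemperateGrowth_fderiv (contDiff_fiberEnergy hΩ hω P) fun n hn => ?_
  obtain ⟨C, hC, h⟩ := norm_iteratedFDeriv_fiberEnergy_le hΩ hω P n hn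
  -- the exponent `2` serves for all orders, as `s - n ≤ 2`
  refine ⟨2, C * (1 + ‖P‖) ^ 2 + C, fun k => (h k).trans ?_⟩
  have h1 : japaneseBracket (P - k) ^ (s - n) ≤ japaneseBracket (P - k) ^ 2 := by
    rw [← Real.rpow_natCast]
    refine japaneseBracket_rpow_le _ ?_
    have := hΩ.exponent_mem.2
    have hn0 : (0 : ℝ) ≤ n := n.cast_nonneg
    push_cast
    linarith
  have h2 : japaneseBracket (P - k) ≤ (1 + ‖P‖) * (1 + ‖k‖) := by
    refine (japaneseBracket_le _).trans ?_
    nlinarith [norm_sub_le P k, norm_nonneg P, norm_nonneg k, mul_nonneg (norm_nonneg P)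
      (norm_nonneg k)]
  have h3 : japaneseBracket (P - k) ^ 2 ≤ ((1 + ‖P‖) * (1 + ‖k‖)) ^ 2 :=
    pow_le_pow_left₀ (zero_le_one.trans (one_le_japaneseBracket _)) h2 2
  have h4 : (1 : ℝ) ≤ (1 + ‖k‖) ^ 2 := one_le_pow₀ (by linarith [norm_nonneg k])
  calc C * japaneseBracket (P - k) ^ (s - n) + C
      ≤ C * ((1 + ‖P‖) * (1 + ‖k‖)) ^ 2 + C * (1 + ‖k‖) ^ 2 :=
        add_le_add (mul_le_mul_of_nonneg_left (h1.trans h3) hC.le) (le_mul_of_one_le_right hC.le h4)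
    _ = (C * (1 + ‖P‖) ^ 2 + C) * (1 + ‖k‖) ^ 2 := by ring

/-- As `s ≤ 2`, the square of the velocity, of order `2 s - 2`, is dominated by the energy, of
order `s`. -/
theorem sq_norm_relativeVelocity_le :
    ∃ A : ℝ, 0 ≤ A ∧ ∀ k, ‖relativeVelocity Ω ω P k‖ ^ 2 ≤ A * (fiberEnergy Ω ω P k + 1) := by
  obtain ⟨C, hC, h⟩ := norm_iteratedFDeriv_fiberEnergy_le hΩ hω P 1 le_rfl
  obtain ⟨D, hD, hlow⟩ := hΩ.lower_bound
  refine ⟨2 * C ^ 2 * (D * (1 + D)) + 2 * C ^ 2, by positivity, fun k => ?_⟩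
  have h1 := h k
  rw [norm_iteratedFDeriv_one, ← norm_gradient, gradient_fiberEnergy hΩ hω] at h1
  set b := japaneseBracket (P - k) with hb
  have hb1 : 1 ≤ b := one_le_japaneseBracket _
  have hb0 : 0 < b := zero_lt_one.trans_le hb1
  have h2 : (b ^ (s - (1 : ℕ))) ^ 2 ≤ b ^ s := by
    rw [← Real.rpow_natCast, ← Real.rpow_mul hb0.le]
    refine Real.rpow_le_rpow_of_exponent_le hb1 ?_
    have := hΩ.exponent_mem.2
    push_cast
    linarith
  have h3 : b ^ s ≤ D * (1 + D) * (fiberEnergy Ω ω P k + 1) := by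
    have h4 := hlow (P - k)
    have h5 : D⁻¹ * b ^ s ≤ fiberEnergy Ω ω P k + D := by
      have := hω.nonneg k
      simp only [fiberEnergy]
      linarith
    rw [inv_mul_le_iff₀ hD] at h5
    refine h5.trans ?_
    rw [mul_assoc]
    refine mul_le_mul_of_nonneg_left ?_ hD.le
    nlinarith [fiberEnergy_nonneg hΩ hω P k, mul_nonneg hD.le (fiberEnergy_nonneg hΩ hω P k)]
  have h6 : ‖relativeVelocity Ω ω P k‖ ^ 2 ≤ (C * b ^ (s - (1 : ℕ)) + C) ^ 2 :=
    pow_le_pow_left₀ (norm_nonneg _) h1 2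
  have h7 : (C * b ^ (s - (1 : ℕ)) + C) ^ 2 ≤ 2 * C ^ 2 * (b ^ (s - (1 : ℕ))) ^ 2 + 2 * C ^ 2 := by
    nlinarith [sq_nonneg (C * b ^ (s - (1 : ℕ)) - C)]
  have h8 : 2 * C ^ 2 ≤ 2 * C ^ 2 * (fiberEnergy Ω ω P k + 1) :=
    le_mul_of_one_le_right (by positivity) (by linarith [fiberEnergy_nonneg hΩ hω P k])
  calc ‖relativeVelocity Ω ω P k‖ ^ 2 ≤ 2 * C ^ 2 * (b ^ (s - (1 : ℕ))) ^ 2 + 2 * C ^ 2 :=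
        h6.trans h7
    _ ≤ 2 * C ^ 2 * (D * (1 + D) * (fiberEnergy Ω ω P k + 1))
        + 2 * C ^ 2 * (fiberEnergy Ω ω P k + 1) :=
        add_le_add (mul_le_mul_of_nonneg_left (h2.trans h3) (by positivity)) h8
    _ = _ := by ring

/-- The energy is proper, so that the energy shells are compact. -/
theorem tendsto_fiberEnergy : Tendsto (fiberEnergy Ω ω P) (cocompact (Space ν)) atTop := by
  rcases hΩ.exponent_mem.1.eq_or_lt with hs | hs
  · exact tendsto_atTop_mono (fun k => le_add_of_nonneg_left (hΩ.nonneg _))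
      (hω.tendsto_atTop hs.symm)
  · obtain ⟨D, hD, hlow⟩ := hΩ.lower_bound
    have h1 : Tendsto (fun k : Space ν => ‖P - k‖) (cocompact (Space ν)) atTop := by
      refine tendsto_atTop_mono (f := fun k : Space ν => ‖k‖ - ‖P‖) (fun k => ?_)
        (tendsto_atTop_add_const_right _ _ (tendsto_norm_cocompact_atTop (E := Space ν)))
      rw [norm_sub_rev]
      exact norm_sub_norm_le k P
    have h2 := tendsto_atTop_add_const_right _ (-D)
      (((tendsto_rpow_atTop hs).comp h1).const_mul_atTop (inv_pos.2 hD))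
    refine tendsto_atTop_mono (fun k => ?_) h2
    refine le_trans ?_ ((hlow (P - k)).trans (le_add_of_nonneg_right (hω.nonneg k)))
    rw [sub_eq_add_neg]
    exact add_le_add_left (mul_le_mul_of_nonneg_left (Real.rpow_le_rpow (norm_nonneg _)
      (norm_le_japaneseBracket _) hs.le) (inv_pos.2 hD).le) _

/-- Away from the thresholds, the relative velocity is bounded below near the energy shell. -/
theorem exists_le_sq_norm_relativeVelocity {lam : ℝ} (hlam : lam ∉ thresholdSet Ω ω P) :
    ∃ κ > (0 : ℝ), ∃ c > (0 : ℝ), ∀ k, |fiberEnergy Ω ω P k - lam| ≤ 2 * κ →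
      c ≤ ‖relativeVelocity Ω ω P k‖ ^ 2 := by
  have hc : Continuous (fiberEnergy Ω ω P) := (contDiff_fiberEnergy hΩ hω P).continuous
  have hgc : Continuous fun k => |fiberEnergy Ω ω P k - lam| + ‖relativeVelocity Ω ω P k‖ ^ 2 := by
    have h1 : Continuous (fderiv ℝ (fiberEnergy Ω ω P)) :=
      (contDiff_fiberEnergy hΩ hω P).continuous_fderiv (by simp)
    have h2 : ∀ k, ‖relativeVelocity Ω ω P k‖ = ‖fderiv ℝ (fiberEnergy Ω ω P) k‖ := fun k => by
      rw [← norm_gradient, gradient_fiberEnergy hΩ hω]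
    simp only [h2]
    exact (hc.sub continuous_const).abs.add (h1.norm.pow 2)
  -- a zero of this function would be a point with vanishing velocity on the energy shell
  have hpos : ∀ k, 0 < |fiberEnergy Ω ω P k - lam| + ‖relativeVelocity Ω ω P k‖ ^ 2 := by
    intro k
    by_contra hk
    have h1 : |fiberEnergy Ω ω P k - lam| = 0 := by
      linarith [abs_nonneg (fiberEnergy Ω ω P k - lam), sq_nonneg ‖relativeVelocity Ω ω P k‖]
    have h2 : ‖relativeVelocity Ω ω P k‖ ^ 2 = 0 := by
      linarith [abs_nonneg (fiberEnergy Ω ω P k - lam), sq_nonneg ‖relativeVelocity Ω ω P k‖]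
    refine hlam ⟨k, (sub_eq_zero.1 (abs_eq_zero.1 h1)).symm, ?_⟩
    exact (sub_eq_zero.1 (norm_eq_zero.1 (pow_eq_zero_iff two_ne_zero |>.1 h2))).symm
  have hK : IsCompact {k | |fiberEnergy Ω ω P k - lam| ≤ 2} := by
    have h1 : ∀ᶠ k in cocompact (Space ν), lam + 2 < fiberEnergy Ω ω P k :=
      (tendsto_fiberEnergy hΩ hω P).eventually_gt_atTop _
    obtain ⟨t, ht, hsub⟩ := mem_cocompact.1 h1
    refine ht.of_isClosed_subset
      (isClosed_le (hc.sub continuous_const).abs continuous_const) fun k hk => ?_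
    by_contra hkt
    have h2 : lam + 2 < fiberEnergy Ω ω P k := hsub hkt
    have h3 : fiberEnergy Ω ω P k - lam ≤ 2 := (le_abs_self _).trans hk
    linarith
  obtain ⟨δ, hδ, hle⟩ : ∃ δ > (0 : ℝ), ∀ k, |fiberEnergy Ω ω P k - lam| ≤ 2 →
      δ ≤ |fiberEnergy Ω ω P k - lam| + ‖relativeVelocity Ω ω P k‖ ^ 2 := by
    obtain ⟨δ, hδ, h⟩ := hK.exists_forall_le' hgc.continuousOn (a := 0) fun k _ => hpos k
    exact ⟨δ, hδ, h⟩
  -- where `|m - lam| ≤ 2 κ ≤ δ / 2`, at least `δ / 2` is left for the velocity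
  refine ⟨min 1 (δ / 4), lt_min one_pos (by linarith), δ / 2, by linarith, fun k hk => ?_⟩
  have h1 := hle k (hk.trans (by linarith [min_le_left 1 (δ / 4)]))
  linarith [min_le_right 1 (δ / 4)]

end Energy

/-! ### The commutator form -/

section CommutatorForm

variable {𝓗 : Type*} [NormedAddCommGroup 𝓗] [InnerProductSpace ℂ 𝓗]

/-- The form `⟪u, M (H w - V w + w)⟫ + ⟪u, K w⟫` on the domain of `H`. For `H = V + H₀` it is the
form of `M (H₀ + 1) + K`. -/
def commutatorForm (H : 𝓗 →ₗ.[ℂ] 𝓗) (V M K : 𝓗 →L[ℂ] 𝓗) :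
    H.domain →ₗ⋆[ℂ] H.domain →ₗ[ℂ] ℂ :=
  ((innerₛₗ ℂ).comp H.domain.subtype).compl₂
    ((M : 𝓗 →ₗ[ℂ] 𝓗).comp (H.toFun - (V : 𝓗 →ₗ[ℂ] 𝓗).comp H.domain.subtype + H.domain.subtype)
      + (K : 𝓗 →ₗ[ℂ] 𝓗).comp H.domain.subtype)

theorem commutatorForm_apply (H : 𝓗 →ₗ.[ℂ] 𝓗) (V M K : 𝓗 →L[ℂ] 𝓗) (u w : H.domain) :
    commutatorForm H V M K u w = ⟪(u : 𝓗), M (H w - V w + w)⟫_ℂ + ⟪(u : 𝓗), K w⟫_ℂ := by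
  rw [← inner_add_right]
  rfl

theorem norm_commutatorForm_le (H : 𝓗 →ₗ.[ℂ] 𝓗) (V M K : 𝓗 →L[ℂ] 𝓗) (u w : H.domain) :
    ‖commutatorForm H V M K u w‖ ≤ (‖M‖ * (1 + ‖V‖) + ‖K‖) * (‖(u : 𝓗)‖ + ‖H u‖)
      * (‖(w : 𝓗)‖ + ‖H w‖) := by
  rw [commutatorForm_apply, ← inner_add_right]
  have h1 : ‖M (H w - V w + w) + K w‖ ≤ (‖M‖ * (1 + ‖V‖) + ‖K‖) * (‖(w : 𝓗)‖ + ‖H w‖) := by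
    have h2 : ‖H w - V w + w‖ ≤ (1 + ‖V‖) * (‖(w : 𝓗)‖ + ‖H w‖) := by
      refine (norm_add_le _ _).trans ?_
      have h3 := norm_sub_le (H w) (V w)
      nlinarith [V.le_opNorm (w : 𝓗), mul_nonneg (norm_nonneg V) (norm_nonneg (H w))]
    have h4 : ‖M (H w - V w + w)‖ ≤ ‖M‖ * ((1 + ‖V‖) * (‖(w : 𝓗)‖ + ‖H w‖)) :=
      (M.le_opNorm _).trans (mul_le_mul_of_nonneg_left h2 (norm_nonneg _))
    have h5 : ‖K w‖ ≤ ‖K‖ * (‖(w : 𝓗)‖ + ‖H w‖) :=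
      (K.le_opNorm _).trans (mul_le_mul_of_nonneg_left
        (le_add_of_nonneg_right (norm_nonneg _)) (norm_nonneg _))
    refine (norm_add_le _ _).trans ((add_le_add h4 h5).trans (le_of_eq (by ring)))
  calc _ ≤ ‖(u : 𝓗)‖ * ‖M (H w - V w + w) + K w‖ := norm_inner_le_norm _ _
    _ ≤ (‖(u : 𝓗)‖ + ‖H u‖) * ((‖M‖ * (1 + ‖V‖) + ‖K‖) * (‖(w : 𝓗)‖ + ‖H w‖)) :=
        mul_le_mul (le_add_of_nonneg_right (norm_nonneg _)) h1 (norm_nonneg _) (by positivity)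
    _ = _ := by ring

/-- The bounded extension of the commutator form is unique if the domain of `A` contains a core
of `H`. -/
theorem IsCommutatorExtension.unique {H A : 𝓗 →ₗ.[ℂ] 𝓗}
    {C C' : H.domain →ₗ⋆[ℂ] H.domain →ₗ[ℂ] ℂ} (hC : IsCommutatorExtension H A C)
    (hC' : IsCommutatorExtension H A C')
    (hcore : ∀ u : H.domain, ∃ x : ℕ → H.domain, (∀ n, (x n : 𝓗) ∈ A.domain) ∧
      Tendsto (fun n => (x n : 𝓗)) atTop (𝓝 u) ∧ Tendsto (fun n => H (x n)) atTop (𝓝 (H u))) :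
    C' = C := by
  obtain ⟨M, hM⟩ := hC.bounded
  obtain ⟨M', hM'⟩ := hC'.bounded
  have hb : ∀ u w : H.domain, ‖(C' - C) u w‖
      ≤ (M' + M) * (‖(u : 𝓗)‖ + ‖H u‖) * (‖(w : 𝓗)‖ + ‖H w‖) := by
    intro u w
    rw [LinearMap.sub_apply, LinearMap.sub_apply]
    exact (norm_sub_le _ _).trans ((add_le_add (hM' u w) (hM u w)).trans (le_of_eq (by ring)))
  rw [← sub_eq_zero]
  refine LinearMap.ext fun u => LinearMap.ext fun w => ?_
  obtain ⟨x, hxA, hx, hHx⟩ := hcore u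
  obtain ⟨y, hyA, hy, hHy⟩ := hcore w
  have hzero : ∀ n, (C' - C) (x n) (y n) = 0 := by
    intro n
    rw [LinearMap.sub_apply, LinearMap.sub_apply, hC.extend _ _ (hxA n) (hyA n),
      hC'.extend _ _ (hxA n) (hyA n), sub_self]
  generalize C' - C = D at hb hzero ⊢
  have hle : ∀ n, ‖D u w‖
      ≤ (M' + M) * (‖(u : 𝓗) - x n‖ + ‖H u - H (x n)‖) * (‖(w : 𝓗)‖ + ‖H w‖)
        + (M' + M) * (‖(x n : 𝓗)‖ + ‖H (x n)‖) * (‖(w : 𝓗) - y n‖ + ‖H w - H (y n)‖) := by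
    intro n
    have h1 : D u w = D (u - x n) w + D (x n) (w - y n) := by
      rw [map_sub, map_sub, LinearMap.sub_apply, hzero n]
      ring
    have h2 := hb (u - x n) w
    have h3 := hb (x n) (w - y n)
    rw [LinearPMap.map_sub, Submodule.coe_sub] at h2 h3
    rw [h1]
    exact (norm_add_le _ _).trans (add_le_add h2 h3)
  have hlim := (((((tendsto_const_nhds (x := (u : 𝓗))).sub hx).norm.add
      ((tendsto_const_nhds (x := H u)).sub hHx).norm).const_mul (M' + M)).mul_const
        (‖(w : 𝓗)‖ + ‖H w‖)).add (((hx.norm.add hHx.norm).const_mul (M' + M)).mul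
      (((tendsto_const_nhds (x := (w : 𝓗))).sub hy).norm.add
      ((tendsto_const_nhds (x := H w)).sub hHy).norm))
  have h0 := ge_of_tendsto' hlim hle
  simp only [sub_self, norm_zero, add_zero, mul_zero, zero_mul] at h0
  exact norm_le_zero_iff.1 h0

end CommutatorForm

/-! ### Schwartz functions form a core -/

section Core

variable {ν : ℕ} {m : Space ν → ℝ}

theorem boundedMultiplier_inv_add_multiplier (hm : Measurable m) (hm0 : ∀ k, 0 ≤ m k)
    (u : (multiplier m).domain) :
    boundedMultiplier (fun k => (m k + 1)⁻¹) (multiplier m u + u) = u := by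
  have h1 := boundedMeasurable_inv_add hm hm0 one_pos
  have h2 : BoundedMeasurable fun _ : Space ν => (1 : ℝ) := BoundedMeasurable.const 1
  have h3 := h2.sub h1
  rw [map_add, boundedMultiplier_multiplier h1 h3 (fun k => ?_) u, ← add_apply,
    ← boundedMultiplier_add h3 h1]
  · simp [boundedMultiplier_one]
  · have : m k + 1 ≠ 0 := by linarith [hm0 k]
    field_simp
    ring

/-- The functions with smooth, compactly supported Fourier transform form a core of `m(D)`, for
smooth `m ≥ 0`: `(m + 1) û` is approximated by smooth compactly supported functions. -/
theorem exists_seq_schwartz_multiplier (hm : ContDiff ℝ ((⊤ : ℕ∞) : WithTop ℕ∞) m)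
    (hm0 : ∀ k, 0 ≤ m k) (u : (multiplier m).domain) :
    ∃ (φ : ℕ → 𝓢(Space ν, ℂ)) (hφ : ∀ n, schwartzToL2 (φ n) ∈ (multiplier m).domain),
      Tendsto (fun n => schwartzToL2 (φ n)) atTop (𝓝 (u : L2 ν)) ∧
      Tendsto (fun n => multiplier m ⟨schwartzToL2 (φ n), hφ n⟩) atTop (𝓝 (multiplier m u)) := by
  have hmm : Measurable m := hm.continuous.measurable
  have hpos : ∀ k, m k + 1 ≠ 0 := fun k => by linarith [hm0 k]
  set x : L2 ν := multiplier m u + u with hx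
  have key : ∀ n : ℕ, ∃ (φ : 𝓢(Space ν, ℂ)) (hφ : schwartzToL2 φ ∈ (multiplier m).domain),
      ‖multiplier m ⟨schwartzToL2 φ, hφ⟩ + schwartzToL2 φ - x‖ ≤ 1 / ((n : ℝ) + 1) := by
    intro n
    obtain ⟨h, hh1, hh2, hh3⟩ := (Lp.memLp (fourierEquivL2 ν x)).exist_eLpNorm_sub_le
      (by simp) (by simp) (ε := 1 / ((n : ℝ) + 1)) (by positivity)
    have hM : ContDiff ℝ ((⊤ : ℕ∞) : WithTop ℕ∞)
        fun ξ : Space ν => (((m ((2 * Real.pi) • ξ) + 1)⁻¹ : ℝ) : ℂ) :=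
      Complex.ofRealCLM.contDiff.comp
        (((hm.comp (contDiff_const_smul _)).add contDiff_const).inv fun ξ => hpos _)
    have hc : HasCompactSupport fun ξ : Space ν =>
        (((m ((2 * Real.pi) • ξ) + 1)⁻¹ : ℝ) : ℂ) * h ξ :=
      hh1.mul_left
    let ψ : 𝓢(Space ν, ℂ) := hc.toSchwartzMap (hM.mul hh2)
    have hψ : (fourierEquivL2 ν (schwartzToL2 (𝓕⁻ ψ : 𝓢(Space ν, ℂ))) : Space ν → ℂ)
        =ᵐ[volume] ψ := by
      have := fourierEquivL2_schwartzToL2 (𝓕⁻ ψ : 𝓢(Space ν, ℂ))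
      rwa [FourierTransform.fourier_fourierInv_eq] at this
    have hψ' : ∀ ξ, ψ ξ = (((m ((2 * Real.pi) • ξ) + 1)⁻¹ : ℝ) : ℂ) * h ξ := fun ξ => rfl
    have hadd : ∀ ξ, (m ((2 * Real.pi) • ξ) : ℂ) * ψ ξ + ψ ξ = h ξ := by
      intro ξ
      have h1 : ((m ((2 * Real.pi) • ξ) : ℂ) + 1) ≠ 0 := by
        exact_mod_cast hpos ((2 * Real.pi) • ξ)
      rw [hψ']
      push_cast
      field_simp
    have hh : MemLp h 2 volume := hh2.continuous.memLp_of_hasCompactSupport hh1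
    have hdom : schwartzToL2 (𝓕⁻ ψ : 𝓢(Space ν, ℂ)) ∈ (multiplier m).domain := by
      refine mem_multiplier_domain.2 ((memLp_congr_ae ?_).2 (hh.sub (ψ.memLp 2 volume)))
      filter_upwards [hψ] with ξ h1
      rw [h1, Pi.sub_apply, ← hadd]
      ring
    refine ⟨𝓕⁻ ψ, hdom, ?_⟩
    rw [← norm_fourierEquivL2, Lp.norm_def]
    refine ENNReal.toReal_le_of_le_ofReal (by positivity) ?_
    refine le_trans (le_of_eq ?_) hh3
    rw [eLpNorm_sub_comm]
    refine eLpNorm_congr_ae ?_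
    rw [map_sub, map_add]
    filter_upwards [hψ, fourierEquivL2_multiplier m ⟨_, hdom⟩,
      Lp.coeFn_sub (fourierEquivL2 ν (multiplier m ⟨_, hdom⟩) + fourierEquivL2 ν
        (schwartzToL2 (𝓕⁻ ψ : 𝓢(Space ν, ℂ)))) (fourierEquivL2 ν x),
      Lp.coeFn_add (fourierEquivL2 ν (multiplier m ⟨_, hdom⟩)) (fourierEquivL2 ν
        (schwartzToL2 (𝓕⁻ ψ : 𝓢(Space ν, ℂ))))] with ξ h1 h2 h3 h4
    rw [h3, Pi.sub_apply, Pi.sub_apply, h4, Pi.add_apply, h2, h1, hadd]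
  choose φ hφ hle using key
  have hlim : Tendsto (fun n => multiplier m ⟨schwartzToL2 (φ n), hφ n⟩ + schwartzToL2 (φ n))
      atTop (𝓝 x) := by
    rw [tendsto_iff_norm_sub_tendsto_zero]
    exact squeeze_zero (fun _ => norm_nonneg _) hle tendsto_one_div_add_atTop_nhds_zero_nat
  have h1 : Tendsto (fun n => schwartzToL2 (φ n)) atTop (𝓝 (u : L2 ν)) := by
    have h2 := ((boundedMultiplier fun k => (m k + 1)⁻¹).continuous.tendsto x).comp hlim
    rw [hx, boundedMultiplier_inv_add_multiplier hmm hm0] at h2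
    exact h2.congr fun n => boundedMultiplier_inv_add_multiplier hmm hm0 ⟨_, hφ n⟩
  refine ⟨φ, hφ, h1, ?_⟩
  have h2 := hlim.sub h1
  simpa [hx] using h2

end Core

/-! ### The commutator of the fiber Hamiltonian -/

section Assembly

variable {ν : ℕ}

/-- The commutator of the interaction with the conjugate operator, for `τ = a ρ`: the finite rank
operator `(z, u) ↦ (i ⟪τ, u⟫, -i z τ)`. -/
def interactionCommutator (τ : L2 ν) : FiberSpace ν →L[ℂ] FiberSpace ν :=
  Complex.I • (InnerProductSpace.rankOne ℂ (vacuum ν) (oneParticle τ)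
    - InnerProductSpace.rankOne ℂ (oneParticle τ) (vacuum ν))

theorem isCompactOperator_interactionCommutator (τ : L2 ν) :
    IsCompactOperator (interactionCommutator τ) :=
  ((isCompactOperator_rankOne _ _).sub (isCompactOperator_rankOne _ _)).smul Complex.I

theorem inner_interactionCommutator (τ : L2 ν) (u w : FiberSpace ν) :
    ⟪u, interactionCommutator τ w⟫_ℂ = Complex.I * ((starRingEnd ℂ) u.fst * ⟪τ, w.snd⟫_ℂ)
      - Complex.I * (w.fst * ⟪u.snd, τ⟫_ℂ) := by
  have h1 : interactionCommutator τ w = Complex.I • (⟪oneParticle τ, w⟫_ℂ • vacuum ν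
      - ⟪vacuum ν, w⟫_ℂ • oneParticle τ) := rfl
  rw [h1, inner_smul_right, inner_sub_right, inner_smul_right, inner_smul_right,
    ← inner_conj_symm u (vacuum ν), ← inner_conj_symm u (oneParticle τ), inner_oneParticle,
    inner_oneParticle, inner_vacuum, inner_vacuum, inner_conj_symm]
  ring

/-- The operator `(V + H₀) w = (e z + ⟪ρ, y⟫, m(D) y + z ρ)` on `w = (z, y)`. -/
theorem inner_interactionL_add_diagonal (ρ : L2 ν) (e : ℂ) {m : Space ν → ℝ}
    (w : (diagonal e (multiplier m)).domain) (y : L2 ν) :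
    ⟪oneParticle y, interactionL ρ (w : FiberSpace ν) + diagonal e (multiplier m) w⟫_ℂ
      = (w : FiberSpace ν).fst * ⟪y, ρ⟫_ℂ + ⟪y, multiplier m ⟨(w : FiberSpace ν).snd, w.2⟩⟫_ℂ := by
  have h1 : interactionL ρ (w : FiberSpace ν) = interaction ρ w := by
    rw [← coe_interactionL]
    rfl
  rw [inner_oneParticle, WithLp.add_snd, inner_add_right, h1, diagonal_apply]
  congr 1
  change ⟪y, (w : FiberSpace ν).fst • ρ⟫_ℂ = _
  rw [inner_smul_right]

variable {v : Space ν → Space ν} {w : Fin ν → Space ν → ℝ} {m q : Space ν → ℝ} {A e : ℝ}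
  {ρ τ : L2 ν}

/-- The commutator form of `H = V + diag (e, m(D))` with `i diag (0, a)` is given by
`diag (0, q(D))`, `q = |v|²`, and the finite rank operator `interactionCommutator τ`, `τ = a ρ`. -/
theorem isCommutatorExtension_commutatorForm
    (hw : ∀ j, (w j).HasTemperateGrowth) (hv : ∀ j ξ, v ((2 * Real.pi) • ξ) j = w j ξ)
    (hm : ContDiff ℝ 1 m) (hm0 : ∀ k, 0 ≤ m k)
    (hmw : ∀ j ξ, fderiv ℝ m ((2 * Real.pi) • ξ) (basisVector j) = w j ξ)
    (hqm : Measurable q) (hq : ∀ ξ, q ((2 * Real.pi) • ξ) = ∑ j, w j ξ ^ 2)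
    (hq0 : ∀ k, 0 ≤ q k) (hA : 0 ≤ A) (hqA : ∀ k, q k ≤ A * (m k + 1))
    (hτ : ∀ φ, ⟪ρ, schwartzToL2 (schwartzConjugate v φ)⟫_ℂ = ⟪τ, schwartzToL2 φ⟫_ℂ) :
    IsCommutatorExtension
      ((interactionL ρ : FiberSpace ν →ₗ[ℂ] FiberSpace ν) +ᵥ diagonal (e : ℂ) (multiplier m))
      (conjugateOperator v)
      (commutatorForm _ (interactionL ρ) (blockMultiplier 0 fun k => q k * (m k + 1)⁻¹)
        (interactionCommutator τ)) := by
  refine ⟨⟨_, norm_commutatorForm_le _ _ _ _⟩, fun u y hu hy => ?_⟩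
  have hfree := commutator_multiplier hw hv hm hm0 hmw hqm hq hq0 hA hqA
    ⟨(u : FiberSpace ν).snd, u.2⟩ ⟨(y : FiberSpace ν).snd, y.2⟩ hu hy
  have hA' : ∀ (z : FiberSpace ν) (hz : z ∈ (conjugateOperator v).domain),
      conjugateOperator v ⟨z, hz⟩ = oneParticle (oneBodyConjugate v ⟨z.snd, hz⟩) := by
    intro z hz
    refine fiberSpace_ext ?_ rfl
    exact zero_mul _
  have hH : ∀ z : ((interactionL ρ : FiberSpace ν →ₗ[ℂ] FiberSpace ν) +ᵥ
      diagonal (e : ℂ) (multiplier m)).domain,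
      ((interactionL ρ : FiberSpace ν →ₗ[ℂ] FiberSpace ν) +ᵥ diagonal (e : ℂ) (multiplier m)) z
        = interactionL ρ (z : FiberSpace ν) + diagonal (e : ℂ) (multiplier m) z := fun z => rfl
  have h1 := inner_interactionL_add_diagonal ρ (e : ℂ) u (oneBodyConjugate v ⟨_, hy⟩)
  have h2 := inner_interactionL_add_diagonal ρ (e : ℂ) y (oneBodyConjugate v ⟨_, hu⟩)
  have h3 := inner_oneBodyConjugate hτ ⟨_, hu⟩
  have h4 := inner_oneBodyConjugate hτ ⟨_, hy⟩
  rw [hA', hA', inner_smul_right, inner_smul_left, hH, hH, h2,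
    ← inner_conj_symm _ (oneParticle (oneBodyConjugate v ⟨_, hy⟩)), h1, map_add, map_mul,
    inner_conj_symm, inner_conj_symm, h4, ← inner_conj_symm _ ρ, h3, inner_conj_symm,
    commutatorForm_apply, inner_interactionCommutator, hH, add_sub_cancel_left]
  rw [inner_fiberSpace, blockMultiplier_fst, blockMultiplier_snd, Complex.ofReal_zero, zero_mul,
    mul_zero, zero_add]
  have h5 : (diagonal (e : ℂ) (multiplier m) y + (y : FiberSpace ν)).snd
      = multiplier m ⟨(y : FiberSpace ν).snd, y.2⟩ + (y : FiberSpace ν).snd := rfl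
  rw [h5]
  simp only [map_neg, Complex.conj_I, neg_neg]
  linear_combination -hfree

/-- The vectors with a Schwartz function as second component form a core of `H`. -/
theorem exists_seq_core (hm : ContDiff ℝ ((⊤ : ℕ∞) : WithTop ℕ∞) m) (hm0 : ∀ k, 0 ≤ m k)
    (u : ((interactionL ρ : FiberSpace ν →ₗ[ℂ] FiberSpace ν) +ᵥ
      diagonal (e : ℂ) (multiplier m)).domain) :
    ∃ x : ℕ → ((interactionL ρ : FiberSpace ν →ₗ[ℂ] FiberSpace ν) +ᵥ
      diagonal (e : ℂ) (multiplier m)).domain,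
      (∀ n, (x n : FiberSpace ν) ∈ (conjugateOperator v).domain) ∧
      Tendsto (fun n => (x n : FiberSpace ν)) atTop (𝓝 (u : FiberSpace ν)) ∧
      Tendsto (fun n => ((interactionL ρ : FiberSpace ν →ₗ[ℂ] FiberSpace ν) +ᵥ
        diagonal (e : ℂ) (multiplier m)) (x n)) atTop
          (𝓝 (((interactionL ρ : FiberSpace ν →ₗ[ℂ] FiberSpace ν) +ᵥ
            diagonal (e : ℂ) (multiplier m)) u)) := by
  obtain ⟨φ, hφ, h1, h2⟩ := exists_seq_schwartz_multiplier hm hm0 ⟨(u : FiberSpace ν).snd, u.2⟩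
  have hpair : ∀ (z : ℂ) {f : ℕ → L2 ν} {y : L2 ν}, Tendsto f atTop (𝓝 y) →
      Tendsto (fun n => (WithLp.toLp 2 (z, f n) : FiberSpace ν)) atTop
        (𝓝 (WithLp.toLp 2 (z, y))) := fun z f y h =>
    ((WithLp.prod_continuous_toLp 2 ℂ (L2 ν)).tendsto _).comp (tendsto_const_nhds.prodMk_nhds h)
  have h3 := hpair (u : FiberSpace ν).fst h1
  refine ⟨fun n => ⟨WithLp.toLp 2 ((u : FiberSpace ν).fst, schwartzToL2 (φ n)), hφ n⟩,
    fun n => schwartzToL2_mem_domain v (φ n), h3, ?_⟩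
  exact (((interactionL ρ).continuous.tendsto _).comp h3).add
    (hpair ((e : ℂ) * (u : FiberSpace ν).fst) h2)

end Assembly

section Model

variable {ν : ℕ}

theorem japaneseBracket_sub_smul_le (P ξ : Space ν) :
    japaneseBracket (P - (2 * Real.pi) • ξ) ≤ (1 + ‖P‖ + 2 * Real.pi) * japaneseBracket ξ := by
  refine (japaneseBracket_le _).trans ?_
  have h1 : ‖P - (2 * Real.pi) • ξ‖ ≤ ‖P‖ + 2 * Real.pi * ‖ξ‖ := by
    refine (norm_sub_le _ _).trans ?_
    rw [norm_smul, Real.norm_of_nonneg Real.two_pi_pos.le]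
  nlinarith [norm_nonneg P, one_le_japaneseBracket ξ, norm_le_japaneseBracket ξ, Real.two_pi_pos,
    mul_nonneg (norm_nonneg P) (sub_nonneg.2 (one_le_japaneseBracket ξ)),
    mul_nonneg Real.two_pi_pos.le (sub_nonneg.2 (norm_le_japaneseBracket ξ))]

/-- The coupling function is in the domain of the adjoint of the conjugate operator. -/
theorem exists_adjoint_couplingFunction {s : ℝ} {Ω ω : Space ν → ℝ} {ρ : L2 ν}
    (hΩ : MatterDispersion s Ω) (hω : FieldDispersion s ω) (hρ : CouplingFunction ρ)
    (P : Space ν) {w : Fin ν → Space ν → ℝ} (hw : ∀ j, (w j).HasTemperateGrowth)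
    (hwm : ∀ j ξ, w j ξ = fderiv ℝ (fiberEnergy Ω ω P) ((2 * Real.pi) • ξ) (basisVector j))
    (hv : ∀ j ξ, relativeVelocity Ω ω P ((2 * Real.pi) • ξ) j = w j ξ) :
    ∃ τ : L2 ν, ∀ φ, ⟪ρ, schwartzToL2 (schwartzConjugate (relativeVelocity Ω ω P) φ)⟫_ℂ
      = ⟪τ, schwartzToL2 φ⟫_ℂ := by
  obtain ⟨g, hg, hg2, hdg, -⟩ := hρ.fourier
  obtain ⟨C₁, hC₁, h1⟩ := norm_iteratedFDeriv_fiberEnergy_le hΩ hω P 1 le_rfl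
  obtain ⟨C₂, hC₂, h2⟩ := norm_iteratedFDeriv_fiberEnergy_le hΩ hω P 2 one_le_two
  have hs := hΩ.exponent_mem.2
  have hb : ∀ j : Fin ν, ‖(basisVector j : Space ν)‖ = 1 := fun j => by simp
  set C := max (C₁ * (1 + ‖P‖ + 2 * Real.pi) + C₁) (2 * Real.pi * (C₂ + C₂)) with hC
  refine exists_adjoint_schwartzConjugate hw hv (C := C) (fun j ξ => ?_) (fun j ξ => ?_) hg
    (hg2.of_le (by norm_num)) hdg
  · have h3 := h1 ((2 * Real.pi) • ξ)
    rw [norm_iteratedFDeriv_one] at h3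
    have h4 : japaneseBracket (P - (2 * Real.pi) • ξ) ^ (s - (1 : ℕ))
        ≤ (1 + ‖P‖ + 2 * Real.pi) * japaneseBracket ξ := by
      refine (japaneseBracket_rpow_le _ (b := 1) ?_).trans ?_
      · push_cast
        linarith
      · rw [Real.rpow_one]
        exact japaneseBracket_sub_smul_le P ξ
    have h5 := (fderiv ℝ (fiberEnergy Ω ω P) ((2 * Real.pi) • ξ)).le_opNorm (basisVector j)
    rw [hb, mul_one, ← hwm, Real.norm_eq_abs] at h5
    have hJ := one_le_japaneseBracket ξ
    calc |w j ξ| ≤ C₁ * ((1 + ‖P‖ + 2 * Real.pi) * japaneseBracket ξ) + C₁ * japaneseBracket ξ :=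
          (h5.trans h3).trans (add_le_add (mul_le_mul_of_nonneg_left h4 hC₁.le)
            (le_mul_of_one_le_right hC₁.le hJ))
      _ = (C₁ * (1 + ‖P‖ + 2 * Real.pi) + C₁) * japaneseBracket ξ := by ring
      _ ≤ C * japaneseBracket ξ := mul_le_mul_of_nonneg_right (le_max_left _ _) (by linarith)
  · have h3 := h2 ((2 * Real.pi) • ξ)
    rw [← norm_iteratedFDeriv_fderiv, norm_iteratedFDeriv_one] at h3
    have h4 : japaneseBracket (P - (2 * Real.pi) • ξ) ^ (s - (2 : ℕ)) ≤ 1 := by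
      rw [← Real.rpow_zero (japaneseBracket (P - (2 * Real.pi) • ξ))]
      refine japaneseBracket_rpow_le _ ?_
      push_cast
      linarith
    have h5 : HasFDerivAt (w j) ((ContinuousLinearMap.apply ℝ ℝ (basisVector j)).comp
        ((2 * Real.pi) • fderiv ℝ (fderiv ℝ (fiberEnergy Ω ω P)) ((2 * Real.pi) • ξ))) ξ := by
      have h6 : Differentiable ℝ (fderiv ℝ (fiberEnergy Ω ω P)) :=
        (hasTemperateGrowth_fderiv_fiberEnergy hΩ hω P).1.differentiable (by simp)
      have h7 := (h6 ((2 * Real.pi) • ξ)).hasFDerivAt.comp ξ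
        ((hasFDerivAt_id ξ).const_smul (2 * Real.pi))
      have h8 : w j = fun ξ => (ContinuousLinearMap.apply ℝ ℝ (basisVector j))
          (fderiv ℝ (fiberEnergy Ω ω P) ((2 * Real.pi) • ξ)) := funext fun ξ => hwm j ξ
      rw [h8]
      refine ((ContinuousLinearMap.apply ℝ ℝ (basisVector j)).hasFDerivAt.comp ξ
        h7).congr_fderiv ?_
      ext y
      simp
    set D := fderiv ℝ (fderiv ℝ (fiberEnergy Ω ω P)) ((2 * Real.pi) • ξ)
    have h9 : |D (basisVector j) (basisVector j)| ≤ ‖D‖ := by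
      have h10 := D.le_opNorm₂ (basisVector j) (basisVector j)
      rwa [hb, mul_one, mul_one] at h10
    rw [h5.fderiv]
    change |(2 * Real.pi) * D (basisVector j) (basisVector j)| ≤ C
    rw [abs_mul, abs_of_nonneg Real.two_pi_pos.le]
    refine (mul_le_mul_of_nonneg_left (h9.trans (h3.trans ?_)) Real.two_pi_pos.le).trans
      (le_max_right _ _)
    nlinarith

end Model

end

theorem mainTheorem3 {ν : ℕ} (s : ℝ) (Ω ω : Space ν → ℝ) (ρ : L2 ν)
    (hΩ : MatterDispersion s Ω) (hω : FieldDispersion s ω) (hρ : CouplingFunction ρ)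
    (P : Space ν) (lam : ℝ) (hlam : lam ∉ thresholdSet Ω ω P) :
    ∃ C : (fiberHamiltonian Ω ω ρ P).domain →ₗ⋆[ℂ] (fiberHamiltonian Ω ω ρ P).domain →ₗ[ℂ] ℂ,
      IsCommutatorExtension (fiberHamiltonian Ω ω ρ P)
        (conjugateOperator (relativeVelocity Ω ω P)) C ∧
      (∀ C', IsCommutatorExtension (fiberHamiltonian Ω ω ρ P)
        (conjugateOperator (relativeVelocity Ω ω P)) C' → C' = C) ∧
      ∃ E : ProjectionValuedMeasure (FiberSpace ν),
        IsSpectralMeasure (fiberHamiltonian Ω ω ρ P) E ∧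
        ∃ κ > (0 : ℝ), ∃ c > (0 : ℝ), ∃ K T : FiberSpace ν →L[ℂ] FiberSpace ν,
          IsCompactOperator K ∧
          IsSandwich (fiberHamiltonian Ω ω ρ P) C (E.proj (Set.Icc (lam - κ) (lam + κ))) T ∧
          (c : ℂ) • E.proj (Set.Icc (lam - κ) (lam + κ)) + K ≤ T := by
  have hH : fiberHamiltonian Ω ω ρ P = (interactionL ρ : FiberSpace ν →ₗ[ℂ] FiberSpace ν) +ᵥ
      diagonal (Ω P : ℂ) (multiplier (fiberEnergy Ω ω P)) := by
    rw [coe_interactionL]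
    rfl
  rw [hH]
  set m := fiberEnergy Ω ω P with hmdef
  set v := relativeVelocity Ω ω P with hvdef
  let w : Fin ν → Space ν → ℝ := fun j ξ => fderiv ℝ m ((2 * Real.pi) • ξ) (basisVector j)
  have hm := contDiff_fiberEnergy hΩ hω P
  have hm0 := fiberEnergy_nonneg hΩ hω P
  have hmm : Measurable m := hm.continuous.measurable
  have hgrad : ∀ k j, v k j = fderiv ℝ m k (basisVector j) := fun k j => by
    rw [← inner_gradient_basisVector, gradient_fiberEnergy hΩ hω]
  have hw : ∀ j, (w j).HasTemperateGrowth := fun j =>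
    (hasTemperateGrowth_fderiv_apply (hasTemperateGrowth_fderiv_fiberEnergy hΩ hω P)
      (basisVector j)).comp
        (((2 * Real.pi) • ContinuousLinearMap.id ℝ (Space ν)).hasTemperateGrowth)
  have hv : ∀ j ξ, v ((2 * Real.pi) • ξ) j = w j ξ := fun j ξ => hgrad _ j
  have hq : ∀ ξ, ‖v ((2 * Real.pi) • ξ)‖ ^ 2 = ∑ j, w j ξ ^ 2 := fun ξ => by
    rw [EuclideanSpace.real_norm_sq_eq]
    simp only [hv]
  have hqm : Measurable fun k => ‖v k‖ ^ 2 := by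
    have h1 : (fun k => ‖v k‖ ^ 2) = fun k => ‖fderiv ℝ m k‖ ^ 2 := by
      funext k
      rw [← norm_gradient, gradient_fiberEnergy hΩ hω]
    rw [h1]
    exact ((hm.continuous_fderiv (by simp)).norm.pow 2).measurable
  have hq0 : ∀ k, 0 ≤ ‖v k‖ ^ 2 := fun k => sq_nonneg _
  obtain ⟨A, hA, hqA⟩ := sq_norm_relativeVelocity_le hΩ hω P
  obtain ⟨κ, hκ, c, hc, hle⟩ := exists_le_sq_norm_relativeVelocity hΩ hω P hlam
  obtain ⟨τ, hτ⟩ := exists_adjoint_couplingFunction hΩ hω hρ P hw (fun _ _ => rfl) hv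
  obtain ⟨E, hE, K, T, hK, ⟨hp, hT⟩, hpos⟩ := exists_mourre_estimate (e := Ω P) (lam := lam)
    (hΩ.nonneg P) hmm hm0 hqm hq0 hqA (isCompactOperator_interactionL ρ)
    (isSelfAdjoint_interactionL ρ) (isCompactOperator_interactionCommutator τ) hκ hle
  have hC := isCommutatorExtension_commutatorForm (e := Ω P) hw hv (hm.of_le (by simp)) hm0
    (fun _ _ => rfl) hqm hq hq0 hA hqA hτ
  refine ⟨_, hC, fun C' hC' => hC.unique hC' (exists_seq_core hm hm0), E, hE, κ, hκ, c, hc, K, T,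
    hK, ⟨hp, fun u y => ?_⟩, hpos⟩
  have h1 : ((interactionL ρ : FiberSpace ν →ₗ[ℂ] FiberSpace ν) +ᵥ
      diagonal (Ω P : ℂ) (multiplier m)) ⟨_, hp y⟩
        = interactionL ρ (E.proj (Icc (lam - κ) (lam + κ)) y)
          + diagonal (Ω P : ℂ) (multiplier m) ⟨_, hp y⟩ := rfl
  rw [hT, commutatorForm_apply, h1, add_sub_cancel_left]
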